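/- Let $b:\mathbb{R}_+\to\mathbb{R}$, $b\in L^1_{\mathrm{loc}}(\mathbb{R}_+)$, $b\neq 0$, be of subexponential growth, that is, $\int_0^\infty e^{-\varepsilon t}|b(t)|\,dt<\infty$ for all $\varepsilon>0$, and let $\hat b(\lambda)=\int_0^\infty e^{-\lambda t}b(t)\,dt$, $\mathrm{Re}\,\lambda>0$, be its Laplace transform. Suppose that: (a) $b$ is 2-regular: there is $C>0$ with $|\lambda|^j|\hat b^{(j)}(\lambda)|\le C|\hat b(\lambda)|$ for all $\mathrm{Re}\,\lambda>0$ and $0\le j\le 2$; (b) $b$ is sectorial of angle less than $\pi/2$: $\sup\{|\arg\hat b(\lambda)|:\mathrm{Re}\,\lambda>0\}<\pi/2$; (c) the boundary function $g(k)=\lim_{\varepsilon\downarrow 0}\hat b(\varepsilon+ik)$, $k\in\mathbb{R}\setminus\{0\}$, is twice continuously differentiable on $(0,\infty)$ with $g''$ locally absolutely continuous there (so that $g'''$ exists almost everywhere), and $k\mapsto g(k)/(|k|+|g(k)|)$ belongs to $L^p(\mathbb{R})$ for some $1\le p<\infty$; (d) for some $1<\rho<2$ there is $C>0$ such that for all $\mu>0$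 $$\int_0^\infty\frac{|g(k)|}{(|k|+\mu|g(k)|)^2}\,dk\le \frac{C}{\mu},\qquad \int_0^\infty\frac{|k^2g'''(k)|+|kg''(k)|+|g'(k)|+1/\mu}{(|k|+\mu|g(k)|)^2}\,dk\le\frac{C}{\mu^{1+1/\rho}}.$$ For $\mu>0$ let $s_\mu:[0,\infty)\to\mathbb{R}$ be the continuous solution of $$\dot s_\mu(t)+\mu\int_0^t b(t-\tau)s_\mu(\tau)\,d\tau=0,\quad t>0,\qquad s_\mu(0)=1.$$ Then $\dot s_\mu$ is locally absolutely continuous on $(0,\infty)$ (so that $\ddot s_\mu$ exists almost everywhere), and there exists $C_0>0$, independent of $\mu$, such that for all $\mu>0$ $$\|s_\mu\|_{L^\infty(\mathbb{R}_+)}\le 1,\qquad \|s_\mu\|_{L^1(\mathbb{R}_+)}\le C_0\mu^{-1/\rho},$$ $$\|\dot s_\mu\|_{L^1(\mathbb{R}_+)}+\|t\ddot s_\mu\|_{L^1(\mathbb{R}_+)}\le C_0,\qquad \|t\dot s_\mu\|_{L^1(\mathbb{R}_+)}+\|t^2\ddot s_\mu\|_{L^1(\mathbb{R}_+)}\le C_0\mu^{-1/\rho}.$$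 -/

import Mathlib

open MeasureTheory Set Filter Topology
open scoped ENNReal

noncomputable section

namespace Volterra

/-- The Laplace transform `∫₀^∞ e^{-λt} b(t) dt` of a real kernel (used for `Re λ > 0`). -/
def laplace (b : ℝ → ℝ) (z : ℂ) : ℂ :=
  ∫ t in Ioi (0 : ℝ), Complex.exp (-(z * t)) * (b t : ℂ)

/-- The kernel is of subexponential growth: `∫₀^∞ e^{-εt} |b(t)| dt < ∞` for every `ε > 0`. -/
def SubexponentialGrowth (b : ℝ → ℝ) : Prop :=
  ∀ ε : ℝ, 0 < ε → IntegrableOn (fun t => Real.exp (-(ε * t)) * b t) (Ioi 0)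

/-- `n`-regularity: `|λ|^j |b̂^{(j)}(λ)| ≤ C |b̂(λ)|` for `Re λ > 0` and `0 ≤ j ≤ n`. -/
def IsRegular (n : ℕ) (b : ℝ → ℝ) : Prop :=
  ∃ C : ℝ, 0 < C ∧ ∀ z : ℂ, 0 < z.re → ∀ j : ℕ, j ≤ n →
    ‖z‖ ^ j * ‖iteratedDeriv j (laplace b) z‖ ≤ C * ‖laplace b z‖

/-- Sectoriality of angle less than `π/2`: `sup {|arg b̂(λ)| : Re λ > 0} < π/2`. -/
def IsSectorial (b : ℝ → ℝ) : Prop :=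
  ∃ θ : ℝ, θ < Real.pi / 2 ∧ ∀ z : ℂ, 0 < z.re → |(laplace b z).arg| ≤ θ

/-- The boundary function `g(k) = lim_{ε ↓ 0} b̂(ε + ik)`. -/
def boundary (b : ℝ → ℝ) (k : ℝ) : ℂ :=
  limUnder (𝓝[>] (0 : ℝ)) fun ε : ℝ => laplace b ((ε : ℂ) + (k : ℂ) * Complex.I)

/-- The standing assumption on the convolution kernel, with exponent `ρ`. The integral bounds are
stated with `[0, ∞]`-valued integrals, so that they include the finiteness of the integrals. -/
structure KernelAssumption (b : ℝ → ℝ) (ρ : ℝ) : Prop where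
  locallyIntegrable : LocallyIntegrableOn b (Ici 0)
  ne_zero : ¬ b =ᵐ[volume.restrict (Ioi 0)] 0
  subexponential : SubexponentialGrowth b
  regular : IsRegular 2 b
  sectorial : IsSectorial b
  /-- The limit defining `g(k)` exists away from the origin. -/
  tendsto_boundary : ∀ k : ℝ, k ≠ 0 →
    Tendsto (fun ε : ℝ => laplace b ((ε : ℂ) + (k : ℂ) * Complex.I)) (𝓝[>] 0)
      (𝓝 (boundary b k))
  /-- `g` is three times differentiable on `(0, ∞)` in the weak sense (`g` is twice continuously
  differentiable and `g''` is locally absolutely continuous), so that `g'''` makes sense a.e. -/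
  contDiffOn_boundary : ContDiffOn ℝ 2 (boundary b) (Ioi 0)
  absCont_boundary : ∀ x y : ℝ, 0 < x → x ≤ y →
    AbsolutelyContinuousOnInterval (iteratedDeriv 2 (boundary b)) x y
  memLp : ∃ p : ℝ≥0∞, 1 ≤ p ∧ p < ∞ ∧
    MemLp (fun k : ℝ => boundary b k / ((|k| + ‖boundary b k‖ : ℝ) : ℂ)) p volume
  one_lt : 1 < ρ
  lt_two : ρ < 2
  growth : ∃ C : ℝ, 0 < C ∧ ∀ μ : ℝ, 0 < μ →
    (∫⁻ k in Ioi (0 : ℝ), ENNReal.ofReal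
        (‖boundary b k‖ / (|k| + μ * ‖boundary b k‖) ^ 2)) ≤ ENNReal.ofReal (C / μ) ∧
    (∫⁻ k in Ioi (0 : ℝ), ENNReal.ofReal
        ((‖(k : ℂ) ^ 2 * iteratedDeriv 3 (boundary b) k‖
            + ‖(k : ℂ) * iteratedDeriv 2 (boundary b) k‖
            + ‖deriv (boundary b) k‖ + 1 / μ) / (|k| + μ * ‖boundary b k‖) ^ 2))
      ≤ ENNReal.ofReal (C / μ ^ (1 + 1 / ρ))

/-- `s` solves `ṡ(t) + μ ∫₀^t b(t-τ) s(τ) dτ = 0` for `t > 0`, is continuous on `[0, ∞)`, and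
`s(0) = 1`. -/
structure IsScalarSolution (b : ℝ → ℝ) (μ : ℝ) (s : ℝ → ℝ) : Prop where
  continuousOn : ContinuousOn s (Ici 0)
  initial : s 0 = 1
  equation : ∀ t : ℝ, 0 < t →
    HasDerivAt s (-(μ * ∫ τ in (0 : ℝ)..t, b (t - τ) * s τ)) t

/-- The norm of `L^p(ℝ₊)`, with values in `[0, ∞]`. -/
def normLp (p : ℝ≥0∞) (f : ℝ → ℝ) : ℝ≥0∞ :=
  eLpNorm f p (volume.restrict (Ioi 0))

end Volterra

end

/-! Write σ(z) = 1/(z + μ b̂(z)), the Laplace transform of the solution. The four functions s, s', t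
s', t s'' have transforms σ, zσ - 1, -(σ + zσ') and 1 - 2zσ - z²σ'. An L¹ bound for a function U on
the half-line comes from Hardy's inequality: if v is supported on (0, ∞), then ∫ |v(t)|/t dt is at
most a constant times the L¹ norm of v̂. With v = tU this bounds ∫ |U| by the total variation of k ↦
Û(ik). Hence the theorem reduces to estimating derivatives of boundary functions built from σ.

For these derivatives put S = |k| + μ|g(k)|. Sectoriality makes |ik + μg| comparable to S, and
regularity gives |k|·|1 + μx₁| ≲ S, where x₁ = -i g' is the derivative of b̂ on the axis. For s' and
t s'' the derivatives cancel so that they are bounded by μ|g|/S², the first integrand in (d). For s,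
t s' and t² s'' the bound is μ times the second integrand. Integrating gives O(1) and O(μ^(-1/ρ))
respectively. The algebra is collected in `SymbolData`.

Two derivatives of b̂ are controlled in the open half-plane, while g''' is controlled only on the
axis. For this reason Hardy's inequality is not applied to derivatives of transforms but to finite
differences, that is, to (e^{-iδt} - 1)^j U(t), and δ is sent to 0 afterwards. Differences are
dominated uniformly as the vertical line approaches the axis, because the transforms are
O(|z|^(-1/2)) and their derivatives O(|z|^(-2)) for |z| ≥ 1. First differences give
`lintegral_norm_le_of_boundary_variation`; second differences, applied to U = t s'', give
`lintegral_mul_norm_le_of_boundary_variation` and thereby the weight t².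

Hardy's inequality is proved for polynomials on the circle (`sum_norm_coeff_div_le`) by factoring
into two square-summable power series and using Hilbert's inequality, then carried to the line by
sampling and Fejér means (`lintegral_norm_div_le`).

The sup bound is an energy estimate: Re b̂ ≥ 0 makes b of positive type
(`integral_mul_convolution_nonneg`), so s² cannot exceed its initial value. It also shows that s has
a Laplace transform at all, from which `IsScalarSolution.solutionTransforms` derives the formulas
above and the absolute continuity of s'. -/

noncomputable section

/-! ### Hardy's inequality for polynomials on the unit circle. -/

namespace Volterra

/-- The `n`-th Taylor coefficient at the origin. -/
def taylorCoef (f : ℂ → ℂ) (n : ℕ) : ℂ := ((n.factorial : ℂ))⁻¹ * iteratedDeriv n f 0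

/-- By Cauchy's formula the Fourier coefficients of nonnegative index on the circle of radius r are
the Taylor coefficients times r^n; Parseval then gives the bound after dropping the other terms. -/
theorem sum_sq_taylorCoef_le {f : ℂ → ℂ} (hf : DifferentiableOn ℂ f (Metric.ball 0 1)) {r : ℝ}
    (hr : 0 < r) (hr1 : r < 1) (N : ℕ) :
    ∑ n ∈ Finset.range N, ‖taylorCoef f n‖ ^ 2 * r ^ (2 * n) ≤
      (2 * Real.pi)⁻¹ * ∫ θ in (0 : ℝ)..2 * Real.pi, ‖f (circleMap 0 r θ)‖ ^ 2 := by
  have hpi := Real.two_pi_pos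
  have hsub : Metric.closedBall (0 : ℂ) r ⊆ Metric.ball 0 1 := Metric.closedBall_subset_ball hr1
  have hcl : DiffContOnCl ℂ f (Metric.ball 0 r) := by
    apply DifferentiableOn.diffContOnCl
    rw [closure_ball _ hr.ne']
    exact hf.mono hsub
  have hcont : Continuous fun θ : ℝ => f (circleMap 0 r θ) :=
    hf.continuousOn.comp_continuous (continuous_circleMap 0 r) fun θ =>
      hsub (circleMap_mem_closedBall 0 hr.le θ)
  have hL2 : MemLp (fun θ : ℝ => f (circleMap 0 r θ)) 2 (volume.restrict (Ioc 0 (2 * Real.pi))) := by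
    obtain ⟨C, hC⟩ := (isCompact_Icc (a := (0 : ℝ)) (b := 2 * Real.pi)).exists_bound_of_continuousOn
      hcont.continuousOn
    refine MemLp.of_bound hcont.aestronglyMeasurable C ?_
    filter_upwards [ae_restrict_mem measurableSet_Ioc] with x hx
    exact hC x (Ioc_subset_Icc_self hx)
  have hsum := hasSum_sq_fourierCoeffOn hpi hL2
  have hcoef : ∀ n : ℕ, fourierCoeffOn hpi (fun θ : ℝ => f (circleMap 0 r θ)) (n : ℤ)
      = taylorCoef f n * r ^ n := by
    intro n
    have h1 := hcl.circleIntegral_one_div_sub_center_pow_smul hr n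
    rw [fourierCoeffOn_eq_integral, taylorCoef]
    rw [circleIntegral] at h1
    have h2 : (∫ θ in (0 : ℝ)..2 * Real.pi, deriv (circleMap 0 r) θ •
        (1 / (circleMap 0 r θ - 0) ^ (n + 1)) • f (circleMap 0 r θ)) =
        (Complex.I / r ^ n) * ∫ θ in (0 : ℝ)..2 * Real.pi,
          fourier (-(n : ℤ)) (θ : AddCircle (2 * Real.pi - 0)) • f (circleMap 0 r θ) := by
      rw [← intervalIntegral.integral_const_mul]
      congr 1 with θ
      have hne : Complex.exp (θ * Complex.I) ≠ 0 := Complex.exp_ne_zero _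
      have hrc : (r : ℂ) ≠ 0 := by exact_mod_cast hr.ne'
      have e1 : (fourier (-(n : ℤ)) (θ : AddCircle (2 * Real.pi - 0)) : ℂ)
          = (Complex.exp (θ * Complex.I) ^ n)⁻¹ := by
        rw [fourier_coe_apply, ← Complex.exp_nat_mul, ← Complex.exp_neg]
        congr 1
        have : (Real.pi : ℂ) ≠ 0 := by exact_mod_cast Real.pi_ne_zero
        push_cast
        field_simp
        ring
      rw [e1]
      simp only [deriv_circleMap, circleMap, smul_eq_mul, sub_zero, zero_add]
      field_simp
      ring
    rw [h2] at h1
    have hrc : (r : ℂ) ≠ 0 := by exact_mod_cast hr.ne'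
    have hI := Complex.I_ne_zero
    have hpc : (Real.pi : ℂ) ≠ 0 := by exact_mod_cast Real.pi_ne_zero
    have hfac : (n.factorial : ℂ) ≠ 0 := by exact_mod_cast n.factorial_ne_zero
    set J := ∫ θ in (0 : ℝ)..2 * Real.pi,
          fourier (-(n : ℤ)) (θ : AddCircle (2 * Real.pi - 0)) • f (circleMap 0 r θ) with hJ
    have h3 : J = (2 * Real.pi / n.factorial) * iteratedDeriv n f 0 * r ^ n := by
      rw [smul_eq_mul] at h1
      field_simp at h1 ⊢
      linear_combination h1
    rw [h3, Complex.real_smul]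
    push_cast
    field_simp
    ring
  rw [sub_zero, smul_eq_mul] at hsum
  have h4 : ∑ n ∈ Finset.range N, ‖taylorCoef f n‖ ^ 2 * r ^ (2 * n) =
      ∑ i ∈ (Finset.range N).map (Nat.castEmbedding (R := ℤ)),
        ‖fourierCoeffOn hpi (fun θ : ℝ => f (circleMap 0 r θ)) i‖ ^ 2 := by
    rw [Finset.sum_map]
    refine Finset.sum_congr rfl fun n _ => ?_
    simp only [Nat.castEmbedding_apply]
    rw [hcoef, norm_mul, mul_pow, norm_pow, Complex.norm_real, Real.norm_of_nonneg hr.le, ← pow_mul,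
      mul_comm n 2]
  rw [h4]
  exact sum_le_hasSum _ (fun i _ => by positivity) hsum

theorem taylorCoef_mul {f g : ℂ → ℂ} (hf : DifferentiableOn ℂ f (Metric.ball 0 1))
    (hg : DifferentiableOn ℂ g (Metric.ball 0 1)) (n : ℕ) :
    taylorCoef (f * g) n = ∑ i ∈ Finset.range (n + 1), taylorCoef f i * taylorCoef g (n - i) := by
  have h0 : (0 : ℂ) ∈ Metric.ball (0 : ℂ) 1 := by simp
  have hf' : ContDiffWithinAt ℂ n f univ 0 :=
    ((hf.analyticAt (Metric.isOpen_ball.mem_nhds h0)).contDiffAt).contDiffWithinAt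
  have hg' : ContDiffWithinAt ℂ n g univ 0 :=
    ((hg.analyticAt (Metric.isOpen_ball.mem_nhds h0)).contDiffAt).contDiffWithinAt
  have := iteratedDerivWithin_mul (mem_univ (0 : ℂ)) uniqueDiffOn_univ hf' hg'
  simp only [iteratedDerivWithin_univ] at this
  unfold taylorCoef
  rw [this, Finset.mul_sum]
  refine Finset.sum_congr rfl fun i hi => ?_
  have hi' : i ≤ n := by simpa [Nat.lt_succ_iff] using hi
  rw [Nat.cast_choose ℂ hi']
  have h1 : (n.factorial : ℂ) ≠ 0 := by exact_mod_cast n.factorial_ne_zero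
  have h2 : (i.factorial : ℂ) ≠ 0 := by exact_mod_cast i.factorial_ne_zero
  have h3 : ((n - i).factorial : ℂ) ≠ 0 := by exact_mod_cast (n - i).factorial_ne_zero
  field_simp

theorem taylorCoef_polynomial (P : Polynomial ℂ) (n : ℕ) :
    taylorCoef (fun z => P.eval z) n = P.coeff n := by
  have key : ∀ n : ℕ, iteratedDeriv n (fun z => P.eval z) =
      fun z => (Polynomial.derivative^[n] P).eval z := by
    intro n
    induction n with
    | zero => simp
    | succ k ih =>
      rw [iteratedDeriv_succ, ih]
      ext z
      rw [Polynomial.deriv, Function.iterate_succ_apply']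
  have h1 : (n.factorial : ℂ) ≠ 0 := by exact_mod_cast n.factorial_ne_zero
  rw [taylorCoef, key]
  simp only
  rw [← Polynomial.coeff_zero_eq_eval_zero, Polynomial.coeff_iterate_derivative]
  simp [Nat.descFactorial_self, h1]

theorem taylorCoef_congr {f g : ℂ → ℂ} (h : EqOn f g (Metric.ball 0 1)) (n : ℕ) :
    taylorCoef f n = taylorCoef g n := by
  have : f =ᶠ[𝓝 0] g := h.eventuallyEq_of_mem (Metric.ball_mem_nhds _ one_pos)
  rw [taylorCoef, taylorCoef, this.iteratedDeriv_eq]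

/-- The row estimate in Schur's test for the Hilbert matrix 1/(j + k + 1) with weight (k +
1)^(-1/2). For k ≤ j the first factor is at most 1/(j + 1) and the sum of inverse square roots
remains; for k > j the term is at most (k + 1)^(-3/2), which telescopes. -/
theorem sum_one_div_mul_sqrt_le (j N : ℕ) :
    ∑ k ∈ Finset.range N, 1 / (((j : ℝ) + k + 1) * √(k + 1)) ≤ 4 / √(j + 1) := by
  have hpos : ∀ x : ℕ, (0 : ℝ) < √(x + 1) := fun x => Real.sqrt_pos.2 (by positivity)
  have hsq : ∀ x : ℕ, √((x : ℝ) + 1) * √((x : ℝ) + 1) = x + 1 := fun x =>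
    Real.mul_self_sqrt (by positivity)
  have A : ∀ N : ℕ, ∑ k ∈ Finset.range N, 1 / √((k : ℝ) + 1) ≤ 2 * √N := by
    intro N
    induction N with
    | zero => simp
    | succ n ih =>
      rw [Finset.sum_range_succ]
      push_cast
      have h1 := hpos n
      have h2 := hsq n
      have h3 : √(n : ℝ) * √(n : ℝ) = n := Real.mul_self_sqrt (by positivity)
      have h4 : 1 / √((n : ℝ) + 1) ≤ 2 * √((n : ℝ) + 1) - 2 * √n := by
        rw [div_le_iff₀ h1]
        nlinarith [sq_nonneg (√((n : ℝ) + 1) - √n)]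
      linarith
  have B : ∀ M : ℕ, M ≤ j + 1 →
      ∑ k ∈ Finset.range M, 1 / (((j : ℝ) + k + 1) * √(k + 1)) ≤ 2 / √(j + 1) := by
    intro M hM
    calc ∑ k ∈ Finset.range M, 1 / (((j : ℝ) + k + 1) * √(k + 1))
        ≤ ∑ k ∈ Finset.range M, (1 / ((j : ℝ) + 1)) * (1 / √((k : ℝ) + 1)) := by
          refine Finset.sum_le_sum fun k _ => ?_
          rw [← one_div_mul_one_div]
          have := hpos k
          gcongr
          linarith [(Nat.cast_nonneg k : (0 : ℝ) ≤ k)]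
      _ = (1 / ((j : ℝ) + 1)) * ∑ k ∈ Finset.range M, 1 / √((k : ℝ) + 1) := by
          rw [Finset.mul_sum]
      _ ≤ (1 / ((j : ℝ) + 1)) * (2 * √((j : ℝ) + 1)) := by
          gcongr
          refine (A M).trans ?_
          gcongr
          exact_mod_cast hM
      _ = 2 / √(j + 1) := by
          have h1 := hpos j
          have h2 := hsq j
          rw [div_mul_eq_mul_div, one_mul, div_eq_div_iff (by positivity) (by positivity)]
          linear_combination 2 * h2
  rcases le_total N (j + 1) with hN | hN
  · refine (B N hN).trans ?_
    have := hpos j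
    gcongr
    norm_num
  · have C : ∀ m : ℕ, ∑ k ∈ Finset.range (j + 1 + m), 1 / (((j : ℝ) + k + 1) * √(k + 1))
        ≤ 4 / √(j + 1) - 2 / √(((j + m : ℕ) : ℝ) + 1) := by
      intro m
      induction m with
      | zero =>
        have := B (j + 1) le_rfl
        have e : 4 / √((j : ℝ) + 1) - 2 / √(((j + 0 : ℕ) : ℝ) + 1) = 2 / √((j : ℝ) + 1) := by
          rw [add_zero]; ring
        rw [e]; exact this
      | succ m ih =>
        rw [← add_assoc, Finset.sum_range_succ]
        have h1 := hpos (j + m)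
        have h2 := hpos (j + 1 + m)
        have h1' := hsq (j + m)
        have h2' := hsq (j + 1 + m)
        have e : ((j + (m + 1) : ℕ) : ℝ) = ((j + 1 + m : ℕ) : ℝ) := by push_cast; ring
        rw [e]
        set a := √(((j + m : ℕ) : ℝ) + 1)
        set c := √(((j + 1 + m : ℕ) : ℝ) + 1)
        have hac : c * c = a * a + 1 := by rw [h1', h2']; push_cast; ring
        have hle : 1 / (((j : ℝ) + ((j + 1 + m : ℕ) : ℝ) + 1) * c) ≤ 1 / (c * c * c) := by
          gcongr
          rw [h2']
          linarith [(Nat.cast_nonneg j : (0 : ℝ) ≤ j)]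
        have hca : a ≤ c := by nlinarith
        have : 1 / (c * c * c) ≤ 2 / a - 2 / c := by
          rw [div_sub_div _ _ h1.ne' h2.ne', div_le_div_iff₀ (by positivity) (by positivity)]
          have h5 : (c - a) * (c + a) = 1 := by linarith
          have h6 : c - a ≥ 1 / (2 * c) := by
            rw [ge_iff_le, div_le_iff₀ (by positivity)]
            nlinarith
          have h7 : (2 * c - a * 2) * (c * c * c) ≥ (2 * (1 / (2 * c))) * (c * c * c) := by
            gcongr
            linarith
          have h8 : (2 * (1 / (2 * c))) * (c * c * c) = c * c := by field_simp
          nlinarith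
        linarith
    obtain ⟨m, rfl⟩ := Nat.exists_eq_add_of_le hN
    refine (C m).trans ?_
    have := hpos (j + m)
    have : 0 ≤ 2 / √(((j + m : ℕ) : ℝ) + 1) := by positivity
    linarith

/-- Hilbert's inequality by Schur's test. The Cauchy product divided by n + 1 is the part j + k < N
of the double sum with Hilbert's matrix. -/
theorem hilbert_inequality {x y : ℕ → ℝ} {M : ℝ} (hx : ∀ n, 0 ≤ x n) (hy : ∀ n, 0 ≤ y n) (N : ℕ)
    (hxM : ∑ n ∈ Finset.range N, x n ^ 2 ≤ M) (hyM : ∑ n ∈ Finset.range N, y n ^ 2 ≤ M) :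
    ∑ n ∈ Finset.range N, (∑ i ∈ Finset.range (n + 1), x i * y (n - i)) / ((n : ℝ) + 1)
      ≤ 4 * M := by
  have hpos : ∀ x : ℕ, (0 : ℝ) < √(x + 1) := fun x => Real.sqrt_pos.2 (by positivity)
  have step1 : ∑ n ∈ Finset.range N, (∑ i ∈ Finset.range (n + 1), x i * y (n - i)) / ((n : ℝ) + 1)
      ≤ ∑ p ∈ Finset.range N ×ˢ Finset.range N, x p.1 * y p.2 / ((p.1 : ℝ) + p.2 + 1) := by
    have e : ∀ n ∈ Finset.range N,
        (∑ i ∈ Finset.range (n + 1), x i * y (n - i)) / ((n : ℝ) + 1) =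
        ∑ p ∈ Finset.HasAntidiagonal.antidiagonal n, x p.1 * y p.2 / ((p.1 : ℝ) + p.2 + 1) := by
      intro n _
      rw [Finset.Nat.sum_antidiagonal_eq_sum_range_succ
        (fun a b => x a * y b / ((a : ℝ) + b + 1)), Finset.sum_div]
      refine Finset.sum_congr rfl fun i hi => ?_
      have hi' : i ≤ n := by simpa [Nat.lt_succ_iff] using hi
      rw [Nat.cast_sub hi']
      congr 1
      ring
    rw [Finset.sum_congr rfl e]
    have e2 : ∑ n ∈ Finset.range N, ∑ p ∈ Finset.HasAntidiagonal.antidiagonal n,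
          x p.1 * y p.2 / ((p.1 : ℝ) + p.2 + 1) =
        ∑ p ∈ (Finset.range N ×ˢ Finset.range N).filter (fun p => p.1 + p.2 ∈ Finset.range N),
          x p.1 * y p.2 / ((p.1 : ℝ) + p.2 + 1) := by
      rw [← Finset.sum_fiberwise_of_maps_to (g := fun p : ℕ × ℕ => p.1 + p.2) (t := Finset.range N)
        (fun p hp => (Finset.mem_filter.1 hp).2)]
      refine Finset.sum_congr rfl fun n hn => Finset.sum_congr ?_ fun _ _ => rfl
      ext p
      simp only [Finset.HasAntidiagonal.mem_antidiagonal, Finset.mem_filter, Finset.mem_product,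
        Finset.mem_range] at hn ⊢
      omega
    rw [e2]
    refine Finset.sum_le_sum_of_subset_of_nonneg (Finset.filter_subset _ _) fun p _ _ => ?_
    have := hx p.1
    have := hy p.2
    positivity
  -- Weighted AM-GM with ratio √(j + 1) : √(k + 1); the difference of the two sides is a square over
  -- a positive quantity.
  have step2 : ∀ p ∈ Finset.range N ×ˢ Finset.range N, x p.1 * y p.2 / ((p.1 : ℝ) + p.2 + 1) ≤
      (x p.1 ^ 2 * √(p.1 + 1) / 2) * (1 / (((p.1 : ℝ) + p.2 + 1) * √(p.2 + 1))) +
      (y p.2 ^ 2 * √(p.2 + 1) / 2) * (1 / (((p.2 : ℝ) + p.1 + 1) * √(p.1 + 1))) := by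
    rintro ⟨j, k⟩ _
    simp only
    have h1 := hpos j
    have h2 := hpos k
    set a := √((j : ℝ) + 1)
    set c := √((k : ℝ) + 1)
    have h3 : (0 : ℝ) < (j : ℝ) + k + 1 := by positivity
    have h4 : (k : ℝ) + j + 1 = (j : ℝ) + k + 1 := by ring
    rw [h4]
    have : (x j ^ 2 * a / 2) * (1 / (((j : ℝ) + k + 1) * c)) +
      (y k ^ 2 * c / 2) * (1 / (((j : ℝ) + k + 1) * a)) - x j * y k / ((j : ℝ) + k + 1)
      = (x j * a - y k * c) ^ 2 / (2 * a * c * ((j : ℝ) + k + 1)) := by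
      field_simp
      ring
    have h5 : 0 ≤ (x j * a - y k * c) ^ 2 / (2 * a * c * ((j : ℝ) + k + 1)) := by positivity
    linarith
  have step3 : ∀ z : ℕ → ℝ, ∑ j ∈ Finset.range N, ∑ k ∈ Finset.range N,
      (z j ^ 2 * √(j + 1) / 2) * (1 / (((j : ℝ) + k + 1) * √(k + 1))) ≤
      2 * ∑ j ∈ Finset.range N, z j ^ 2 := by
    intro z
    rw [Finset.mul_sum]
    refine Finset.sum_le_sum fun j _ => ?_
    rw [← Finset.mul_sum]
    have h1 := hpos j
    calc _ ≤ (z j ^ 2 * √(j + 1) / 2) * (4 / √(j + 1)) := by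
          gcongr
          exact sum_one_div_mul_sqrt_le j N
      _ = 2 * z j ^ 2 := by field_simp; ring
  refine step1.trans ((Finset.sum_le_sum step2).trans ?_)
  rw [Finset.sum_add_distrib, Finset.sum_product, Finset.sum_product_right]
  have := step3 x
  have := step3 y
  linarith

/-- A polynomial `Q` without zeros in the unit disc, with square root `q` there, that dominates `P`
in the disc and has the same modulus on the circle. -/
def HasSqrtMajorant (P : Polynomial ℂ) : Prop :=
  ∃ (Q : Polynomial ℂ) (q : ℂ → ℂ), DifferentiableOn ℂ q (Metric.ball 0 1) ∧
    (∀ z ∈ Metric.ball (0 : ℂ) 1, q z ≠ 0 ∧ q z ^ 2 = Q.eval z) ∧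
    (∀ z : ℂ, ‖z‖ ≤ 1 → ‖P.eval z‖ ≤ ‖Q.eval z‖) ∧
    (∀ z : ℂ, ‖z‖ = 1 → ‖P.eval z‖ = ‖Q.eval z‖)

theorem HasSqrtMajorant.mul {P₁ P₂ : Polynomial ℂ} (h₁ : HasSqrtMajorant P₁)
    (h₂ : HasSqrtMajorant P₂) : HasSqrtMajorant (P₁ * P₂) := by
  obtain ⟨Q₁, q₁, a₁, b₁, c₁, d₁⟩ := h₁
  obtain ⟨Q₂, q₂, a₂, b₂, c₂, d₂⟩ := h₂
  refine ⟨Q₁ * Q₂, q₁ * q₂, a₁.mul a₂, fun z hz => ⟨mul_ne_zero (b₁ z hz).1 (b₂ z hz).1, ?_⟩,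
    fun z hz => ?_, fun z hz => ?_⟩
  · rw [Pi.mul_apply, mul_pow, (b₁ z hz).2, (b₂ z hz).2, Polynomial.eval_mul]
  · rw [Polynomial.eval_mul, Polynomial.eval_mul, norm_mul, norm_mul]
    exact mul_le_mul (c₁ z hz) (c₂ z hz) (norm_nonneg _) (norm_nonneg _)
  · rw [Polynomial.eval_mul, Polynomial.eval_mul, norm_mul, norm_mul, d₁ z hz, d₂ z hz]

theorem hasSqrtMajorant_C {c : ℂ} (hc : c ≠ 0) : HasSqrtMajorant (Polynomial.C c) := by
  obtain ⟨d, hd⟩ := IsAlgClosed.exists_pow_nat_eq c (n := 2) (by norm_num)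
  refine ⟨Polynomial.C c, fun _ => d, differentiableOn_const d, fun z _ => ⟨?_, ?_⟩,
    fun _ _ => le_rfl, fun _ _ => rfl⟩
  · rintro rfl
    exact hc (by simpa using hd.symm)
  · simpa using hd

theorem exists_sqrt_one_sub_mul {w : ℂ} (hw : ‖w‖ ≤ 1) : ∃ q : ℂ → ℂ,
    DifferentiableOn ℂ q (Metric.ball 0 1) ∧
    ∀ z ∈ Metric.ball (0 : ℂ) 1, q z ≠ 0 ∧ q z ^ 2 = 1 - w * z := by
  have hs : ∀ z ∈ Metric.ball (0 : ℂ) 1, 1 - w * z ∈ Complex.slitPlane := by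
    intro z hz
    left
    have hz' : ‖z‖ < 1 := by simpa using hz
    have h1 : ‖w * z‖ < 1 := by
      rw [norm_mul]
      nlinarith [norm_nonneg w, norm_nonneg z]
    have := Complex.re_le_norm (w * z)
    simp only [Complex.sub_re, Complex.one_re]
    linarith
  refine ⟨fun z => Complex.exp (Complex.log (1 - w * z) / 2), ?_, fun z hz =>
    ⟨Complex.exp_ne_zero _, ?_⟩⟩
  · refine DifferentiableOn.cexp (DifferentiableOn.div_const ?_ _)
    exact DifferentiableOn.clog (by fun_prop) hs
  · rw [← Complex.exp_nat_mul, Nat.cast_ofNat, mul_div_cancel₀ _ (two_ne_zero),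
      Complex.exp_log (Complex.slitPlane_ne_zero (hs z hz))]

/-- A root inside the disc is reflected: z - a is replaced by 1 - āz, which is z - a divided by a
Blaschke factor. A root outside or on the circle is kept, with z - a = -a(1 - z/a). In both cases 1
- wz with |w| ≤ 1 has a holomorphic square root in the disc. -/
theorem hasSqrtMajorant_X_sub_C (a : ℂ) : HasSqrtMajorant (Polynomial.X - Polynomial.C a) := by
  rcases lt_or_ge ‖a‖ 1 with ha | ha
  · obtain ⟨q, hq, hq'⟩ := exists_sqrt_one_sub_mul (w := (starRingEnd ℂ) a) (by simpa using ha.le)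
    have key : ∀ z : ℂ, ‖1 - (starRingEnd ℂ) a * z‖ ^ 2 - ‖z - a‖ ^ 2 =
        (1 - ‖a‖ ^ 2) * (1 - ‖z‖ ^ 2) := by
      intro z
      simp only [← Complex.normSq_eq_norm_sq, Complex.normSq_apply]
      simp
      ring
    refine ⟨1 - Polynomial.C ((starRingEnd ℂ) a) * Polynomial.X, q, hq, fun z hz => ?_,
      fun z hz => ?_, fun z hz => ?_⟩
    · simpa using hq' z hz
    · have h1 := key z
      have : 0 ≤ (1 - ‖a‖ ^ 2) * (1 - ‖z‖ ^ 2) :=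
        mul_nonneg (by nlinarith [norm_nonneg a]) (by nlinarith [norm_nonneg z])
      simp only [Polynomial.eval_sub, Polynomial.eval_X, Polynomial.eval_C, Polynomial.eval_one,
        Polynomial.eval_mul]
      exact le_of_sq_le_sq (by linarith) (norm_nonneg _)
    · have h1 := key z
      rw [hz] at h1
      simp only [Polynomial.eval_sub, Polynomial.eval_X, Polynomial.eval_C, Polynomial.eval_one,
        Polynomial.eval_mul]
      exact (sq_eq_sq₀ (norm_nonneg _) (norm_nonneg _)).1 (by linarith)
  · have ha0 : a ≠ 0 := by
      rintro rfl
      simp at ha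
      linarith
    obtain ⟨q, hq, hq'⟩ := exists_sqrt_one_sub_mul (w := a⁻¹) (by
      rw [norm_inv]; exact inv_le_one_of_one_le₀ ha)
    obtain ⟨d, hd⟩ := IsAlgClosed.exists_pow_nat_eq (-a) (n := 2) (by norm_num)
    refine ⟨Polynomial.X - Polynomial.C a, fun z => d * q z, hq.const_mul d, fun z hz => ⟨?_, ?_⟩,
      fun _ _ => le_rfl, fun _ _ => rfl⟩
    · refine mul_ne_zero ?_ (hq' z hz).1
      rintro rfl
      exact ha0 (by simpa using hd.symm)
    · rw [mul_pow, hd, (hq' z hz).2]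
      simp
      field_simp
      ring

theorem hasSqrtMajorant_of_ne_zero {P : Polynomial ℂ} (hP : P ≠ 0) : HasSqrtMajorant P := by
  rw [(IsAlgClosed.splits P).eq_prod_roots]
  refine (hasSqrtMajorant_C (Polynomial.leadingCoeff_ne_zero.2 hP)).mul ?_
  induction P.roots using Multiset.induction with
  | empty => simpa using hasSqrtMajorant_C one_ne_zero
  | cons a s ih =>
    rw [Multiset.map_cons, Multiset.prod_cons]
    exact (hasSqrtMajorant_X_sub_C a).mul ih

/-- **Hardy's inequality** for polynomials. -/
theorem sum_norm_coeff_div_le (P : Polynomial ℂ) (N : ℕ) :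
    ∑ n ∈ Finset.range N, ‖P.coeff n‖ / ((n : ℝ) + 1) ≤
      4 * ((2 * Real.pi)⁻¹ * ∫ θ in (0 : ℝ)..2 * Real.pi, ‖P.eval (circleMap 0 1 θ)‖) := by
  have hpi := Real.two_pi_pos
  by_cases hP : P = 0
  · simp [hP]
  obtain ⟨Q, q, hq, hqQ, hPQ, hPQ1⟩ := hasSqrtMajorant_of_ne_zero hP
  -- P = q·p with |q|² = |Q| and |p|² ≤ |Q|, so both factors have Taylor coefficients whose squares
  -- are controlled by the circle means of |Q|. The coefficients of P are Cauchy products, to which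
  -- Hilbert's inequality applies.
  set p : ℂ → ℂ := fun z => P.eval z / q z with hp_def
  have hp : DifferentiableOn ℂ p (Metric.ball 0 1) :=
    (P.differentiable.differentiableOn).div hq fun z hz => (hqQ z hz).1
  have hcoef : ∀ n, P.coeff n = ∑ i ∈ Finset.range (n + 1), taylorCoef q i * taylorCoef p (n - i) := by
    intro n
    rw [← taylorCoef_mul hq hp, ← taylorCoef_polynomial]
    refine taylorCoef_congr (fun z hz => ?_) n
    simp only [Pi.mul_apply, hp_def]
    rw [mul_div_cancel₀ _ (hqQ z hz).1]
  have hqn : ∀ z ∈ Metric.ball (0 : ℂ) 1, ‖q z‖ ^ 2 ≤ ‖Q.eval z‖ := fun z hz => by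
    rw [← norm_pow, (hqQ z hz).2]
  have hpn : ∀ z ∈ Metric.ball (0 : ℂ) 1, ‖p z‖ ^ 2 ≤ ‖Q.eval z‖ := by
    intro z hz
    have h1 : 0 < ‖q z‖ := norm_pos_iff.2 (hqQ z hz).1
    have h2 : ‖q z‖ ^ 2 = ‖Q.eval z‖ := by rw [← norm_pow, (hqQ z hz).2]
    have h3 := hPQ z (by simpa using (Metric.mem_ball.1 hz).le)
    simp only [hp_def, norm_div, div_pow]
    rw [h2, div_le_iff₀ (by rw [← h2]; positivity)]
    nlinarith [norm_nonneg (P.eval z)]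
  set I : ℝ → ℝ := fun r => (2 * Real.pi)⁻¹ * ∫ θ in (0 : ℝ)..2 * Real.pi, ‖Q.eval (circleMap 0 r θ)‖
  have hIcont : Continuous I := by
    refine continuous_const.mul ?_
    refine intervalIntegral.continuous_parametric_intervalIntegral_of_continuous'
      (f := fun r θ => ‖Q.eval (circleMap 0 r θ)‖) ?_ _ _
    refine (Q.continuous.comp ?_).norm
    simp only [circleMap]
    fun_prop
  have hle : ∀ f : ℂ → ℂ, DifferentiableOn ℂ f (Metric.ball 0 1) →
      (∀ z ∈ Metric.ball (0 : ℂ) 1, ‖f z‖ ^ 2 ≤ ‖Q.eval z‖) → ∀ r : ℝ, 0 < r → r < 1 →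
      ∑ n ∈ Finset.range N, (‖taylorCoef f n‖ * r ^ n) ^ 2 ≤ I r := by
    intro f hf hfQ r hr hr1
    have h1 := sum_sq_taylorCoef_le hf hr hr1 N
    have hmem : ∀ θ : ℝ, circleMap 0 r θ ∈ Metric.ball (0 : ℂ) 1 := fun θ =>
      Metric.closedBall_subset_ball hr1 (circleMap_mem_closedBall 0 hr.le θ)
    have hcont : Continuous fun θ : ℝ => f (circleMap 0 r θ) :=
      hf.continuousOn.comp_continuous (continuous_circleMap 0 r) hmem
    calc _ = ∑ n ∈ Finset.range N, ‖taylorCoef f n‖ ^ 2 * r ^ (2 * n) := by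
          refine Finset.sum_congr rfl fun n _ => ?_
          rw [mul_pow, ← pow_mul, mul_comm n 2]
      _ ≤ _ := h1
      _ ≤ I r := by
          refine mul_le_mul_of_nonneg_left ?_ (by positivity)
          refine intervalIntegral.integral_mono_on hpi.le ?_ ?_ fun θ _ => hfQ _ (hmem θ)
          · exact (hcont.norm.pow 2).intervalIntegrable _ _
          · exact (Q.continuous.comp (continuous_circleMap 0 r)).norm.intervalIntegrable _ _
  have hr : ∀ r : ℝ, 0 < r → r < 1 →
      ∑ n ∈ Finset.range N, ‖P.coeff n‖ * r ^ n / ((n : ℝ) + 1) ≤ 4 * I r := by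
    intro r hr hr1
    refine le_trans ?_ (hilbert_inequality (x := fun n => ‖taylorCoef q n‖ * r ^ n)
      (y := fun n => ‖taylorCoef p n‖ * r ^ n) (fun n => by positivity) (fun n => by positivity) N
      (hle q hq hqn r hr hr1) (hle p hp hpn r hr hr1))
    refine Finset.sum_le_sum fun n _ => ?_
    gcongr
    rw [hcoef]
    calc _ ≤ (∑ i ∈ Finset.range (n + 1), ‖taylorCoef q i * taylorCoef p (n - i)‖) * r ^ n := by
          gcongr
          exact norm_sum_le _ _
      _ = _ := by
          rw [Finset.sum_mul]
          refine Finset.sum_congr rfl fun i hi => ?_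
          have hi' : i ≤ n := by simpa [Nat.lt_succ_iff] using hi
          rw [norm_mul]
          rw [show r ^ n = r ^ i * r ^ (n - i) by rw [← pow_add, Nat.add_sub_cancel' hi']]
          ring
  -- The factors live only in the open disc, so the radius is sent to 1 at the end; there |Q| = |P|.
  have hlim : Tendsto (fun r : ℝ => ∑ n ∈ Finset.range N, ‖P.coeff n‖ * r ^ n / ((n : ℝ) + 1))
      (𝓝[<] 1) (𝓝 (∑ n ∈ Finset.range N, ‖P.coeff n‖ * 1 ^ n / ((n : ℝ) + 1))) := by
    refine Tendsto.mono_left ?_ nhdsWithin_le_nhds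
    exact Continuous.tendsto (f := fun r : ℝ => ∑ n ∈ Finset.range N,
      ‖P.coeff n‖ * r ^ n / ((n : ℝ) + 1)) (by fun_prop) 1
  have hlim2 : Tendsto (fun r => 4 * I r) (𝓝[<] 1) (𝓝 (4 * I 1)) :=
    ((hIcont.const_mul 4).tendsto 1).mono_left nhdsWithin_le_nhds
  have hfin := le_of_tendsto_of_tendsto hlim hlim2 (by
    filter_upwards [Ioo_mem_nhdsLT (zero_lt_one' ℝ)] with r hr'
    exact hr r hr'.1 hr'.2)
  simp only [one_pow, mul_one] at hfin
  have hIeq : I 1 = (2 * Real.pi)⁻¹ * ∫ θ in (0 : ℝ)..2 * Real.pi, ‖P.eval (circleMap 0 1 θ)‖ := by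
    refine congrArg _ (intervalIntegral.integral_congr fun θ _ => ?_)
    exact (hPQ1 _ (by simp)).symm
  rwa [hIeq] at hfin

end Volterra

/-! ### Fourier inversion and a sampled form of Hardy's inequality on the line. -/

namespace Volterra

open FourierTransform

theorem fourierInv_real_eq (w : ℝ → ℂ) (t : ℝ) :
    𝓕⁻ w t = ∫ ξ : ℝ, Complex.exp (((2 * Real.pi * (ξ * t) : ℝ) : ℂ) * Complex.I) * w ξ := by
  rw [Real.fourierInv_eq']
  congr 1 with ξ
  rw [smul_eq_mul]
  congr 4
  simp [mul_comm]

theorem integrable_cexp_mul {w : ℝ → ℂ} (hw : Integrable w) (t : ℝ) :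
    Integrable fun ξ : ℝ => Complex.exp (((2 * Real.pi * (ξ * t) : ℝ) : ℂ) * Complex.I) * w ξ := by
  refine hw.bdd_mul (c := 1) ?_ ?_
  · exact Continuous.aestronglyMeasurable (by fun_prop)
  · filter_upwards with ξ
    rw [Complex.norm_exp_ofReal_mul_I]

theorem continuous_fourierInv {w : ℝ → ℂ} (hw : Integrable w) : Continuous (𝓕⁻ w) := by
  have : 𝓕⁻ w = fun t : ℝ =>
      ∫ ξ : ℝ, Complex.exp (((2 * Real.pi * (ξ * t) : ℝ) : ℂ) * Complex.I) * w ξ := by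
    ext t; exact fourierInv_real_eq w t
  rw [this]
  refine continuous_of_dominated (bound := fun ξ => ‖w ξ‖) (fun t => ?_) (fun t => ?_) hw.norm ?_
  · exact (integrable_cexp_mul hw t).aestronglyMeasurable
  · filter_upwards with ξ
    rw [norm_mul, Complex.norm_exp_ofReal_mul_I, one_mul]
  · filter_upwards with ξ
    fun_prop

theorem integral_fourier_mul_eq {f g : ℝ → ℂ} (hf : Integrable f) (hg : Integrable g) :
    ∫ ξ, 𝓕 f ξ * g ξ = ∫ x, f x * 𝓕 g x := by
  have := VectorFourier.integral_fourierIntegral_smul_eq_flip (L := innerₗ ℝ)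
    (μ := (volume : Measure ℝ)) (ν := (volume : Measure ℝ)) Real.continuous_fourierChar
    (by exact continuous_inner) hf hg
  simpa only [flip_innerₗ, smul_eq_mul] using! this

/-- No continuity of v is available, so inversion is obtained in the sense of distributions: pair
with test functions, move transforms across by the multiplication formula, and invert on Schwartz
functions. -/
theorem ae_eq_fourierInv_fourier {v : ℝ → ℂ} (hv : Integrable v) (hw : Integrable (𝓕 v)) :
    ∀ᵐ t, v t = 𝓕⁻ (𝓕 v) t := by
  refine ae_eq_of_integral_contDiff_smul_eq hv.locallyIntegrable
    (continuous_fourierInv hw).locallyIntegrable fun φ hφ hφc => ?_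
  have hφC : HasCompactSupport fun t => (φ t : ℂ) := hφc.comp_left Complex.ofReal_zero
  have hφd : ContDiff ℝ (↑(⊤ : ℕ∞)) fun t => (φ t : ℂ) := Complex.ofRealCLM.contDiff.comp hφ
  set Φ : SchwartzMap ℝ ℂ := hφC.toSchwartzMap hφd with hΦ
  have hΦe : ∀ t, Φ t = φ t := fun t => rfl
  have h1 : ∀ t, 𝓕⁻ (𝓕 v) t = 𝓕 (fun ξ => 𝓕 v (-ξ)) t := fun t => by
    rw [Real.fourierInv_eq_fourier_comp_neg]
  have h2 : (fun x => 𝓕 (𝓕⁻ (Φ : ℝ → ℂ)) x) = Φ := by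
    ext x
    rw [← SchwartzMap.fourierInv_coe, ← SchwartzMap.fourier_coe]
    simp
  have hiI : Integrable (𝓕⁻ (Φ : ℝ → ℂ)) := by
    rw [← SchwartzMap.fourierInv_coe]
    exact SchwartzMap.integrable _
  have h3 : ∫ t, 𝓕⁻ (𝓕 v) t * Φ t = ∫ t, v t * Φ t := by
    calc ∫ t, 𝓕⁻ (𝓕 v) t * Φ t = ∫ t, 𝓕 (fun ξ => 𝓕 v (-ξ)) t * Φ t := by simp_rw [h1]
      _ = ∫ ξ, 𝓕 v (-ξ) * 𝓕 (Φ : ℝ → ℂ) ξ := integral_fourier_mul_eq hw.comp_neg Φ.integrable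
      _ = ∫ ξ, 𝓕 v ξ * 𝓕 (Φ : ℝ → ℂ) (-ξ) := by
          rw [← integral_neg_eq_self]
          simp
      _ = ∫ ξ, 𝓕 v ξ * 𝓕⁻ (Φ : ℝ → ℂ) ξ := by
          simp_rw [Real.fourierInv_eq_fourier_neg]
      _ = ∫ t, v t * 𝓕 (𝓕⁻ (Φ : ℝ → ℂ)) t := integral_fourier_mul_eq hv hiI
      _ = ∫ t, v t * Φ t := by
          congr 1 with t
          rw [← congrFun h2 t]
  calc ∫ t, φ t • v t = ∫ t, v t * Φ t := by
        congr 1 with t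
        rw [hΦe, Complex.real_smul, mul_comm]
    _ = ∫ t, 𝓕⁻ (𝓕 v) t * Φ t := h3.symm
    _ = _ := by
        congr 1 with t
        rw [hΦe, Complex.real_smul, mul_comm]

/-- The Fejér weight N - n counts the pairs k ≤ j < N with j - k = n. -/
theorem fejer_sum_eq (F : ℕ → ℂ) (N : ℕ) :
    ∑ n ∈ Finset.range N, ((N : ℂ) - n) * F n =
      ∑ j ∈ Finset.range N, ∑ k ∈ Finset.range (j + 1), F (j - k) := by
  induction N with
  | zero => simp
  | succ N ih =>
    rw [Finset.sum_range_succ (fun j => ∑ k ∈ Finset.range (j + 1), F (j - k)), ← ih,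
      Finset.sum_range_succ]
    have h1 : ∑ k ∈ Finset.range (N + 1), F (N - k) = ∑ k ∈ Finset.range (N + 1), F k := by
      rw [← Finset.sum_range_reflect F (N + 1)]
      simp
    rw [h1, Finset.sum_range_succ]
    have h2 : ∑ x ∈ Finset.range N, (((N + 1 : ℕ) : ℂ) - x) * F x =
        ∑ x ∈ Finset.range N, ((N : ℂ) - x) * F x + ∑ x ∈ Finset.range N, F x := by
      rw [← Finset.sum_add_distrib]
      refine Finset.sum_congr rfl fun x _ => ?_
      push_cast
      ring
    rw [h2]
    push_cast
    ring

/-- The modulus squared of the Dirichlet sum, a multiple of the Fejér kernel. -/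
theorem sum_sum_cexp_eq (N : ℕ) (x : ℝ) :
    ∑ j ∈ Finset.range N, ∑ k ∈ Finset.range N,
      Complex.exp ((((j : ℝ) - k) * x : ℝ) * Complex.I) =
      ((‖∑ j ∈ Finset.range N, Complex.exp (((j : ℝ) * x : ℝ) * Complex.I)‖ ^ 2 : ℝ) : ℂ) := by
  push_cast
  rw [← Complex.mul_conj', map_sum, Finset.sum_mul_sum]
  refine Finset.sum_congr rfl fun j _ => Finset.sum_congr rfl fun k _ => ?_
  rw [← Complex.exp_conj, ← Complex.exp_add]
  congr 1
  simp
  ring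

theorem integral_sq_dirichlet (N : ℕ) (c : ℝ) :
    ∫ θ in (0 : ℝ)..2 * Real.pi,
      ‖∑ j ∈ Finset.range N, Complex.exp (((j : ℝ) * (c + θ) : ℝ) * Complex.I)‖ ^ 2 =
      2 * Real.pi * N := by
  have h0 : ∀ j k : ℕ, ∫ θ in (0 : ℝ)..2 * Real.pi,
      Complex.exp ((((j : ℝ) - k) * (c + θ) : ℝ) * Complex.I) = if j = k then 2 * Real.pi else 0 := by
    intro j k
    split_ifs with h
    · subst h
      simp
    · have hjk : (j : ℂ) - k ≠ 0 := by
        rw [sub_ne_zero]; exact_mod_cast h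
      have hne : ((j : ℂ) - k) * Complex.I ≠ 0 := mul_ne_zero hjk Complex.I_ne_zero
      have e : ∀ θ : ℝ, Complex.exp ((((j : ℝ) - k) * (c + θ) : ℝ) * Complex.I) =
          Complex.exp (((j : ℂ) - k) * c * Complex.I) * Complex.exp (((j : ℂ) - k) * Complex.I * θ) := by
        intro θ
        rw [← Complex.exp_add]
        congr 1
        push_cast
        ring
      simp_rw [e]
      rw [intervalIntegral.integral_const_mul, integral_exp_mul_complex hne]
      have : Complex.exp (((j : ℂ) - k) * Complex.I * ((2 * Real.pi : ℝ) : ℂ)) = 1 := by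
        rw [Complex.exp_eq_one_iff]
        refine ⟨(j : ℤ) - k, ?_⟩
        push_cast
        ring
      rw [this]
      simp
  have h1 : ((∫ θ in (0 : ℝ)..2 * Real.pi,
      ‖∑ j ∈ Finset.range N, Complex.exp (((j : ℝ) * (c + θ) : ℝ) * Complex.I)‖ ^ 2 : ℝ) : ℂ)
      = ((2 * Real.pi * N : ℝ) : ℂ) := by
    rw [← intervalIntegral.integral_ofReal]
    simp_rw [← sum_sum_cexp_eq]
    rw [intervalIntegral.integral_finsetSum]
    · have : ∀ j ∈ Finset.range N, ∫ θ in (0 : ℝ)..2 * Real.pi, ∑ k ∈ Finset.range N,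
          Complex.exp ((((j : ℝ) - k) * (c + θ) : ℝ) * Complex.I) = ((2 * Real.pi : ℝ) : ℂ) := by
        intro j hj
        rw [intervalIntegral.integral_finsetSum]
        · simp_rw [h0]
          rw [← Complex.ofReal_sum, Finset.sum_ite_eq, if_pos hj]
        · intro k _
          exact Continuous.intervalIntegrable (by fun_prop) _ _
      rw [Finset.sum_congr rfl this]
      simp [mul_comm]
    · intro j _
      exact Continuous.intervalIntegrable (by fun_prop) _ _
  exact_mod_cast h1

/-- The Fejér sum of the samples is w integrated against a nonnegative kernel, the squared Dirichlet
sum, whose mass in θ is 2πN whatever ξ is. Tonelli then transfers the L¹ norm from the line to the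
circle. -/
theorem integral_norm_fejer_le {w : ℝ → ℂ} (hw : Integrable w) (h0 : ∀ t ≤ 0, 𝓕⁻ w t = 0) (h : ℝ)
    (hh : 0 < h) (N : ℕ) :
    ∫ θ in (0 : ℝ)..2 * Real.pi, ‖∑ n ∈ Finset.range N,
      ((N : ℂ) - n) * (𝓕⁻ w (n * h) * Complex.exp (((n : ℝ) * θ : ℝ) * Complex.I))‖
      ≤ 2 * Real.pi * N * ∫ ξ, ‖w ξ‖ := by
  set D : ℝ → ℝ → ℝ := fun θ ξ =>
    ‖∑ j ∈ Finset.range N, Complex.exp (((j : ℝ) * (2 * Real.pi * (ξ * h) + θ) : ℝ) * Complex.I)‖ ^ 2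
    with hD
  have hDc : Continuous (Function.uncurry D) := by
    simp only [hD, Function.uncurry_def]
    fun_prop
  have hD0 : ∀ θ ξ, 0 ≤ D θ ξ := fun θ ξ => by positivity
  have hDN : ∀ θ ξ, D θ ξ ≤ (N : ℝ) ^ 2 := by
    intro θ ξ
    simp only [hD]
    gcongr
    refine (norm_sum_le _ _).trans ?_
    simp only [Complex.norm_exp_ofReal_mul_I]
    simp
  have hrep : ∀ θ : ℝ, ∑ n ∈ Finset.range N,
      ((N : ℂ) - n) * (𝓕⁻ w (n * h) * Complex.exp (((n : ℝ) * θ : ℝ) * Complex.I)) =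
      ∫ ξ, (D θ ξ : ℂ) * w ξ := by
    intro θ
    set G : ℝ → ℂ := fun x => 𝓕⁻ w (x * h) * Complex.exp ((x * θ : ℝ) * Complex.I) with hG
    rw [fejer_sum_eq (fun n => 𝓕⁻ w (n * h) * Complex.exp (((n : ℝ) * θ : ℝ) * Complex.I))]
    -- Support in (0, ∞) enters here: the samples at (j - k)h with k > j vanish, so the one-sided
    -- sum equals the full Toeplitz sum, which factors as a squared modulus.
    have e1 : ∀ j ∈ Finset.range N, ∑ k ∈ Finset.range (j + 1),
        𝓕⁻ w ((j - k : ℕ) * h) * Complex.exp ((((j - k : ℕ) : ℝ) * θ : ℝ) * Complex.I) =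
        ∑ k ∈ Finset.range N, G ((j : ℝ) - k) := by
      intro j hj
      have hj' : j + 1 ≤ N := by simpa using hj
      rw [← Finset.sum_subset (Finset.range_mono hj')]
      · refine Finset.sum_congr rfl fun k hk => ?_
        have hk' : k ≤ j := by simpa [Nat.lt_succ_iff] using hk
        simp only [hG]
        rw [Nat.cast_sub hk']
      · intro k _ hk
        have hk' : j < k := by simpa [Nat.lt_succ_iff] using hk
        simp only [hG]
        rw [h0, zero_mul]
        have : (j : ℝ) < k := by exact_mod_cast hk'
        nlinarith
    rw [Finset.sum_congr rfl e1]
    have e2 : ∀ x : ℝ, G x = ∫ ξ, Complex.exp ((x * (2 * Real.pi * (ξ * h) + θ) : ℝ) * Complex.I) * w ξ := by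
      intro x
      simp only [hG]
      rw [fourierInv_real_eq, ← integral_mul_const]
      congr 1 with ξ
      rw [mul_right_comm, ← Complex.exp_add]
      congr 2
      push_cast
      ring
    have e3 : ∀ x : ℝ, Integrable fun ξ : ℝ =>
        Complex.exp ((x * (2 * Real.pi * (ξ * h) + θ) : ℝ) * Complex.I) * w ξ := by
      intro x
      refine hw.bdd_mul (c := 1) ?_ ?_
      · exact Continuous.aestronglyMeasurable (by fun_prop)
      · filter_upwards with ξ
        rw [Complex.norm_exp_ofReal_mul_I]
    simp_rw [e2]
    have e4 : ∀ j ∈ Finset.range N, ∑ k ∈ Finset.range N, ∫ ξ,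
        Complex.exp ((((j : ℝ) - k) * (2 * Real.pi * (ξ * h) + θ) : ℝ) * Complex.I) * w ξ =
        ∫ ξ, ∑ k ∈ Finset.range N,
          Complex.exp ((((j : ℝ) - k) * (2 * Real.pi * (ξ * h) + θ) : ℝ) * Complex.I) * w ξ :=
      fun j _ => (integral_finsetSum _ fun (k : ℕ) _ => e3 ((j : ℝ) - (k : ℝ))).symm
    rw [Finset.sum_congr rfl e4, ← integral_finsetSum]
    · congr 1 with ξ
      simp only [hD]
      rw [← sum_sum_cexp_eq, Finset.sum_mul]
      refine Finset.sum_congr rfl fun j _ => ?_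
      rw [Finset.sum_mul]
    · intro j _
      exact integrable_finsetSum _ fun k _ => e3 ((j : ℝ) - k)
  have hint : Integrable (Function.uncurry fun (θ : ℝ) (ξ : ℝ) => D θ ξ * ‖w ξ‖)
      ((volume.restrict (uIoc 0 (2 * Real.pi))).prod volume) := by
    have h1 : Integrable (fun p : ℝ × ℝ => (1 : ℝ) * ‖w p.2‖)
        ((volume.restrict (uIoc 0 (2 * Real.pi))).prod volume) := by
      have : IsFiniteMeasure (volume.restrict (uIoc 0 (2 * Real.pi))) := by
        rw [uIoc_of_le Real.two_pi_pos.le]; infer_instance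
      exact Integrable.mul_prod (f := fun _ : ℝ => (1 : ℝ)) (integrable_const _) hw.norm
    simp only [one_mul] at h1
    refine h1.bdd_mul (c := (N : ℝ) ^ 2) hDc.aestronglyMeasurable ?_
    filter_upwards with p
    rw [Real.norm_of_nonneg (hD0 _ _)]
    exact hDN _ _
  calc _ = ∫ θ in (0 : ℝ)..2 * Real.pi, ‖∫ ξ, (D θ ξ : ℂ) * w ξ‖ := by simp_rw [hrep]
    _ ≤ ∫ θ in (0 : ℝ)..2 * Real.pi, ∫ ξ, D θ ξ * ‖w ξ‖ := by
        refine intervalIntegral.integral_mono_on Real.two_pi_pos.le ?_ ?_ ?_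
        · simp_rw [← hrep]
          exact Continuous.intervalIntegrable (by fun_prop) _ _
        · exact intervalIntegrable_iff.2 hint.integral_prod_left
        · intro θ _
          refine (norm_integral_le_integral_norm _).trans (le_of_eq ?_)
          congr 1 with ξ
          rw [norm_mul, Complex.norm_real, Real.norm_of_nonneg (hD0 _ _)]
    _ = ∫ ξ, ∫ θ in (0 : ℝ)..2 * Real.pi, D θ ξ * ‖w ξ‖ :=
        intervalIntegral_integral_swap hint
    _ = ∫ ξ, (2 * Real.pi * N) * ‖w ξ‖ := by
        congr 1 with ξ
        rw [intervalIntegral.integral_mul_const, integral_sq_dirichlet]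
    _ = _ := integral_const_mul _ _

/-- Hardy's inequality for the polynomial with coefficients (N - n) times the samples, whose L¹ norm
on the circle is O(N). Divide by N and let N → ∞ with the number m of retained terms fixed. -/
theorem sum_norm_fourierInv_div_le {w : ℝ → ℂ} (hw : Integrable w) (h0 : ∀ t ≤ 0, 𝓕⁻ w t = 0)
    {h : ℝ} (hh : 0 < h) (m : ℕ) :
    ∑ n ∈ Finset.range m, ‖𝓕⁻ w (n * h)‖ / ((n : ℝ) + 1) ≤ 4 * ∫ ξ, ‖w ξ‖ := by
  have hN : ∀ N : ℕ, 0 < N → m ≤ N →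
      ∑ n ∈ Finset.range m, (1 - (n : ℝ) / N) * (‖𝓕⁻ w (n * h)‖ / ((n : ℝ) + 1)) ≤
        4 * ∫ ξ, ‖w ξ‖ := by
    intro N hN hmN
    have hNp : (0 : ℝ) < N := by exact_mod_cast hN
    set P : Polynomial ℂ := ∑ n ∈ Finset.range N,
      Polynomial.monomial n (((N : ℂ) - n) * 𝓕⁻ w (n * h)) with hP
    have hcoef : ∀ n ∈ Finset.range m, P.coeff n = ((N : ℂ) - n) * 𝓕⁻ w (n * h) := by
      intro n hn
      rw [hP, Polynomial.finsetSum_coeff]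
      simp only [Polynomial.coeff_monomial]
      rw [Finset.sum_ite_eq', if_pos (Finset.range_mono hmN hn)]
    have heval : ∀ θ : ℝ, P.eval (circleMap 0 1 θ) = ∑ n ∈ Finset.range N,
        ((N : ℂ) - n) * (𝓕⁻ w (n * h) * Complex.exp (((n : ℝ) * θ : ℝ) * Complex.I)) := by
      intro θ
      rw [hP, Polynomial.eval_finsetSum]
      refine Finset.sum_congr rfl fun n _ => ?_
      rw [Polynomial.eval_monomial, circleMap]
      simp only [Complex.ofReal_one, one_mul, zero_add]
      rw [← Complex.exp_nat_mul, mul_assoc]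
      push_cast
      rw [mul_assoc (n : ℂ)]
    have h1 := sum_norm_coeff_div_le P m
    simp_rw [heval] at h1
    have h2 := integral_norm_fejer_le hw h0 h hh N
    have h3 : ∑ n ∈ Finset.range m, (1 - (n : ℝ) / N) * (‖𝓕⁻ w (n * h)‖ / ((n : ℝ) + 1)) =
        (∑ n ∈ Finset.range m, ‖P.coeff n‖ / ((n : ℝ) + 1)) / N := by
      rw [Finset.sum_div]
      refine Finset.sum_congr rfl fun n hn => ?_
      have hn' : (n : ℝ) ≤ N := by
        exact_mod_cast (Finset.mem_range.1 hn).le.trans hmN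
      rw [hcoef n hn, norm_mul]
      have : ‖(N : ℂ) - n‖ = (N : ℝ) - n := by
        rw [← Complex.ofReal_natCast, ← Complex.ofReal_natCast, ← Complex.ofReal_sub,
          Complex.norm_real, Real.norm_of_nonneg (by linarith)]
      rw [this]
      field_simp
    rw [h3, div_le_iff₀ hNp]
    refine h1.trans ?_
    have hpi := Real.two_pi_pos
    calc _ ≤ 4 * ((2 * Real.pi)⁻¹ * (2 * Real.pi * N * ∫ ξ, ‖w ξ‖)) := by gcongr
      _ = _ := by field_simp
  have hlim : Tendsto (fun N : ℕ =>
      ∑ n ∈ Finset.range m, (1 - (n : ℝ) / N) * (‖𝓕⁻ w (n * h)‖ / ((n : ℝ) + 1))) atTop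
      (𝓝 (∑ n ∈ Finset.range m, (1 - 0) * (‖𝓕⁻ w (n * h)‖ / ((n : ℝ) + 1)))) := by
    refine tendsto_finsetSum _ fun n _ => Tendsto.mul_const _ (tendsto_const_nhds.sub ?_)
    exact tendsto_const_nhds.div_atTop tendsto_natCast_atTop_atTop
  simp only [sub_zero, one_mul] at hlim
  refine le_of_tendsto hlim ?_
  filter_upwards [eventually_gt_atTop 0, eventually_ge_atTop m] with N h1 h2 using hN N h1 h2

end Volterra

/-! ### Hardy's inequality on the half-line, by refinement of the sampling step. -/

namespace Volterra

open FourierTransform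

/-- On each cell [nh, (n + 1)h) the integrand is constant, and the cell length h cancels the h in
the denominator: the weighted sum is the integral of a step function. -/
theorem lintegral_step_le {c : ℕ → ℝ} (hc : ∀ n, 0 ≤ c n) {h S : ℝ} (hh : 0 < h)
    (hS : ∀ m, ∑ n ∈ Finset.range m, c n / ((n : ℝ) + 1) ≤ S) :
    ∫⁻ t in Ioi (0 : ℝ), ENNReal.ofReal (c ⌊t / h⌋₊ / (((⌊t / h⌋₊ : ℝ) + 1) * h)) ≤
      ENNReal.ofReal S := by
  set I : ℕ → Set ℝ := fun n => Ico (n * h) ((n + 1) * h) with hI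
  have hle : ∀ t ∈ Ioi (0 : ℝ), ENNReal.ofReal (c ⌊t / h⌋₊ / (((⌊t / h⌋₊ : ℝ) + 1) * h)) ≤
      ∑' n, (I n).indicator (fun _ => ENNReal.ofReal (c n / (((n : ℝ) + 1) * h))) t := by
    intro t ht
    have ht' : 0 ≤ t / h := div_nonneg (le_of_lt ht) hh.le
    refine le_trans (le_of_eq ?_) (ENNReal.le_tsum ⌊t / h⌋₊)
    rw [indicator_of_mem]
    refine ⟨?_, ?_⟩
    · rw [← le_div_iff₀ hh]; exact Nat.floor_le ht'
    · rw [← div_lt_iff₀ hh]; exact Nat.lt_floor_add_one _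
  calc _ ≤ ∫⁻ t in Ioi (0 : ℝ),
        ∑' n, (I n).indicator (fun _ => ENNReal.ofReal (c n / (((n : ℝ) + 1) * h))) t :=
        setLIntegral_mono' measurableSet_Ioi hle
    _ ≤ ∫⁻ t, ∑' n, (I n).indicator (fun _ => ENNReal.ofReal (c n / (((n : ℝ) + 1) * h))) t :=
        setLIntegral_le_lintegral _ _
    _ = ∑' n, ENNReal.ofReal (c n / ((n : ℝ) + 1)) := by
        rw [lintegral_tsum fun n => (measurable_const.indicator measurableSet_Ico).aemeasurable]
        congr 1 with n
        rw [lintegral_indicator measurableSet_Ico, setLIntegral_const, Real.volume_Ico,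
          ← ENNReal.ofReal_mul (div_nonneg (hc n) (by positivity))]
        congr 1
        field_simp
        ring
    _ ≤ ENNReal.ofReal S := by
        refine ENNReal.tsum_le_of_sum_range_le fun m => ?_
        rw [← ENNReal.ofReal_sum_of_nonneg fun n _ => div_nonneg (hc n) (by positivity)]
        exact ENNReal.ofReal_le_ofReal (hS m)

/-- **Hardy's inequality** for functions on the line whose Fourier transform is integrable and
which vanish on the negative half-line. -/
theorem lintegral_norm_div_le {v : ℝ → ℂ} (hv : Integrable v) (hw : Integrable (𝓕 v))
    (hv0 : ∀ t < 0, v t = 0) :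
    ∫⁻ t in Ioi (0 : ℝ), ENNReal.ofReal (‖v t‖ / t) ≤ ENNReal.ofReal (4 * ∫ ξ, ‖𝓕 v ξ‖) := by
  set u : ℝ → ℂ := 𝓕⁻ (𝓕 v) with hu
  have hae : ∀ᵐ t, v t = u t := ae_eq_fourierInv_fourier hv hw
  have huc : Continuous u := continuous_fourierInv hw
  -- Samples are meaningful only for the continuous representative u. It vanishes almost everywhere
  -- on t < 0, hence everywhere there, and by continuity also at t = 0.
  have hneg : EqOn u 0 (Iio 0) := by
    refine Measure.eqOn_open_of_ae_eq (μ := volume) ?_ isOpen_Iio huc.continuousOn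
      continuousOn_const
    filter_upwards [ae_restrict_of_ae hae, ae_restrict_mem measurableSet_Iio] with t h1 h2
    rw [← h1, hv0 t h2]
    rfl
  have hu0 : ∀ t ≤ 0, u t = 0 := by
    intro t ht
    have := hneg.closure huc continuous_const
    rw [closure_Iio] at this
    exact this ht
  have hstep : ∀ M : ℕ, ∫⁻ t in Ioi (0 : ℝ), ENNReal.ofReal
      (‖u (⌊t / (1 / ((M : ℝ) + 1))⌋₊ * (1 / ((M : ℝ) + 1)))‖ /
        (((⌊t / (1 / ((M : ℝ) + 1))⌋₊ : ℝ) + 1) * (1 / ((M : ℝ) + 1)))) ≤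
      ENNReal.ofReal (4 * ∫ ξ, ‖𝓕 v ξ‖) := by
    intro M
    have hh : (0 : ℝ) < 1 / ((M : ℝ) + 1) := by positivity
    exact lintegral_step_le (c := fun n => ‖u (n * (1 / ((M : ℝ) + 1)))‖)
      (fun n => norm_nonneg _) hh (fun m => sum_norm_fourierInv_div_le hw hu0 hh m)
  have hpt : ∀ t ∈ Ioi (0 : ℝ), Tendsto (fun M : ℕ => ENNReal.ofReal
      (‖u (⌊t / (1 / ((M : ℝ) + 1))⌋₊ * (1 / ((M : ℝ) + 1)))‖ /
        (((⌊t / (1 / ((M : ℝ) + 1))⌋₊ : ℝ) + 1) * (1 / ((M : ℝ) + 1))))) atTop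
      (𝓝 (ENNReal.ofReal (‖u t‖ / t))) := by
    intro t ht
    have ht0 : (0 : ℝ) < t := ht
    have hM : Tendsto (fun M : ℕ => (M : ℝ) + 1) atTop atTop :=
      tendsto_atTop_add_const_right _ _ tendsto_natCast_atTop_atTop
    have h1 : Tendsto (fun M : ℕ => (⌊t / (1 / ((M : ℝ) + 1))⌋₊ : ℝ) * (1 / ((M : ℝ) + 1))) atTop
        (𝓝 t) := by
      have := (tendsto_nat_floor_mul_div_atTop ht0.le).comp hM
      refine this.congr fun M => ?_
      simp only [Function.comp_apply, one_div, div_inv_eq_mul]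
      rw [div_eq_mul_inv]
    have h2 : Tendsto (fun M : ℕ => (1 : ℝ) / ((M : ℝ) + 1)) atTop (𝓝 0) :=
      tendsto_one_div_add_atTop_nhds_zero_nat
    have h3 : Tendsto (fun M : ℕ =>
        ((⌊t / (1 / ((M : ℝ) + 1))⌋₊ : ℝ) + 1) * (1 / ((M : ℝ) + 1))) atTop (𝓝 t) := by
      have := h1.add h2
      rw [add_zero] at this
      refine this.congr fun M => ?_
      ring
    refine ENNReal.tendsto_ofReal (Tendsto.div ?_ h3 ht0.ne')
    exact ((huc.tendsto t).comp h1).norm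
  calc ∫⁻ t in Ioi (0 : ℝ), ENNReal.ofReal (‖v t‖ / t)
      = ∫⁻ t in Ioi (0 : ℝ), ENNReal.ofReal (‖u t‖ / t) := by
        refine lintegral_congr_ae (ae_restrict_of_ae ?_)
        filter_upwards [hae] with t ht
        rw [ht]
    _ = ∫⁻ t in Ioi (0 : ℝ), liminf (fun M : ℕ => ENNReal.ofReal
          (‖u (⌊t / (1 / ((M : ℝ) + 1))⌋₊ * (1 / ((M : ℝ) + 1)))‖ /
          (((⌊t / (1 / ((M : ℝ) + 1))⌋₊ : ℝ) + 1) * (1 / ((M : ℝ) + 1))))) atTop :=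
        setLIntegral_congr_fun measurableSet_Ioi fun t ht => (hpt t ht).liminf_eq.symm
    _ ≤ liminf (fun M : ℕ => ∫⁻ t in Ioi (0 : ℝ), ENNReal.ofReal
          (‖u (⌊t / (1 / ((M : ℝ) + 1))⌋₊ * (1 / ((M : ℝ) + 1)))‖ /
          (((⌊t / (1 / ((M : ℝ) + 1))⌋₊ : ℝ) + 1) * (1 / ((M : ℝ) + 1))))) atTop := by
        refine lintegral_liminf_le fun M => ?_
        have := huc.measurable
        fun_prop
    _ ≤ ENNReal.ofReal (4 * ∫ ξ, ‖𝓕 v ξ‖) := by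
        refine liminf_le_of_le (by isBoundedDefault) fun b hb => ?_
        obtain ⟨M, hM⟩ := hb.exists
        exact hM.trans (hstep M)

end Volterra

/-! ### Laplace transforms: integrability from the variation of boundary values. -/

namespace Volterra

open FourierTransform

/-- The Laplace transform of a complex-valued function. -/
def laplaceC (u : ℝ → ℂ) (z : ℂ) : ℂ :=
  ∫ t in Ioi (0 : ℝ), Complex.exp (-(z * t)) * u t

theorem laplace_eq_laplaceC (U : ℝ → ℝ) : laplace U = laplaceC fun t => (U t : ℂ) := rfl

/-- Subexponential growth of a complex-valued function. -/
def SubexponentialGrowthC (u : ℝ → ℂ) : Prop :=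
  ∀ ε : ℝ, 0 < ε → IntegrableOn (fun t => (Real.exp (-(ε * t)) : ℂ) * u t) (Ioi 0)

theorem SubexponentialGrowth.toC {U : ℝ → ℝ} (hU : SubexponentialGrowth U) :
    SubexponentialGrowthC fun t => (U t : ℂ) := by
  intro ε hε
  have := (hU ε hε).ofReal (𝕜 := ℂ)
  refine this.congr (ae_of_all _ fun t => ?_)
  exact Complex.ofReal_mul _ _

theorem SubexponentialGrowthC.aestronglyMeasurable {u : ℝ → ℂ} (hu : SubexponentialGrowthC u) :
    AEStronglyMeasurable u (volume.restrict (Ioi 0)) := by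
  have h1 := (hu 1 one_pos).aestronglyMeasurable
  have h2 : AEStronglyMeasurable (fun t : ℝ => Complex.exp (t : ℂ)) (volume.restrict (Ioi 0)) :=
    Continuous.aestronglyMeasurable (by fun_prop)
  refine (h2.mul h1).congr (ae_of_all _ fun t => ?_)
  simp only [Pi.mul_apply]
  rw [← mul_assoc, Complex.ofReal_exp, ← Complex.exp_add]
  simp

theorem SubexponentialGrowthC.integrableOn {u : ℝ → ℂ} (hu : SubexponentialGrowthC u) {z : ℂ}
    (hz : 0 < z.re) : IntegrableOn (fun t : ℝ => Complex.exp (-(z * t)) * u t) (Ioi 0) := by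
  have h1 := hu z.re hz
  have : (fun t : ℝ => Complex.exp (-(z * t)) * u t) = fun t : ℝ =>
      Complex.exp (((-(z.im * t) : ℝ) : ℂ) * Complex.I) * ((Real.exp (-(z.re * t)) : ℂ) * u t) := by
    ext t
    rw [← mul_assoc, Complex.ofReal_exp, ← Complex.exp_add]
    congr 2
    nth_rw 1 [← Complex.re_add_im z]
    push_cast
    ring
  rw [this]
  refine h1.bdd_mul (c := 1) ?_ ?_
  · exact Continuous.aestronglyMeasurable (by fun_prop)
  · filter_upwards with t
    rw [Complex.norm_exp_ofReal_mul_I]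

theorem SubexponentialGrowthC.bdd_mul {u : ℝ → ℂ} (hu : SubexponentialGrowthC u) {f : ℝ → ℂ}
    (hf : Continuous f) {c : ℝ} (hc : ∀ t, ‖f t‖ ≤ c) : SubexponentialGrowthC fun t => f t * u t := by
  intro ε hε
  have := (hu ε hε).bdd_mul (c := c) hf.aestronglyMeasurable (ae_of_all _ hc)
  refine this.congr (ae_of_all _ fun t => ?_)
  simp only
  ring

/-- Half of the exponential absorbs the factor t, since t e^{-εt/2} ≤ 2/ε. -/
theorem SubexponentialGrowthC.mul_id {u : ℝ → ℂ} (hu : SubexponentialGrowthC u) :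
    SubexponentialGrowthC fun t => (t : ℂ) * u t := by
  intro ε hε
  have h1 := hu (ε / 2) (by positivity)
  have h2 : IntegrableOn (fun t : ℝ => ((t * Real.exp (-(ε / 2 * t)) : ℝ) : ℂ) *
      ((Real.exp (-(ε / 2 * t)) : ℂ) * u t)) (Ioi 0) := by
    refine Integrable.bdd_mul h1 (c := 2 / ε) ?_ ?_
    · exact Continuous.aestronglyMeasurable (by fun_prop)
    · filter_upwards [ae_restrict_mem measurableSet_Ioi] with t ht
      have ht' : (0 : ℝ) < t := ht
      rw [Complex.norm_real, Real.norm_of_nonneg (by positivity), Real.exp_neg,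
        ← div_eq_mul_inv, div_le_div_iff₀ (Real.exp_pos _) hε]
      have := Real.add_one_le_exp (ε / 2 * t)
      nlinarith
  refine h2.congr (ae_of_all _ fun t => ?_)
  simp only
  have : Real.exp (-(ε * t)) = Real.exp (-(ε / 2 * t)) * Real.exp (-(ε / 2 * t)) := by
    rw [← Real.exp_add]
    congr 1
    ring
  rw [this]
  push_cast
  ring

theorem hasDerivAt_laplaceC {u : ℝ → ℂ} (hu : SubexponentialGrowthC u) {z : ℂ} (hz : 0 < z.re) :
    HasDerivAt (laplaceC u) (-laplaceC (fun t => (t : ℂ) * u t) z) z := by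
  have hs : {w : ℂ | z.re / 2 < w.re} ∈ 𝓝 z :=
    (isOpen_lt continuous_const Complex.continuous_re).mem_nhds (by simp; linarith)
  have hu1 := hu.mul_id
  have key := hasDerivAt_integral_of_dominated_loc_of_deriv_le
    (μ := volume.restrict (Ioi (0 : ℝ)))
    (F := fun (w : ℂ) (t : ℝ) => Complex.exp (-(w * t)) * u t)
    (F' := fun (w : ℂ) (t : ℝ) => -(Complex.exp (-(w * t)) * ((t : ℂ) * u t)))
    (bound := fun t => ‖(Real.exp (-(z.re / 2 * t)) : ℂ) * ((t : ℂ) * u t)‖) (x₀ := z) hs ?_ ?_ ?_ ?_ ?_ ?_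
  · have h2 := key.2
    rw [integral_neg] at h2
    exact h2
  · filter_upwards [hs] with w hw
    have hw' : z.re / 2 < w.re := hw
    exact (hu.integrableOn (z := w) (by linarith)).aestronglyMeasurable
  · exact hu.integrableOn hz
  · exact (hu1.integrableOn hz).aestronglyMeasurable.neg
  · filter_upwards [ae_restrict_mem measurableSet_Ioi] with t ht w hw
    have ht' : (0 : ℝ) < t := ht
    have hw' : z.re / 2 < w.re := hw
    rw [norm_neg, norm_mul, norm_mul (Real.exp (-(z.re / 2 * t)) : ℂ)]
    gcongr
    rw [Complex.norm_exp, Complex.norm_real, Real.norm_of_nonneg (Real.exp_pos _).le]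
    gcongr
    simp
    nlinarith
  · exact (hu1 (z.re / 2) (by positivity)).norm
  · filter_upwards with t w _
    have h1 : HasDerivAt (fun w : ℂ => -(w * t)) (-(1 * (t : ℂ))) w :=
      ((hasDerivAt_id w).mul_const (t : ℂ)).neg
    have h2 := (h1.cexp).mul_const (u t)
    refine h2.congr_deriv ?_
    ring

theorem differentiableOn_laplaceC {u : ℝ → ℂ} (hu : SubexponentialGrowthC u) :
    DifferentiableOn ℂ (laplaceC u) {z | 0 < z.re} := fun _ hz =>
  (hasDerivAt_laplaceC hu hz).differentiableAt.differentiableWithinAt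

/-- The multiplier whose effect on the Laplace transform is a difference along the imaginary
direction. -/
theorem laplaceC_mul_cexp_sub_one {u : ℝ → ℂ} (hu : SubexponentialGrowthC u) (δ : ℝ) {z : ℂ}
    (hz : 0 < z.re) :
    laplaceC (fun t => (Complex.exp (((-(δ * t) : ℝ) : ℂ) * Complex.I) - 1) * u t) z =
      laplaceC u (z + δ * Complex.I) - laplaceC u z := by
  rw [laplaceC, laplaceC, laplaceC, ← integral_sub (hu.integrableOn (by simpa using hz))
    (hu.integrableOn hz)]
  congr 1 with t
  have : Complex.exp (-((z + δ * Complex.I) * t)) =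
      Complex.exp (-(z * t)) * Complex.exp (((-(δ * t) : ℝ) : ℂ) * Complex.I) := by
    rw [← Complex.exp_add]
    congr 1
    push_cast
    ring
  rw [this]
  ring

theorem SubexponentialGrowthC.mul_cexp_sub_one {u : ℝ → ℂ} (hu : SubexponentialGrowthC u) (δ : ℝ) :
    SubexponentialGrowthC
      fun t => (Complex.exp (((-(δ * t) : ℝ) : ℂ) * Complex.I) - 1) * u t := by
  refine hu.bdd_mul (c := 2) (by fun_prop) fun t => ?_
  refine (norm_sub_le _ _).trans ?_
  rw [Complex.norm_exp_ofReal_mul_I, norm_one]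
  norm_num

theorem fourier_indicator_eq_laplaceC (u : ℝ → ℂ) (ε ξ : ℝ) :
    𝓕 ((Ioi (0 : ℝ)).indicator fun t => (Real.exp (-(ε * t)) : ℂ) * u t) ξ =
      laplaceC u (ε + (2 * Real.pi * ξ : ℝ) * Complex.I) := by
  rw [Real.fourier_real_eq_integral_exp_smul, laplaceC, ← integral_indicator measurableSet_Ioi]
  congr 1 with t
  by_cases ht : t ∈ Ioi (0 : ℝ)
  · rw [indicator_of_mem ht, indicator_of_mem ht, smul_eq_mul, ← mul_assoc, Complex.ofReal_exp,
      ← Complex.exp_add]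
    congr 2
    push_cast
    ring
  · rw [indicator_of_notMem ht, indicator_of_notMem ht, smul_zero]

/-- Hardy's inequality for Laplace transforms, on a vertical line. -/
theorem lintegral_exp_mul_norm_div_le {u : ℝ → ℂ} (hu : SubexponentialGrowthC u) {ε : ℝ} (hε : 0 < ε)
    (hint : Integrable fun k : ℝ => laplaceC u (ε + k * Complex.I)) :
    ∫⁻ t in Ioi (0 : ℝ), ENNReal.ofReal (Real.exp (-(ε * t)) * ‖u t‖ / t) ≤
      ENNReal.ofReal (∫ k : ℝ, ‖laplaceC u (ε + k * Complex.I)‖) := by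
  have hpi := Real.two_pi_pos
  set v : ℝ → ℂ := (Ioi (0 : ℝ)).indicator fun t => (Real.exp (-(ε * t)) : ℂ) * u t with hv
  have hvi : Integrable v := (integrable_indicator_iff measurableSet_Ioi).2 (hu ε hε)
  have hF : 𝓕 v = fun ξ : ℝ => laplaceC u (ε + (2 * Real.pi * ξ : ℝ) * Complex.I) := by
    ext ξ
    exact fourier_indicator_eq_laplaceC u ε ξ
  have hFi : Integrable (𝓕 v) := by
    rw [hF]
    exact hint.comp_mul_left' hpi.ne'
  have h := lintegral_norm_div_le hvi hFi fun t ht =>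
    indicator_of_notMem (by simpa using ht.le) _
  refine le_trans (le_of_eq ?_) (h.trans (ENNReal.ofReal_le_ofReal ?_))
  · refine setLIntegral_congr_fun measurableSet_Ioi fun t ht => ?_
    simp only [hv]
    rw [indicator_of_mem ht, norm_mul, Complex.norm_real, Real.norm_of_nonneg (Real.exp_pos _).le]
  · rw [hF, Measure.integral_comp_mul_left
      (fun k : ℝ => ‖laplaceC u (ε + k * Complex.I)‖) (2 * Real.pi), smul_eq_mul, ← mul_assoc]
    have h0 : 0 ≤ ∫ k : ℝ, ‖laplaceC u (ε + k * Complex.I)‖ := integral_nonneg fun _ => norm_nonneg _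
    -- The substitution k = 2πξ turns the constant 4 into 4/(2π), which is below 1 and is discarded.
    have h1 : 4 * |(2 * Real.pi)⁻¹| ≤ 1 := by
      rw [abs_of_pos (by positivity), ← div_eq_mul_inv, div_le_one hpi]
      linarith [Real.pi_gt_three]
    nlinarith

/-- Hardy's inequality for Laplace transforms, with boundary values. -/
theorem lintegral_norm_div_le_of_boundary {u : ℝ → ℂ} (hu : SubexponentialGrowthC u) {D : ℝ → ℝ}
    (hD : Integrable D)
    (hle : ∀ ε : ℝ, 0 < ε → ε < 1 → ∀ᵐ k : ℝ, ‖laplaceC u (ε + k * Complex.I)‖ ≤ D k)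
    {h : ℝ → ℂ} (hlim : ∀ᵐ k : ℝ,
      Tendsto (fun ε : ℝ => laplaceC u (ε + k * Complex.I)) (𝓝[>] 0) (𝓝 (h k))) :
    ∫⁻ t in Ioi (0 : ℝ), ENNReal.ofReal (‖u t‖ / t) ≤ ∫⁻ k, ‖h k‖ₑ := by
  set e : ℕ → ℝ := fun n => 1 / ((n : ℝ) + 2) with he
  have he0 : ∀ n, 0 < e n := fun n => by positivity
  have he1 : ∀ n, e n < 1 := fun n => by
    rw [he]
    simp only
    rw [div_lt_one (by positivity)]
    linarith [(Nat.cast_nonneg n : (0 : ℝ) ≤ n)]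
  have helim : Tendsto e atTop (𝓝 0) := by
    have : Tendsto (fun n : ℕ => (n : ℝ) + 2) atTop atTop :=
      tendsto_atTop_add_const_right _ _ tendsto_natCast_atTop_atTop
    exact tendsto_const_nhds.div_atTop this
  have helim' : Tendsto e atTop (𝓝[>] 0) :=
    tendsto_nhdsWithin_iff.2 ⟨helim, Eventually.of_forall he0⟩
  have hcont : ∀ n, Continuous fun k : ℝ => laplaceC u (e n + k * Complex.I) := by
    intro n
    refine (differentiableOn_laplaceC hu).continuousOn.comp_continuous (by fun_prop) fun k => ?_
    simpa using he0 n
  have hint : ∀ n, Integrable fun k : ℝ => laplaceC u (e n + k * Complex.I) := fun n =>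
    hD.mono' (hcont n).aestronglyMeasurable (hle _ (he0 n) (he1 n))
  have hb : ∀ n, ∫⁻ t in Ioi (0 : ℝ), ENNReal.ofReal (Real.exp (-(e n * t)) * ‖u t‖ / t) ≤
      ∫⁻ k : ℝ, ‖laplaceC u (e n + k * Complex.I)‖ₑ := by
    intro n
    refine (lintegral_exp_mul_norm_div_le hu (he0 n) (hint n)).trans (le_of_eq ?_)
    exact ofReal_integral_norm_eq_lintegral_enorm (hint n)
  -- Passage to the axis: dominated convergence on the frequency side, Fatou on the time side.
  have hlim1 : Tendsto (fun n => ∫⁻ k : ℝ, ‖laplaceC u (e n + k * Complex.I)‖ₑ) atTop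
      (𝓝 (∫⁻ k, ‖h k‖ₑ)) := by
    refine tendsto_lintegral_of_dominated_convergence' (fun k => ENNReal.ofReal (D k))
      (fun n => (hcont n).aestronglyMeasurable.enorm) (fun n => ?_) ?_ ?_
    · filter_upwards [hle _ (he0 n) (he1 n)] with k hk
      rw [← ofReal_norm]
      exact ENNReal.ofReal_le_ofReal hk
    · exact hD.lintegral_lt_top.ne
    · filter_upwards [hlim] with k hk
      exact (hk.comp helim').enorm
  have hmeas := hu.aestronglyMeasurable
  calc ∫⁻ t in Ioi (0 : ℝ), ENNReal.ofReal (‖u t‖ / t)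
      = ∫⁻ t in Ioi (0 : ℝ), liminf (fun n =>
          ENNReal.ofReal (Real.exp (-(e n * t)) * ‖u t‖ / t)) atTop := by
        refine lintegral_congr fun t => (Tendsto.liminf_eq ?_).symm
        refine ENNReal.tendsto_ofReal (Tendsto.div_const ?_ _)
        have h1 : Tendsto (fun n => Real.exp (-(e n * t))) atTop (𝓝 (Real.exp (-(0 * t)))) :=
          (Real.continuous_exp.tendsto _).comp (helim.mul_const t).neg
        simpa using h1.mul_const ‖u t‖
    _ ≤ liminf (fun n => ∫⁻ t in Ioi (0 : ℝ),
          ENNReal.ofReal (Real.exp (-(e n * t)) * ‖u t‖ / t)) atTop := by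
        refine lintegral_liminf_le' fun n => ?_
        have h1 : AEMeasurable (fun t => ‖u t‖) (volume.restrict (Ioi 0)) := hmeas.norm.aemeasurable
        have h2 : AEMeasurable (fun t : ℝ => Real.exp (-(e n * t))) (volume.restrict (Ioi 0)) := by
          fun_prop
        exact ((h2.mul h1).div aemeasurable_id).ennreal_ofReal
    _ ≤ liminf (fun n => ∫⁻ k : ℝ, ‖laplaceC u (e n + k * Complex.I)‖ₑ) atTop :=
        liminf_le_liminf (Eventually.of_forall hb)
    _ = ∫⁻ k, ‖h k‖ₑ := hlim1.liminf_eq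

theorem tendsto_norm_cexp_sub_one_div (t : ℝ) {δ : ℕ → ℝ} (hδ : ∀ n, 0 < δ n)
    (hlim : Tendsto δ atTop (𝓝 0)) :
    Tendsto (fun n => ‖Complex.exp (((-(δ n * t) : ℝ) : ℂ) * Complex.I) - 1‖ / δ n) atTop
      (𝓝 |t|) := by
  have hd : HasDerivAt (fun s : ℝ => Complex.exp (((-(s * t) : ℝ) : ℂ) * Complex.I))
      (Complex.exp (((-(0 * t) : ℝ) : ℂ) * Complex.I) * (((-(1 * t) : ℝ) : ℂ) * Complex.I)) 0 := by
    refine HasDerivAt.cexp ?_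
    exact (HasDerivAt.ofReal_comp ((hasDerivAt_id (0 : ℝ)).mul_const t).neg).mul_const _
  rw [hasDerivAt_iff_tendsto_slope] at hd
  have h2 : Tendsto δ atTop (𝓝[≠] 0) :=
    tendsto_nhdsWithin_iff.2 ⟨hlim, Eventually.of_forall fun n => (hδ n).ne'⟩
  have h3 := (hd.comp h2).norm
  have e : ‖Complex.exp (((-(0 * t) : ℝ) : ℂ) * Complex.I) * (((-(1 * t) : ℝ) : ℂ) * Complex.I)‖
      = |t| := by
    simp
  rw [e] at h3
  refine h3.congr fun n => ?_
  simp only [Function.comp_apply, slope_def_module, sub_zero, zero_mul, neg_zero]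
  rw [norm_smul, norm_inv, Real.norm_of_nonneg (hδ n).le, div_eq_inv_mul]
  simp

/-- As δ → 0, |e^{-iδt} - 1|/δ tends to t, so Fatou turns Hardy bounds for j-th differences into a
weighted L¹ bound. The cases j = 1 and j = 2 give the weights 1 and t. -/
theorem lintegral_pow_mul_norm_div_le {u : ℝ → ℂ} (hu : AEStronglyMeasurable u (volume.restrict (Ioi 0)))
    (j : ℕ) {K : ℝ}
    (h : ∀ δ : ℝ, 0 < δ → δ ≤ 1 → ∫⁻ t in Ioi (0 : ℝ), ENNReal.ofReal
      (‖(Complex.exp (((-(δ * t) : ℝ) : ℂ) * Complex.I) - 1) ^ j * u t‖ / t) ≤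
        ENNReal.ofReal (K * δ ^ j)) :
    ∫⁻ t in Ioi (0 : ℝ), ENNReal.ofReal (t ^ j * ‖u t‖ / t) ≤ ENNReal.ofReal K := by
  set δ : ℕ → ℝ := fun n => 1 / ((n : ℝ) + 1) with hδ
  have hδ0 : ∀ n, 0 < δ n := fun n => by positivity
  have hδ1 : ∀ n, δ n ≤ 1 := fun n => by
    rw [hδ]
    simp only
    rw [div_le_one (by positivity)]
    linarith [(Nat.cast_nonneg n : (0 : ℝ) ≤ n)]
  have hlim : Tendsto δ atTop (𝓝 0) := tendsto_one_div_add_atTop_nhds_zero_nat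
  set F : ℕ → ℝ → ℝ≥0∞ := fun n t => ENNReal.ofReal
    ((‖Complex.exp (((-(δ n * t) : ℝ) : ℂ) * Complex.I) - 1‖ / δ n) ^ j * ‖u t‖ / t) with hF
  have hFle : ∀ n, ∫⁻ t in Ioi (0 : ℝ), F n t ≤ ENNReal.ofReal K := by
    intro n
    have h1 := h (δ n) (hδ0 n) (hδ1 n)
    have h2 : ∀ t, F n t = ENNReal.ofReal ((δ n ^ j)⁻¹) * ENNReal.ofReal
      (‖(Complex.exp (((-(δ n * t) : ℝ) : ℂ) * Complex.I) - 1) ^ j * u t‖ / t) := by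
      intro t
      have := hδ0 n
      rw [← ENNReal.ofReal_mul (by positivity), hF]
      simp only
      congr 1
      rw [norm_mul, norm_pow, div_pow]
      field_simp
    simp_rw [h2]
    rw [lintegral_const_mul' _ _ ENNReal.ofReal_ne_top]
    refine (mul_le_mul_right h1 _).trans (le_of_eq ?_)
    have := hδ0 n
    rw [← ENNReal.ofReal_mul (by positivity)]
    congr 1
    field_simp
  calc ∫⁻ t in Ioi (0 : ℝ), ENNReal.ofReal (t ^ j * ‖u t‖ / t)
      = ∫⁻ t in Ioi (0 : ℝ), liminf (fun n => F n t) atTop := by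
        refine setLIntegral_congr_fun measurableSet_Ioi fun t ht => (Tendsto.liminf_eq ?_).symm
        have h1 := ((tendsto_norm_cexp_sub_one_div t hδ0 hlim).pow j)
        rw [abs_of_pos ht] at h1
        exact ENNReal.tendsto_ofReal ((h1.mul_const ‖u t‖).div_const t)
    _ ≤ liminf (fun n => ∫⁻ t in Ioi (0 : ℝ), F n t) atTop := by
        refine lintegral_liminf_le' fun n => ?_
        have h1 : AEMeasurable (fun t => ‖u t‖) (volume.restrict (Ioi 0)) := hu.norm.aemeasurable
        have h2 : AEMeasurable (fun t : ℝ =>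
            (‖Complex.exp (((-(δ n * t) : ℝ) : ℂ) * Complex.I) - 1‖ / δ n) ^ j)
            (volume.restrict (Ioi 0)) := by
          refine Measurable.aemeasurable (Continuous.measurable ?_)
          fun_prop
        exact ((h2.mul h1).div aemeasurable_id).ennreal_ofReal
    _ ≤ ENNReal.ofReal K := by
        refine liminf_le_of_le (by isBoundedDefault) fun b hb => ?_
        obtain ⟨n, hn⟩ := hb.exists
        exact hn.trans (hFle n)

/-- An integrable majorant with an inverse square root singularity at the origin. -/
def majorant (k : ℝ) : ℝ :=
  (Icc (-3 : ℝ) 3).indicator (fun k => |k| ^ (-(1 / 2) : ℝ)) k + 1 / (1 + k ^ 2)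

theorem integrable_majorant : Integrable majorant := by
  refine Integrable.add ?_ (by simpa using integrable_inv_one_add_sq)
  rw [integrable_indicator_iff measurableSet_Icc]
  have h1 : IntegrableOn (fun k : ℝ => |k| ^ (-(1 / 2) : ℝ)) (Ioc 0 3) := by
    have : IntervalIntegrable (fun k : ℝ => k ^ (-(1 / 2) : ℝ)) volume 0 3 :=
      intervalIntegral.intervalIntegrable_rpow' (by norm_num)
    rw [intervalIntegrable_iff_integrableOn_Ioc_of_le (by norm_num)] at this
    refine this.congr_fun (fun k hk => ?_) measurableSet_Ioc
    simp only
    rw [abs_of_pos hk.1]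
  have h2 : IntegrableOn (fun k : ℝ => |k| ^ (-(1 / 2) : ℝ)) (Ico (-3) 0) := by
    rw [← integrable_indicator_iff measurableSet_Ico]
    rw [← integrable_indicator_iff measurableSet_Ioc] at h1
    refine h1.comp_neg.congr (ae_of_all _ fun k => ?_)
    simp only [indicator_apply, mem_Ioc, mem_Ico, abs_neg]
    congr 1
    simp only [eq_iff_iff]
    constructor
    · rintro ⟨a, b⟩; constructor <;> linarith
    · rintro ⟨a, b⟩; constructor <;> linarith
  have h3 : IntegrableOn (fun k : ℝ => |k| ^ (-(1 / 2) : ℝ)) {0} := integrableOn_singleton (by simp) (by simp)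
  refine ((h2.union h3).union h1).mono_set fun k hk => ?_
  rcases lt_trichotomy k 0 with h | h | h
  · exact Or.inl (Or.inl ⟨hk.1, h⟩)
  · exact Or.inl (Or.inr h)
  · exact Or.inr ⟨h, hk.2⟩

theorem majorant_nonneg (k : ℝ) : 0 ≤ majorant k :=
  add_nonneg (indicator_nonneg (fun _ _ => by positivity) _) (by positivity)

/-- The size bound alone is not integrable at infinity, but that of a difference is. The majorant
does not depend on ε, which is what allows ε → 0. -/
theorem norm_sub_le_majorant {H : ℂ → ℂ} {M : ℝ} (hd : ∀ z : ℂ, 0 < z.re → DifferentiableAt ℂ H z)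
    (h1 : ∀ z : ℂ, 0 < z.re → ‖H z‖ ≤ M * ‖z‖ ^ (-(1 / 2) : ℝ))
    (h2 : ∀ z : ℂ, 0 < z.re → 1 ≤ ‖z‖ → ‖deriv H z‖ ≤ M / ‖z‖ ^ 2) {δ : ℝ} (hδ : 0 < δ) (hδ1 : δ ≤ 1)
    {ε : ℝ} (hε : 0 < ε) {k : ℝ} (hk : k ≠ 0) (hk' : k + δ ≠ 0) :
    ‖H (ε + (k + δ : ℝ) * Complex.I) - H (ε + k * Complex.I)‖ ≤
      5 * M * (majorant k + majorant (k + δ)) := by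
  have hM : 0 ≤ M := by
    have := (norm_nonneg _).trans (h1 1 (by simp))
    simpa using this
  -- Near the origin the two values are bounded separately; since δ ≤ 1 both frequencies stay in
  -- [-3, 3]. Away from it the mean value inequality is used on a segment where |z| ≥ |k|/2 ≥ 1.
  by_cases hk2 : |k| ≤ 2
  · have hb : ∀ x : ℝ, x ≠ 0 → |x| ≤ 3 → ‖H (ε + x * Complex.I)‖ ≤ M * majorant x := by
      intro x hx hx3
      refine (h1 _ (by simpa using hε)).trans ?_
      refine mul_le_mul_of_nonneg_left ?_ hM
      have : |x| ≤ ‖(ε : ℂ) + x * Complex.I‖ := by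
        have := Complex.abs_im_le_norm ((ε : ℂ) + x * Complex.I)
        simpa using this
      have h3 : ‖(ε : ℂ) + x * Complex.I‖ ^ (-(1 / 2) : ℝ) ≤ |x| ^ (-(1 / 2) : ℝ) :=
        Real.rpow_le_rpow_of_nonpos (abs_pos.2 hx) this (by norm_num)
      rw [majorant, indicator_of_mem (mem_Icc.2 (abs_le.1 hx3))]
      have : 0 ≤ 1 / (1 + x ^ 2) := by positivity
      linarith
    have a1 := hb k hk (by linarith)
    have a2 := hb (k + δ) hk' (by
      refine (abs_add_le _ _).trans ?_
      rw [abs_of_pos hδ]; linarith)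
    have b1 := majorant_nonneg k
    have b2 := majorant_nonneg (k + δ)
    refine (norm_sub_le _ _).trans ?_
    have : 0 ≤ M * (majorant k + majorant (k + δ)) := by positivity
    nlinarith
  · push Not at hk2
    set s : Set ℂ := {z | 0 < z.re} ∩ (Complex.im ⁻¹' Icc k (k + δ)) with hs
    have hconv : Convex ℝ s := by
      refine Convex.inter (convex_halfSpace_re_gt 0) ?_
      exact (convex_Icc k (k + δ)).linear_preimage Complex.imLm
    have hnorm : ∀ z ∈ s, |k| / 2 ≤ ‖z‖ := by
      intro z hz
      have h3 : k ≤ z.im ∧ z.im ≤ k + δ := hz.2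
      refine le_trans ?_ (Complex.abs_im_le_norm z)
      rcases le_total 0 k with h0 | h0
      · rw [abs_of_nonneg h0] at hk2 ⊢
        refine le_trans ?_ (le_abs_self _)
        linarith
      · rw [abs_of_nonpos h0] at hk2 ⊢
        refine le_trans ?_ (neg_le_abs _)
        linarith
    have hb : ∀ z ∈ s, ‖deriv H z‖ ≤ 4 * M / k ^ 2 := by
      intro z hz
      have h3 := hnorm z hz
      refine (h2 z hz.1 (by linarith)).trans ?_
      have h4 : (|k| / 2) ^ 2 ≤ ‖z‖ ^ 2 := by gcongr
      rw [div_pow, sq_abs] at h4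
      have hk0 : 0 < k ^ 2 := by positivity
      rw [div_le_div_iff₀ (by nlinarith) hk0]
      nlinarith
    have key := hconv.norm_image_sub_le_of_norm_deriv_le (f := H) (fun z hz => hd z hz.1) hb
      (x := ε + k * Complex.I) (y := ε + (k + δ : ℝ) * Complex.I)
      (by simp [hs, hε, hδ.le]) (by simp [hs, hε, hδ.le])
    have e : ‖((ε : ℂ) + (k + δ : ℝ) * Complex.I) - (ε + k * Complex.I)‖ = δ := by
      have : ((ε : ℂ) + (k + δ : ℝ) * Complex.I) - (ε + k * Complex.I) = (δ : ℂ) * Complex.I := by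
        push_cast
        ring
      rw [this, norm_mul, Complex.norm_I, mul_one, Complex.norm_real, Real.norm_of_nonneg hδ.le]
    rw [e] at key
    refine key.trans ?_
    have hk4 : 4 ≤ k ^ 2 := by
      rw [← sq_abs]
      nlinarith
    have h5 : 4 * M / k ^ 2 ≤ 5 * M * (1 / (1 + k ^ 2)) := by
      rw [mul_one_div, div_le_div_iff₀ (by positivity) (by positivity)]
      nlinarith
    have h6 : 1 / (1 + k ^ 2) ≤ majorant k := by
      rw [majorant]
      have : 0 ≤ (Icc (-3 : ℝ) 3).indicator (fun k => |k| ^ (-(1 / 2) : ℝ)) k :=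
        indicator_nonneg (fun _ _ => by positivity) _
      linarith
    have b2 := majorant_nonneg (k + δ)
    calc 4 * M / k ^ 2 * δ ≤ 4 * M / k ^ 2 * 1 := by gcongr
      _ ≤ 5 * M * (1 / (1 + k ^ 2)) := by rw [mul_one]; exact h5
      _ ≤ _ := by gcongr; linarith

theorem ae_add_ne_zero (δ : ℝ) : ∀ᵐ k : ℝ, k + δ ≠ 0 := by
  filter_upwards [Measure.ae_ne volume (-δ)] with k hk h
  exact hk (by linarith)

/-- A function whose Laplace transform has boundary values of bounded variation is integrable. -/
theorem lintegral_norm_le_of_variation {U : ℝ → ℝ} (hU : SubexponentialGrowth U) {M : ℝ}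
    (h1 : ∀ z : ℂ, 0 < z.re → ‖laplace U z‖ ≤ M * ‖z‖ ^ (-(1 / 2) : ℝ))
    (h2 : ∀ z : ℂ, 0 < z.re → 1 ≤ ‖z‖ → ‖deriv (laplace U) z‖ ≤ M / ‖z‖ ^ 2) {h : ℝ → ℂ}
    (hlim : ∀ k : ℝ, k ≠ 0 →
      Tendsto (fun ε : ℝ => laplace U (ε + k * Complex.I)) (𝓝[>] 0) (𝓝 (h k))) {K : ℝ}
    (hK : ∀ δ : ℝ, 0 < δ → δ ≤ 1 → ∫⁻ k, ‖h (k + δ) - h k‖ₑ ≤ ENNReal.ofReal (K * δ)) :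
    ∫⁻ t in Ioi (0 : ℝ), ‖U t‖ₑ ≤ ENNReal.ofReal K := by
  have hu := hU.toC
  rw [laplace_eq_laplaceC] at h1 h2 hlim
  have key := lintegral_pow_mul_norm_div_le (u := fun t => (U t : ℂ)) hu.aestronglyMeasurable 1
    (K := K) ?_
  · refine le_trans (le_of_eq ?_) key
    refine setLIntegral_congr_fun measurableSet_Ioi fun t ht => ?_
    have ht' : (0 : ℝ) < t := ht
    simp only [pow_one]
    rw [mul_div_cancel_left₀ _ ht'.ne', Complex.norm_real, ofReal_norm]
  · intro δ hδ hδ1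
    simp only [pow_one]
    refine le_trans ?_ (hK δ hδ hδ1)
    refine lintegral_norm_div_le_of_boundary (hu.mul_cexp_sub_one δ)
      (D := fun k => 5 * M * (majorant k + majorant (k + δ))) ?_ ?_ ?_
    · exact (integrable_majorant.add (integrable_majorant.comp_add_right δ)).const_mul _
    · intro ε hε _
      filter_upwards [Measure.ae_ne volume (0 : ℝ), ae_add_ne_zero δ] with k hk hk'
      rw [laplaceC_mul_cexp_sub_one hu δ (by simpa using hε)]
      have := norm_sub_le_majorant (fun z hz => (hasDerivAt_laplaceC hu hz).differentiableAt)
        h1 h2 hδ hδ1 hε hk hk'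
      convert this using 4
      push_cast
      ring
    · filter_upwards [Measure.ae_ne volume (0 : ℝ), ae_add_ne_zero δ] with k hk hk'
      refine ((hlim _ hk').sub (hlim k hk)).congr' ?_
      filter_upwards [self_mem_nhdsWithin] with ε hε
      rw [laplaceC_mul_cexp_sub_one hu δ (by simpa using hε)]
      congr 2
      push_cast
      ring

/-- The second order version: if the derivative of the boundary values is of bounded variation, then
`t ↦ t * U t` is integrable. -/
theorem lintegral_mul_norm_le_of_variation {U : ℝ → ℝ} (hU : SubexponentialGrowth U) {M : ℝ}
    (h1 : ∀ z : ℂ, 0 < z.re → ‖laplace U z‖ ≤ M * ‖z‖ ^ (-(1 / 2) : ℝ))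
    (h2 : ∀ z : ℂ, 0 < z.re → 1 ≤ ‖z‖ → ‖deriv (laplace U) z‖ ≤ M / ‖z‖ ^ 2) {h : ℝ → ℂ}
    (hlim : ∀ k : ℝ, k ≠ 0 →
      Tendsto (fun ε : ℝ => laplace U (ε + k * Complex.I)) (𝓝[>] 0) (𝓝 (h k))) {K : ℝ}
    (hK : ∀ δ : ℝ, 0 < δ → δ ≤ 1 →
      ∫⁻ k, ‖(h (k + δ + δ) - h (k + δ)) - (h (k + δ) - h k)‖ₑ ≤ ENNReal.ofReal (K * δ ^ 2)) :
    ∫⁻ t in Ioi (0 : ℝ), ‖t * U t‖ₑ ≤ ENNReal.ofReal K := by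
  have hu := hU.toC
  rw [laplace_eq_laplaceC] at h1 h2 hlim
  have key := lintegral_pow_mul_norm_div_le (u := fun t => (U t : ℂ)) hu.aestronglyMeasurable 2
    (K := K) ?_
  · refine le_trans (le_of_eq ?_) key
    refine setLIntegral_congr_fun measurableSet_Ioi fun t ht => ?_
    have ht' : (0 : ℝ) < t := ht
    rw [← ofReal_norm, norm_mul, Complex.norm_real, Real.norm_of_nonneg ht'.le]
    congr 1
    field_simp
  · intro δ hδ hδ1
    have esq : ∀ a b : ℂ, a ^ 2 * b = a * (a * b) := fun a b => by ring
    simp only [esq]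
    refine le_trans ?_ (hK δ hδ hδ1)
    have hu1 := hu.mul_cexp_sub_one δ
    have e : ∀ ε : ℝ, 0 < ε → ∀ k : ℝ,
        laplaceC (fun t => (Complex.exp (((-(δ * t) : ℝ) : ℂ) * Complex.I) - 1) *
          ((Complex.exp (((-(δ * t) : ℝ) : ℂ) * Complex.I) - 1) * (U t : ℂ))) (ε + k * Complex.I) =
        (laplaceC (fun t => (U t : ℂ)) (ε + (k + δ + δ : ℝ) * Complex.I) -
          laplaceC (fun t => (U t : ℂ)) (ε + (k + δ : ℝ) * Complex.I)) -
        (laplaceC (fun t => (U t : ℂ)) (ε + (k + δ : ℝ) * Complex.I) -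
          laplaceC (fun t => (U t : ℂ)) (ε + k * Complex.I)) := by
      intro ε hε k
      rw [laplaceC_mul_cexp_sub_one hu1 δ (by simpa using hε),
        laplaceC_mul_cexp_sub_one hu δ (by simpa using hε),
        laplaceC_mul_cexp_sub_one hu δ (by simpa using hε)]
      have e1 : (ε : ℂ) + k * Complex.I + δ * Complex.I = ε + (k + δ : ℝ) * Complex.I := by
        push_cast
        ring
      have e2 : (ε : ℂ) + (k + δ : ℝ) * Complex.I + δ * Complex.I =
          ε + (k + δ + δ : ℝ) * Complex.I := by
        push_cast
        ring
      rw [e1, e2]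
    refine lintegral_norm_div_le_of_boundary (hu1.mul_cexp_sub_one δ)
      (D := fun k => 5 * M * (majorant (k + δ) + majorant (k + δ + δ)) +
        5 * M * (majorant k + majorant (k + δ))) ?_ ?_ ?_
    · have i1 := integrable_majorant.comp_add_right δ
      have i2 := i1.comp_add_right δ
      exact ((i1.add i2).const_mul _).add ((integrable_majorant.add i1).const_mul _)
    · intro ε hε _
      filter_upwards [Measure.ae_ne volume (0 : ℝ), ae_add_ne_zero δ, ae_add_ne_zero (δ + δ)]
        with k hk hk' hk''
      rw [e ε hε]
      have hd : ∀ z : ℂ, 0 < z.re → DifferentiableAt ℂ (laplaceC fun t => (U t : ℂ)) z :=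
        fun z hz => (hasDerivAt_laplaceC hu hz).differentiableAt
      exact (norm_sub_le _ _).trans (add_le_add
        (norm_sub_le_majorant hd h1 h2 hδ hδ1 hε hk' (by rwa [add_assoc]))
        (norm_sub_le_majorant hd h1 h2 hδ hδ1 hε hk hk'))
    · filter_upwards [Measure.ae_ne volume (0 : ℝ), ae_add_ne_zero δ, ae_add_ne_zero (δ + δ)]
        with k hk hk' hk''
      refine (((hlim (k + δ + δ) (by rwa [add_assoc])).sub (hlim _ hk')).sub
        ((hlim _ hk').sub (hlim k hk))).congr' ?_
      filter_upwards [self_mem_nhdsWithin] with ε hε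
      rw [e ε hε]

/-- Tonelli: after the shift y = x + s, each of the s-slices has at most the full mass of D. -/
theorem lintegral_lintegral_Ioc_le {D : ℝ → ℝ≥0∞} (hD : Measurable D) (δ : ℝ) :
    ∫⁻ x in Ioi (0 : ℝ), ∫⁻ y in Ioc x (x + δ), D y ≤
      ENNReal.ofReal δ * ∫⁻ y in Ioi (0 : ℝ), D y := by
  set D0 : ℝ → ℝ≥0∞ := (Ioi (0 : ℝ)).indicator D with hD0
  have hD0m : Measurable D0 := hD.indicator measurableSet_Ioi
  calc ∫⁻ x in Ioi (0 : ℝ), ∫⁻ y in Ioc x (x + δ), D y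
      ≤ ∫⁻ x in Ioi (0 : ℝ), ∫⁻ s in Ioc 0 δ, D0 (x + s) := by
        refine setLIntegral_mono' measurableSet_Ioi fun x hx => le_of_eq ?_
        rw [← lintegral_indicator measurableSet_Ioc, ← lintegral_indicator measurableSet_Ioc,
          ← lintegral_add_left_eq_self _ x]
        congr 1 with s
        have hx' : (0 : ℝ) < x := hx
        by_cases hs : s ∈ Ioc 0 δ
        · rw [indicator_of_mem hs, indicator_of_mem (show x + s ∈ Ioc x (x + δ) from
              ⟨by linarith [hs.1], by linarith [hs.2]⟩), hD0,
            indicator_of_mem (show x + s ∈ Ioi (0 : ℝ) from by simp only [mem_Ioi]; linarith [hs.1])]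
        · rw [indicator_of_notMem hs, indicator_of_notMem]
          intro h
          exact hs ⟨by linarith [h.1], by linarith [h.2]⟩
    _ ≤ ∫⁻ x, ∫⁻ s in Ioc 0 δ, D0 (x + s) := setLIntegral_le_lintegral _ _
    _ = ∫⁻ s in Ioc 0 δ, ∫⁻ x, D0 (x + s) := by
        rw [lintegral_lintegral_swap]
        exact (hD0m.comp (measurable_fst.add measurable_snd)).aemeasurable
    _ = ENNReal.ofReal δ * ∫⁻ y in Ioi (0 : ℝ), D y := by
        simp_rw [lintegral_add_right_eq_self]
        rw [setLIntegral_const, Real.volume_Ioc, sub_zero, hD0, lintegral_indicator measurableSet_Ioi,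
          mul_comm]

/-- The `L¹` modulus of continuity of a function of bounded variation off the origin. -/
theorem lintegral_enorm_sub_le {ψ : ℝ → ℂ} {D : ℝ → ℝ≥0∞} (hD : Measurable D)
    (h1 : ∀ x y : ℝ, 0 < x → x ≤ y → ‖ψ y - ψ x‖ₑ ≤ ∫⁻ s in Ioc x y, D s)
    (h2 : ∀ x y : ℝ, 0 < x → x ≤ y → ‖ψ (-y) - ψ (-x)‖ₑ ≤ ∫⁻ s in Ioc x y, D s) {V : ℝ}
    (hV : ∫⁻ s in Ioi (0 : ℝ), D s ≤ ENNReal.ofReal V)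
    (h3 : ∀ x : ℝ, x ≠ 0 → ‖ψ x‖ₑ ≤ ENNReal.ofReal V) {δ : ℝ} (hδ : 0 < δ) :
    ∫⁻ k, ‖ψ (k + δ) - ψ k‖ₑ ≤ ENNReal.ofReal (4 * V * δ) := by
  have hG := (lintegral_lintegral_Ioc_le hD δ).trans (mul_le_mul_right hV (ENNReal.ofReal δ))
  have hA : ∫⁻ k in Ioi (0 : ℝ), ‖ψ (k + δ) - ψ k‖ₑ ≤ ENNReal.ofReal δ * ENNReal.ofReal V := by
    refine le_trans ?_ hG
    exact setLIntegral_mono' measurableSet_Ioi fun k hk => h1 k (k + δ) hk (by linarith)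
  have hB : ∫⁻ k in Iio (-δ), ‖ψ (k + δ) - ψ k‖ₑ ≤ ENNReal.ofReal δ * ENNReal.ofReal V := by
    refine le_trans ?_ hG
    rw [← lintegral_indicator measurableSet_Iio, ← lintegral_indicator measurableSet_Ioi,
      ← lintegral_sub_left_eq_self _ (-δ)]
    refine lintegral_mono fun x => ?_
    simp only
    by_cases hx : x ∈ Ioi (0 : ℝ)
    · have hx' : (0 : ℝ) < x := hx
      rw [indicator_of_mem hx, indicator_of_mem (show -δ - x ∈ Iio (-δ) from by
        simp only [mem_Iio]; linarith)]
      have := h2 x (x + δ) hx' (by linarith)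
      rw [← enorm_neg] at this
      rw [show -δ - x + δ = -x by ring, show -δ - x = -(x + δ) by ring]
      rwa [neg_sub] at this
    · rw [indicator_of_notMem]
      · exact zero_le
      · intro h
        simp only [mem_Iio, mem_Ioi] at h hx
        exact hx (by linarith)
  -- The windows [k, k + δ] that straddle the origin, where ψ may jump: the sup bound gives 2V over
  -- a length δ. With Vδ from each half-line the total constant is 4.
  have hC : ∫⁻ k in Icc (-δ) 0, ‖ψ (k + δ) - ψ k‖ₑ ≤
      ENNReal.ofReal δ * ENNReal.ofReal V + ENNReal.ofReal δ * ENNReal.ofReal V := by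
    calc ∫⁻ k in Icc (-δ) 0, ‖ψ (k + δ) - ψ k‖ₑ
        ≤ ∫⁻ k in Icc (-δ) 0, (ENNReal.ofReal V + ENNReal.ofReal V) := by
          refine lintegral_mono_ae (ae_restrict_of_ae ?_)
          filter_upwards [Measure.ae_ne volume (0 : ℝ), ae_add_ne_zero δ] with k hk hk'
          exact enorm_sub_le.trans (add_le_add (h3 _ hk') (h3 _ hk))
      _ = _ := by
          rw [setLIntegral_const, Real.volume_Icc, zero_sub, neg_neg, add_mul, mul_comm]
  have huniv : (univ : Set ℝ) ⊆ (Ioi 0 ∪ Iio (-δ)) ∪ Icc (-δ) 0 := by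
    intro x _
    rcases lt_or_ge 0 x with h | h
    · exact Or.inl (Or.inl h)
    · rcases lt_or_ge x (-δ) with h' | h'
      · exact Or.inl (Or.inr h')
      · exact Or.inr ⟨h', h⟩
  calc ∫⁻ k, ‖ψ (k + δ) - ψ k‖ₑ = ∫⁻ k in univ, ‖ψ (k + δ) - ψ k‖ₑ := by rw [setLIntegral_univ]
    _ ≤ ∫⁻ k in (Ioi 0 ∪ Iio (-δ)) ∪ Icc (-δ) 0, ‖ψ (k + δ) - ψ k‖ₑ := lintegral_mono_set huniv
    _ ≤ ((∫⁻ k in Ioi 0, ‖ψ (k + δ) - ψ k‖ₑ) + ∫⁻ k in Iio (-δ), ‖ψ (k + δ) - ψ k‖ₑ) +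
        ∫⁻ k in Icc (-δ) 0, ‖ψ (k + δ) - ψ k‖ₑ :=
        (lintegral_union_le _ _ _).trans (add_le_add_left (lintegral_union_le _ _ _) _)
    _ ≤ (ENNReal.ofReal δ * ENNReal.ofReal V + ENNReal.ofReal δ * ENNReal.ofReal V) +
        (ENNReal.ofReal δ * ENNReal.ofReal V + ENNReal.ofReal δ * ENNReal.ofReal V) :=
        add_le_add (add_le_add hA hB) hC
    _ = ENNReal.ofReal (4 * V * δ) := by
        rw [← ENNReal.ofReal_mul hδ.le, ← two_mul, ← two_mul, ← mul_assoc,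
          show (2 : ℝ≥0∞) * 2 = ENNReal.ofReal 4 by norm_num, ← ENNReal.ofReal_mul (by norm_num)]
        congr 1
        ring

/-- Real functions have conjugate-symmetric transforms, so boundary values need to be known only for
k > 0. -/
theorem laplace_conj (U : ℝ → ℝ) (z : ℂ) :
    laplace U ((starRingEnd ℂ) z) = (starRingEnd ℂ) (laplace U z) := by
  rw [laplace, laplace, ← integral_conj]
  congr 1 with t
  rw [map_mul, ← Complex.exp_conj, map_neg, map_mul, Complex.conj_ofReal, Complex.conj_ofReal]

/-- The extension of a function on the positive half-line with `h (-k) = conj (h k)`. -/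
def symmExt (φ : ℝ → ℂ) (k : ℝ) : ℂ := if 0 < k then φ k else (starRingEnd ℂ) (φ (-k))

theorem symmExt_pos {φ : ℝ → ℂ} {k : ℝ} (hk : 0 < k) : symmExt φ k = φ k := if_pos hk

theorem symmExt_neg {φ : ℝ → ℂ} {k : ℝ} (hk : 0 < k) :
    symmExt φ (-k) = (starRingEnd ℂ) (φ k) := by
  rw [symmExt, if_neg (by linarith), neg_neg]

theorem tendsto_laplace_symmExt {U : ℝ → ℝ} {φ : ℝ → ℂ} (hlim : ∀ k : ℝ, 0 < k →
      Tendsto (fun ε : ℝ => laplace U (ε + k * Complex.I)) (𝓝[>] 0) (𝓝 (φ k))) (k : ℝ) (hk : k ≠ 0) :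
    Tendsto (fun ε : ℝ => laplace U (ε + k * Complex.I)) (𝓝[>] 0) (𝓝 (symmExt φ k)) := by
  rcases lt_or_gt_of_ne hk with h | h
  · obtain ⟨l, rfl⟩ : ∃ l, k = -l := ⟨-k, (neg_neg k).symm⟩
    have hl : 0 < l := by linarith
    rw [symmExt_neg hl]
    refine ((Complex.continuous_conj.tendsto _).comp (hlim l hl)).congr fun ε => ?_
    rw [Function.comp_apply, ← laplace_conj]
    congr 1
    simp
  · rw [symmExt_pos h]
    exact hlim k h

theorem norm_boundary_le {H : ℂ → ℂ} {M : ℝ}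
    (h1 : ∀ z : ℂ, 0 < z.re → ‖H z‖ ≤ M * ‖z‖ ^ (-(1 / 2) : ℝ)) {k : ℝ} (hk : 0 < k) {a : ℂ}
    (hlim : Tendsto (fun ε : ℝ => H (ε + k * Complex.I)) (𝓝[>] 0) (𝓝 a)) :
    ‖a‖ ≤ M * k ^ (-(1 / 2) : ℝ) := by
  have h2 : Tendsto (fun ε : ℝ => M * ‖(ε : ℂ) + k * Complex.I‖ ^ (-(1 / 2) : ℝ)) (𝓝[>] 0)
      (𝓝 (M * ‖((0 : ℝ) : ℂ) + k * Complex.I‖ ^ (-(1 / 2) : ℝ))) := by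
    refine Tendsto.const_mul _ (Tendsto.rpow_const ?_ (Or.inl ?_))
    · have : Continuous fun ε : ℝ => ‖(ε : ℂ) + k * Complex.I‖ := by fun_prop
      exact (this.tendsto 0).mono_left nhdsWithin_le_nhds
    · simp [hk.ne']
  have e : ‖((0 : ℝ) : ℂ) + k * Complex.I‖ = k := by
    simp [abs_of_pos hk]
  rw [e] at h2
  refine le_of_tendsto_of_tendsto hlim.norm h2 ?_
  filter_upwards [self_mem_nhdsWithin] with ε hε
  exact h1 _ (by simpa using hε)

theorem tendsto_zero_of_le_rpow {φ : ℝ → ℂ} {M : ℝ}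
    (h : ∀ k : ℝ, 0 < k → ‖φ k‖ ≤ M * k ^ (-(1 / 2) : ℝ)) : Tendsto φ atTop (𝓝 0) := by
  refine squeeze_zero_norm' (a := fun k : ℝ => M * k ^ (-(1 / 2) : ℝ)) ?_ ?_
  · filter_upwards [eventually_gt_atTop 0] with k hk using h k hk
  · simpa using (tendsto_rpow_neg_atTop (show (0 : ℝ) < 1 / 2 by norm_num)).const_mul M

/-- A function tending to zero at infinity is bounded by its total variation. This supplies the sup
bound needed across the origin. -/
theorem enorm_le_of_variation {φ : ℝ → ℂ} (hφ : Tendsto φ atTop (𝓝 0)) {D : ℝ → ℝ≥0∞}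
    (h1 : ∀ x y : ℝ, 0 < x → x ≤ y → ‖φ y - φ x‖ₑ ≤ ∫⁻ s in Ioc x y, D s) {V : ℝ}
    (hV : ∫⁻ s in Ioi (0 : ℝ), D s ≤ ENNReal.ofReal V) {x : ℝ} (hx : 0 < x) :
    ‖φ x‖ₑ ≤ ENNReal.ofReal V := by
  have h2 : Tendsto (fun y => ‖φ y - φ x‖ₑ) atTop (𝓝 ‖(0 : ℂ) - φ x‖ₑ) :=
    (hφ.sub_const _).enorm
  rw [zero_sub, enorm_neg] at h2
  refine le_of_tendsto h2 ?_
  filter_upwards [eventually_ge_atTop x] with y hy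
  refine (h1 x y hx hy).trans (le_trans (lintegral_mono_set fun s hs => ?_) hV)
  exact lt_trans hx hs.1

/-- Integrability from the total variation of the boundary values on the positive half-line. -/
theorem lintegral_norm_le_of_boundary_variation {U : ℝ → ℝ} (hU : SubexponentialGrowth U) {M : ℝ}
    (h1 : ∀ z : ℂ, 0 < z.re → ‖laplace U z‖ ≤ M * ‖z‖ ^ (-(1 / 2) : ℝ))
    (h2 : ∀ z : ℂ, 0 < z.re → 1 ≤ ‖z‖ → ‖deriv (laplace U) z‖ ≤ M / ‖z‖ ^ 2) {φ : ℝ → ℂ}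
    (hlim : ∀ k : ℝ, 0 < k →
      Tendsto (fun ε : ℝ => laplace U (ε + k * Complex.I)) (𝓝[>] 0) (𝓝 (φ k)))
    {D : ℝ → ℝ≥0∞} (hD : Measurable D)
    (hφ : ∀ x y : ℝ, 0 < x → x ≤ y → ‖φ y - φ x‖ₑ ≤ ∫⁻ s in Ioc x y, D s) {V : ℝ}
    (hV : ∫⁻ s in Ioi (0 : ℝ), D s ≤ ENNReal.ofReal V) :
    ∫⁻ t in Ioi (0 : ℝ), ‖U t‖ₑ ≤ ENNReal.ofReal (4 * V) := by
  have hz : Tendsto φ atTop (𝓝 0) :=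
    tendsto_zero_of_le_rpow fun k hk => norm_boundary_le h1 hk (hlim k hk)
  have hb : ∀ x, 0 < x → ‖φ x‖ₑ ≤ ENNReal.ofReal V := fun x hx =>
    enorm_le_of_variation hz hφ hV hx
  have hconj : ∀ z : ℂ, ‖(starRingEnd ℂ) z‖ₑ = ‖z‖ₑ := fun z => by
    rw [← ofReal_norm, ← ofReal_norm, RCLike.norm_conj]
  refine lintegral_norm_le_of_variation hU h1 h2 (tendsto_laplace_symmExt hlim) fun δ hδ _ =>
    lintegral_enorm_sub_le hD (fun x y hx hxy => ?_) (fun x y hx hxy => ?_) hV (fun x hx => ?_) hδ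
  · rw [symmExt_pos hx, symmExt_pos (hx.trans_le hxy)]
    exact hφ x y hx hxy
  · rw [symmExt_neg hx, symmExt_neg (hx.trans_le hxy), ← map_sub, hconj]
    exact hφ x y hx hxy
  · rcases lt_or_gt_of_ne hx with h | h
    · obtain ⟨l, rfl⟩ : ∃ l, x = -l := ⟨-x, (neg_neg x).symm⟩
      rw [symmExt_neg (by linarith), hconj]
      exact hb l (by linarith)
    · rw [symmExt_pos h]
      exact hb x h

/-- The extension with `ψ (-k) = -conj (ψ k)`. -/
def antiExt (φ : ℝ → ℂ) (k : ℝ) : ℂ := if 0 < k then φ k else -(starRingEnd ℂ) (φ (-k))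

theorem antiExt_pos {φ : ℝ → ℂ} {k : ℝ} (hk : 0 < k) : antiExt φ k = φ k := if_pos hk

theorem antiExt_neg {φ : ℝ → ℂ} {k : ℝ} (hk : 0 < k) :
    antiExt φ (-k) = -(starRingEnd ℂ) (φ k) := by
  rw [antiExt, if_neg (by linarith), neg_neg]

/-- The limit of f at 0+ is real, hence equal to its conjugate, so the symmetric extension has no
jump at the origin and its derivative no point mass there. Differentiating k ↦ conj (f (-k))
produces the sign in `antiExt`. -/
theorem symmExt_sub_eq_integral {f φ : ℝ → ℂ} (hφm : Measurable φ) {V : ℝ}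
    (hb : ∀ x, 0 < x → ‖φ x‖ ≤ V)
    (hf : ∀ x y : ℝ, 0 < x → x ≤ y → f y - f x = ∫ s in x..y, φ s) {a : ℝ}
    (ha : Tendsto f (𝓝[>] 0) (𝓝 (a : ℂ))) :
    (∀ x y : ℝ, IntervalIntegrable (antiExt φ) volume x y) ∧
    ∀ x y : ℝ, x ≠ 0 → y ≠ 0 → symmExt f y - symmExt f x = ∫ s in x..y, antiExt φ s := by
  have hm : Measurable (antiExt φ) := by
    refine Measurable.ite measurableSet_Ioi hφm ?_
    exact (Complex.continuous_conj.measurable.comp (hφm.comp measurable_neg)).neg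
  have hbd : ∀ᵐ s : ℝ, ‖antiExt φ s‖ ≤ V := by
    filter_upwards [Measure.ae_ne volume (0 : ℝ)] with s hs
    rcases lt_or_gt_of_ne hs with h | h
    · obtain ⟨l, rfl⟩ : ∃ l, s = -l := ⟨-s, (neg_neg s).symm⟩
      rw [antiExt_neg (by linarith), norm_neg, RCLike.norm_conj]
      exact hb l (by linarith)
    · rw [antiExt_pos h]
      exact hb s h
  have hint : ∀ x y : ℝ, IntervalIntegrable (antiExt φ) volume x y := by
    intro x y
    rw [intervalIntegrable_iff]
    refine Measure.integrableOn_of_bounded (M := V) ?_ hm.aestronglyMeasurable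
      (ae_restrict_of_ae hbd)
    simp [uIoc]
  refine ⟨hint, ?_⟩
  have hpos : ∀ y : ℝ, 0 < y → f y - a = ∫ s in (0 : ℝ)..y, antiExt φ s := by
    intro y hy
    have h1 : Tendsto (fun x => f y - f x) (𝓝[>] 0) (𝓝 (f y - a)) := tendsto_const_nhds.sub ha
    have h2 : Tendsto (fun x => ∫ s in x..y, antiExt φ s) (𝓝[>] 0)
        (𝓝 (∫ s in (0 : ℝ)..y, antiExt φ s)) := by
      have hc : Continuous fun x => ∫ s in y..x, antiExt φ s :=
        intervalIntegral.continuous_primitive hint y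
      have hc' : Continuous fun x => ∫ s in x..y, antiExt φ s := by
        refine hc.neg.congr fun x => ?_
        rw [Pi.neg_apply, intervalIntegral.integral_symm x y, neg_neg]
      exact (hc'.tendsto 0).mono_left nhdsWithin_le_nhds
    refine tendsto_nhds_unique (h1.congr' ?_) h2
    filter_upwards [Ioo_mem_nhdsGT hy] with x hx
    rw [hf x y hx.1 hx.2.le]
    refine intervalIntegral.integral_congr fun s hs => ?_
    rw [uIcc_of_le hx.2.le] at hs
    exact (antiExt_pos (hx.1.trans_le hs.1)).symm
  have hall : ∀ y : ℝ, y ≠ 0 → symmExt f y - a = ∫ s in (0 : ℝ)..y, antiExt φ s := by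
    intro y hy
    rcases lt_or_gt_of_ne hy with h | h
    · obtain ⟨l, rfl⟩ : ∃ l, y = -l := ⟨-y, (neg_neg y).symm⟩
      have hl : 0 < l := by linarith
      rw [symmExt_neg hl]
      have h1 := congrArg (starRingEnd ℂ) (hpos l hl)
      rw [map_sub, Complex.conj_ofReal] at h1
      rw [h1, intervalIntegral.integral_of_le hl.le, ← integral_conj,
        ← intervalIntegral.integral_of_le hl.le]
      have h2 := intervalIntegral.integral_comp_neg (a := 0) (b := l) (antiExt φ)
      rw [neg_zero] at h2
      rw [intervalIntegral.integral_symm (-l) 0, ← h2, ← intervalIntegral.integral_neg]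
      refine intervalIntegral.integral_congr_ae (ae_of_all _ fun s hs => ?_)
      rw [uIoc_of_le hl.le] at hs
      rw [antiExt_pos hs.1, antiExt_neg hs.1, neg_neg]
    · rw [symmExt_pos h]
      exact hpos y h
  intro x y hx hy
  rw [← intervalIntegral.integral_interval_sub_left (hint 0 y) (hint 0 x), ← hall x hx, ← hall y hy]
  ring

/-- Integrability from the total variation of the derivative of the boundary values on the positive
half-line. -/
theorem lintegral_mul_norm_le_of_boundary_variation {U : ℝ → ℝ} (hU : SubexponentialGrowth U) {M : ℝ}
    (h1 : ∀ z : ℂ, 0 < z.re → ‖laplace U z‖ ≤ M * ‖z‖ ^ (-(1 / 2) : ℝ))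
    (h2 : ∀ z : ℂ, 0 < z.re → 1 ≤ ‖z‖ → ‖deriv (laplace U) z‖ ≤ M / ‖z‖ ^ 2) {f φ : ℝ → ℂ}
    (hlim : ∀ k : ℝ, 0 < k →
      Tendsto (fun ε : ℝ => laplace U (ε + k * Complex.I)) (𝓝[>] 0) (𝓝 (f k)))
    (hφm : Measurable φ) (hf : ∀ x y : ℝ, 0 < x → x ≤ y → f y - f x = ∫ s in x..y, φ s) {a : ℝ}
    (ha : Tendsto f (𝓝[>] 0) (𝓝 (a : ℂ))) (hz : Tendsto φ atTop (𝓝 0))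
    {D : ℝ → ℝ≥0∞} (hD : Measurable D)
    (hφ : ∀ x y : ℝ, 0 < x → x ≤ y → ‖φ y - φ x‖ₑ ≤ ∫⁻ s in Ioc x y, D s) {V : ℝ} (hV0 : 0 ≤ V)
    (hV : ∫⁻ s in Ioi (0 : ℝ), D s ≤ ENNReal.ofReal V) :
    ∫⁻ t in Ioi (0 : ℝ), ‖t * U t‖ₑ ≤ ENNReal.ofReal (4 * V) := by
  have hb : ∀ x, 0 < x → ‖φ x‖ₑ ≤ ENNReal.ofReal V := fun x hx =>
    enorm_le_of_variation hz hφ hV hx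
  have hb' : ∀ x, 0 < x → ‖φ x‖ ≤ V := fun x hx => by
    have := hb x hx
    rwa [← ofReal_norm, ENNReal.ofReal_le_ofReal_iff hV0] at this
  have hconj : ∀ z : ℂ, ‖(starRingEnd ℂ) z‖ₑ = ‖z‖ₑ := fun z => by
    rw [← ofReal_norm, ← ofReal_norm, RCLike.norm_conj]
  obtain ⟨hint, hsub⟩ := symmExt_sub_eq_integral hφm hb' hf ha
  set ψ := antiExt φ with hψ
  have hψm : Measurable ψ := by
    refine Measurable.ite measurableSet_Ioi hφm ?_
    exact (Complex.continuous_conj.measurable.comp (hφm.comp measurable_neg)).neg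
  refine lintegral_mul_norm_le_of_variation hU h1 h2 (tendsto_laplace_symmExt hlim) fun δ hδ _ => ?_
  have hvar : ∫⁻ k, ‖ψ (k + δ) - ψ k‖ₑ ≤ ENNReal.ofReal (4 * V * δ) := by
    refine lintegral_enorm_sub_le hD (fun x y hx hxy => ?_) (fun x y hx hxy => ?_) hV
      (fun x hx => ?_) hδ
    · rw [hψ, antiExt_pos hx, antiExt_pos (hx.trans_le hxy)]
      exact hφ x y hx hxy
    · rw [hψ, antiExt_neg hx, antiExt_neg (hx.trans_le hxy), ← neg_sub', enorm_neg, ← map_sub, hconj]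
      exact hφ x y hx hxy
    · rcases lt_or_gt_of_ne hx with h | h
      · obtain ⟨l, rfl⟩ : ∃ l, x = -l := ⟨-x, (neg_neg x).symm⟩
        rw [hψ, antiExt_neg (by linarith), enorm_neg, hconj]
        exact hb l (by linarith)
      · rw [hψ, antiExt_pos h]
        exact hb x h
  -- A second difference of f is the integral over [0, δ] of first differences of its derivative;
  -- together with the L¹ modulus 4Vδ of the latter this yields 4Vδ².
  have hpt : ∀ᵐ k : ℝ, ‖(symmExt f (k + δ + δ) - symmExt f (k + δ)) -
      (symmExt f (k + δ) - symmExt f k)‖ₑ ≤ ∫⁻ s in Ioc 0 δ, ‖ψ (k + s + δ) - ψ (k + s)‖ₑ := by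
    filter_upwards [Measure.ae_ne volume (0 : ℝ), ae_add_ne_zero δ, ae_add_ne_zero (δ + δ)]
      with k hk hk' hk''
    rw [hsub _ _ hk' (by rwa [add_assoc]), hsub _ _ hk hk']
    have e1 : ∫ s in (k + δ)..(k + δ + δ), ψ s = ∫ s in (0 : ℝ)..δ, ψ (k + s + δ) := by
      have := intervalIntegral.integral_comp_add_left (a := 0) (b := δ) ψ (k + δ)
      rw [add_zero] at this
      rw [← this]
      congr 1 with s
      congr 1
      ring
    have e2 : ∫ s in k..(k + δ), ψ s = ∫ s in (0 : ℝ)..δ, ψ (k + s) := by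
      have := intervalIntegral.integral_comp_add_left (a := 0) (b := δ) ψ k
      rw [add_zero] at this
      exact this.symm
    have i1 : IntervalIntegrable (fun s => ψ (k + s + δ)) volume 0 δ := by
      have := (hint (k + δ) (k + δ + δ)).comp_add_left (k + δ)
      simp only [sub_self, add_sub_cancel_left] at this
      refine this.congr fun s _ => ?_
      congr 1
      ring
    have i2 : IntervalIntegrable (fun s => ψ (k + s)) volume 0 δ := by
      have := (hint k (k + δ)).comp_add_left k
      simpa only [sub_self, add_sub_cancel_left] using this
    rw [e1, e2, ← intervalIntegral.integral_sub i1 i2, intervalIntegral.integral_of_le hδ.le]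
    exact enorm_integral_le_lintegral_enorm _
  calc _ ≤ ∫⁻ k, ∫⁻ s in Ioc 0 δ, ‖ψ (k + s + δ) - ψ (k + s)‖ₑ := lintegral_mono_ae hpt
    _ = ∫⁻ s in Ioc 0 δ, ∫⁻ k, ‖ψ (k + s + δ) - ψ (k + s)‖ₑ := by
        rw [lintegral_lintegral_swap]
        refine Measurable.aemeasurable (Measurable.enorm (Measurable.sub ?_ ?_))
        · exact hψm.comp ((measurable_fst.add measurable_snd).add_const δ)
        · exact hψm.comp (measurable_fst.add measurable_snd)
    _ = ∫⁻ s in Ioc 0 δ, ∫⁻ k, ‖ψ (k + δ) - ψ k‖ₑ := by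
        congr 1 with s
        exact lintegral_add_right_eq_self (fun k => ‖ψ (k + δ) - ψ k‖ₑ) s
    _ ≤ ENNReal.ofReal (4 * V * δ) * ENNReal.ofReal δ := by
        rw [setLIntegral_const, Real.volume_Ioc, sub_zero]
        gcongr
    _ = ENNReal.ofReal (4 * V * δ ^ 2) := by
        rw [← ENNReal.ofReal_mul (by positivity)]
        congr 1
        ring

/-! ### Consequences of regularity and sectoriality, in the half-plane and on the axis. -/

theorem SubexponentialGrowth.differentiableOn_laplace {b : ℝ → ℝ} (hb : SubexponentialGrowth b) :
    DifferentiableOn ℂ (laplace b) {z | 0 < z.re} := by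
  rw [laplace_eq_laplaceC]
  exact differentiableOn_laplaceC hb.toC

theorem isOpen_re_pos : IsOpen {z : ℂ | 0 < z.re} := isOpen_lt continuous_const Complex.continuous_re

theorem SubexponentialGrowth.hasDerivAt_laplace {b : ℝ → ℝ} (hb : SubexponentialGrowth b) {z : ℂ}
    (hz : 0 < z.re) : HasDerivAt (laplace b) (deriv (laplace b) z) z :=
  (hb.differentiableOn_laplace.differentiableAt (isOpen_re_pos.mem_nhds hz)).hasDerivAt

theorem SubexponentialGrowth.hasDerivAt_deriv_laplace {b : ℝ → ℝ} (hb : SubexponentialGrowth b)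
    {z : ℂ} (hz : 0 < z.re) :
    HasDerivAt (deriv (laplace b)) (deriv (deriv (laplace b)) z) z :=
  ((hb.differentiableOn_laplace.deriv isOpen_re_pos).differentiableAt
    (isOpen_re_pos.mem_nhds hz)).hasDerivAt

/-- The quantitative form of 2-regularity. -/
structure RegularBound (b : ℝ → ℝ) (C : ℝ) : Prop where
  nonneg : 0 ≤ C
  one : ∀ z : ℂ, 0 < z.re → ‖z‖ * ‖deriv (laplace b) z‖ ≤ C * ‖laplace b z‖
  two : ∀ z : ℂ, 0 < z.re → ‖z‖ ^ 2 * ‖deriv (deriv (laplace b)) z‖ ≤ C * ‖laplace b z‖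

theorem IsRegular.exists_regularBound {b : ℝ → ℝ} (h : IsRegular 2 b) : ∃ C, RegularBound b C := by
  obtain ⟨C, hC, h⟩ := h
  refine ⟨C, hC.le, fun z hz => ?_, fun z hz => ?_⟩
  · have := h z hz 1 (by norm_num)
    rwa [pow_one, iteratedDeriv_one] at this
  · have := h z hz 2 le_rfl
    rwa [iteratedDeriv_succ, iteratedDeriv_one] at this

/-- The Laplace transform of a regular kernel is slowly varying, in exponential coordinates. -/
theorem RegularBound.norm_laplace_exp_le {b : ℝ → ℝ} {C : ℝ} (h : RegularBound b C)
    (hb : SubexponentialGrowth b) {ζ₁ ζ₂ : ℂ} (h₁ : |ζ₁.im| < Real.pi / 2) (h₂ : |ζ₂.im| < Real.pi / 2) :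
    ‖laplace b (Complex.exp ζ₂)‖ ≤ ‖laplace b (Complex.exp ζ₁)‖ * Real.exp (C * ‖ζ₂ - ζ₁‖) := by
  -- In the variable ζ = log z the half-plane becomes the convex strip |Im ζ| < π/2, and regularity
  -- says that the logarithmic derivative of b̂ is at most C in modulus. Gronwall along the segment
  -- needs no nonvanishing of b̂.
  set γ : ℝ → ℂ := fun s => ζ₁ + s * (ζ₂ - ζ₁) with hγ
  have hre : ∀ s ∈ Icc (0 : ℝ) 1, 0 < (Complex.exp (γ s)).re := by
    intro s hs
    rw [Complex.exp_re]
    refine mul_pos (Real.exp_pos _) (Real.cos_pos_of_mem_Ioo ?_)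
    rw [abs_lt] at h₁ h₂
    have e : (γ s).im = (1 - s) * ζ₁.im + s * ζ₂.im := by
      simp [hγ]
      ring
    rw [e]
    exact (convex_Ioo (-(Real.pi / 2)) (Real.pi / 2)) h₁ h₂ (sub_nonneg.2 hs.2) hs.1 (by ring)
  have hd : ∀ s ∈ Icc (0 : ℝ) 1, HasDerivAt (fun s => laplace b (Complex.exp (γ s)))
      (deriv (laplace b) (Complex.exp (γ s)) * (Complex.exp (γ s) * (ζ₂ - ζ₁))) s := by
    intro s hs
    have h1 : HasDerivAt γ (ζ₂ - ζ₁) s := by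
      have := ((HasDerivAt.ofReal_comp (hasDerivAt_id' s)).mul_const (ζ₂ - ζ₁)).const_add ζ₁
      exact this.congr_deriv (by simp)
    exact (hb.hasDerivAt_laplace (hre s hs)).comp s h1.cexp
  have key := norm_le_gronwallBound_of_norm_deriv_right_le (K := C * ‖ζ₂ - ζ₁‖) (ε := 0)
    (δ := ‖laplace b (Complex.exp ζ₁)‖)
    (fun s hs => (hd s hs).continuousAt.continuousWithinAt)
    (fun s hs => (hd s (Ico_subset_Icc_self hs)).hasDerivWithinAt) (by simp [hγ]) (fun s hs => ?_)
    1 (right_mem_Icc.2 zero_le_one)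
  · rw [gronwallBound_ε0, sub_zero, mul_one] at key
    simpa [hγ] using key
  · rw [norm_mul, norm_mul, add_zero]
    have := h.one _ (hre s (Ico_subset_Icc_self hs))
    nlinarith [norm_nonneg (ζ₂ - ζ₁)]

/-- A Harnack inequality: points with moduli within a factor 2 have logarithms at distance at most
log 2 + π ≤ 1 + π, whatever their arguments. -/
theorem RegularBound.norm_laplace_le {b : ℝ → ℝ} {C : ℝ} (h : RegularBound b C)
    (hb : SubexponentialGrowth b) {z₁ z₂ : ℂ} (h₁ : 0 < z₁.re) (h₂ : 0 < z₂.re)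
    (h12 : ‖z₁‖ ≤ 2 * ‖z₂‖) (h21 : ‖z₂‖ ≤ 2 * ‖z₁‖) :
    ‖laplace b z₂‖ ≤ Real.exp (C * (1 + Real.pi)) * ‖laplace b z₁‖ := by
  have hz : ∀ z : ℂ, 0 < z.re → z ≠ 0 := by
    rintro z hz rfl
    simp at hz
  have n₁ := norm_pos_iff.2 (hz z₁ h₁)
  have n₂ := norm_pos_iff.2 (hz z₂ h₂)
  have a₁ : |(Complex.log z₁).im| < Real.pi / 2 := by
    rw [Complex.log_im, Complex.abs_arg_lt_pi_div_two_iff]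
    exact Or.inl h₁
  have a₂ : |(Complex.log z₂).im| < Real.pi / 2 := by
    rw [Complex.log_im, Complex.abs_arg_lt_pi_div_two_iff]
    exact Or.inl h₂
  have key := h.norm_laplace_exp_le hb a₁ a₂
  rw [Complex.exp_log (hz z₁ h₁), Complex.exp_log (hz z₂ h₂)] at key
  refine key.trans ?_
  rw [mul_comm]
  gcongr
  · exact h.nonneg
  have hlog2 : Real.log 2 ≤ 1 := by
    have := Real.log_two_lt_d9
    linarith
  have r1 : |(Complex.log z₂ - Complex.log z₁).re| ≤ 1 := by
    rw [Complex.sub_re, Complex.log_re, Complex.log_re, abs_le]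
    have l1 : Real.log ‖z₁‖ ≤ Real.log 2 + Real.log ‖z₂‖ := by
      rw [← Real.log_mul two_ne_zero n₂.ne']
      exact Real.log_le_log n₁ h12
    have l2 : Real.log ‖z₂‖ ≤ Real.log 2 + Real.log ‖z₁‖ := by
      rw [← Real.log_mul two_ne_zero n₁.ne']
      exact Real.log_le_log n₂ h21
    constructor <;> linarith
  have r2 : |(Complex.log z₂ - Complex.log z₁).im| ≤ Real.pi := by
    rw [Complex.sub_im]
    refine (abs_sub _ _).trans ?_
    linarith
  exact (Complex.norm_le_abs_re_add_abs_im _).trans (add_le_add r1 r2)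

theorem norm_laplace_real_le {b : ℝ → ℝ} (hb : SubexponentialGrowth b) {x : ℝ} (hx : 1 ≤ x) :
    ‖laplace b x‖ ≤ ∫ t in Ioi (0 : ℝ), ‖Real.exp (-(1 * t)) * b t‖ := by
  rw [laplace]
  refine (norm_integral_le_integral_norm _).trans ?_
  refine setIntegral_mono_on ?_ (hb 1 one_pos).norm measurableSet_Ioi fun t ht => ?_
  · exact (hb.toC.integrableOn (z := x) (by simp; linarith)).norm
  · have ht' : (0 : ℝ) < t := ht
    rw [norm_mul, norm_mul, Complex.norm_real, Complex.norm_exp,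
      Real.norm_of_nonneg (Real.exp_pos _).le]
    gcongr
    simp
    nlinarith

/-- Comparison with the real point |z|, where for |z| ≥ 1 the transform is at most the integral of
e^{-t}|b(t)|. -/
theorem RegularBound.exists_norm_laplace_le {b : ℝ → ℝ} {C : ℝ} (h : RegularBound b C)
    (hb : SubexponentialGrowth b) :
    ∃ N : ℝ, 0 ≤ N ∧ ∀ z : ℂ, 0 < z.re → 1 ≤ ‖z‖ → ‖laplace b z‖ ≤ N := by
  refine ⟨Real.exp (C * (1 + Real.pi)) * ∫ t in Ioi (0 : ℝ), ‖Real.exp (-(1 * t)) * b t‖, ?_,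
    fun z hz hz1 => ?_⟩
  · exact mul_nonneg (Real.exp_pos _).le (integral_nonneg fun _ => norm_nonneg _)
  · refine (h.norm_laplace_le hb (z₁ := (‖z‖ : ℝ)) ?_ hz ?_ ?_).trans ?_
    · rw [Complex.ofReal_re]
      linarith
    · simp
      linarith [norm_nonneg z]
    · simp
      linarith [norm_nonneg z]
    · gcongr
      exact norm_laplace_real_le hb hz1

/-- Lower bound for `z + μ x` when `x` lies in a sector of angle less than `π/2`. -/
theorem le_norm_add_mul {κ : ℝ} (hκ : 0 < κ) (hκ1 : κ ≤ 1) {z x : ℂ} (hz : 0 ≤ z.re)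
    (hx : κ * ‖x‖ ≤ x.re) {μ : ℝ} (hμ : 0 < μ) :
    κ / 3 * (‖z‖ + μ * ‖x‖) ≤ ‖z + μ * x‖ := by
  have h1 : μ * (κ * ‖x‖) ≤ ‖z + μ * x‖ := by
    refine le_trans ?_ (Complex.re_le_norm _)
    simp
    nlinarith
  have h2 : ‖z‖ ≤ ‖z + μ * x‖ + μ * ‖x‖ := by
    have h3 : ‖(μ : ℂ) * x‖ = μ * ‖x‖ := by
      rw [norm_mul, Complex.norm_real, Real.norm_of_nonneg hμ.le]
    have h4 := norm_sub_le (z + μ * x) (μ * x)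
    rwa [add_sub_cancel_right, h3] at h4
  nlinarith [norm_nonneg (z + μ * x), norm_nonneg x, mul_nonneg hμ.le (norm_nonneg x)]

/-- The constant is cos θ, positive because θ < π/2. This form of sectoriality passes to limits on
the axis, unlike the argument itself. -/
theorem IsSectorial.exists_re_ge {b : ℝ → ℝ} (h : IsSectorial b) :
    ∃ κ : ℝ, 0 < κ ∧ κ ≤ 1 ∧ ∀ z : ℂ, 0 < z.re → κ * ‖laplace b z‖ ≤ (laplace b z).re := by
  obtain ⟨θ, hθ, h⟩ := h
  have hθ0 : 0 ≤ θ := (abs_nonneg _).trans (h 1 (by simp))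
  refine ⟨Real.cos θ, Real.cos_pos_of_mem_Ioo ⟨by linarith [Real.pi_pos], hθ⟩, Real.cos_le_one _,
    fun z hz => ?_⟩
  have h1 : Real.cos θ ≤ Real.cos (laplace b z).arg := by
    rw [← Real.cos_abs (laplace b z).arg]
    exact Real.cos_le_cos_of_nonneg_of_le_pi (abs_nonneg _) (by linarith [Real.pi_pos]) (h z hz)
  have h2 := Complex.norm_mul_cos_arg (laplace b z)
  rw [← h2, mul_comm]
  gcongr

/-- Derivatives converge along with the functions if the second derivatives are bounded. -/
theorem tendsto_deriv_of_tendsto {ι : Type*} {l : Filter ι} {f f' f'' : ι → ℝ → ℂ} {g : ℝ → ℂ}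
    {k r M : ℝ} (hr : 0 < r)
    (hd : ∀ᶠ i in l, ∀ x ∈ Ioo (k - r) (k + r), HasDerivAt (f i) (f' i x) x ∧
      HasDerivAt (f' i) (f'' i x) x ∧ ‖f'' i x‖ ≤ M)
    (hlim : ∀ x ∈ Ioo (k - r) (k + r), Tendsto (fun i => f i x) l (𝓝 (g x))) {g' : ℂ}
    (hg : HasDerivAt g g' k) : Tendsto (fun i => f' i k) l (𝓝 g') := by
  rw [Metric.tendsto_nhds]
  intro η hη
  have hslope := hasDerivAt_iff_tendsto_slope.1 hg
  have h1 : ∀ᶠ x in 𝓝[≠] k, dist (slope g k x) g' < η / 3 :=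
    hslope.eventually (Metric.ball_mem_nhds _ (by positivity))
  have h2 : ∀ᶠ x in 𝓝[≠] k, x ∈ Ioo (k - r) (k + r) :=
    nhdsWithin_le_nhds (Ioo_mem_nhds (by linarith) (by linarith))
  have h3 : ∀ᶠ x in 𝓝[≠] k, |M| * |x - k| < η / 3 := by
    have : Tendsto (fun x => |M| * |x - k|) (𝓝[≠] k) (𝓝 (|M| * |k - k|)) := by
      have hc : Continuous fun x => |M| * |x - k| := by fun_prop
      exact (hc.tendsto k).mono_left nhdsWithin_le_nhds
    refine this.eventually (gt_mem_nhds ?_)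
    simp
    positivity
  -- One auxiliary point x is fixed before the index moves. The second-derivative bound makes the
  -- slope of f i close to its derivative uniformly in i, and pointwise convergence at k and x
  -- compares that slope with the slope of g.
  obtain ⟨x, ⟨⟨⟨hx1, hx2⟩, hx3⟩, hxk⟩⟩ := (((h1.and h2).and h3).and self_mem_nhdsWithin).exists
  have hxk' : x - k ≠ 0 := sub_ne_zero.2 hxk
  have hkm : k ∈ Ioo (k - r) (k + r) := ⟨by linarith, by linarith⟩
  have h4 : Tendsto (fun i => slope (f i) k x) l (𝓝 (slope g k x)) := by
    simp only [slope_def_module]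
    exact ((hlim x hx2).sub (hlim k hkm)).const_smul _
  have h5 : ∀ᶠ i in l, dist (slope (f i) k x) (slope g k x) < η / 3 :=
    h4.eventually (Metric.ball_mem_nhds _ (by positivity))
  filter_upwards [hd, h5] with i hi h5i
  have hsub : uIcc k x ⊆ Ioo (k - r) (k + r) := ordConnected_Ioo.uIcc_subset hkm hx2
  have hlip : ∀ y ∈ uIcc k x, ‖f' i y - f' i k‖ ≤ |M| * |x - k| := by
    intro y hy
    have := (convex_uIcc k x).norm_image_sub_le_of_norm_hasDerivWithin_le (f := f' i) (f' := f'' i)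
      (C := |M|) (fun z hz => (hi z (hsub hz)).2.1.hasDerivWithinAt)
      (fun z hz => (hi z (hsub hz)).2.2.trans (le_abs_self M)) left_mem_uIcc hy
    refine this.trans ?_
    gcongr
    rw [Real.norm_eq_abs]
    exact abs_sub_left_of_mem_uIcc hy
  have hmv := (convex_uIcc k x).norm_image_sub_le_of_norm_hasDerivWithin_le
    (f := fun y => f i y - (y : ℂ) * f' i k) (f' := fun y => f' i y - 1 * f' i k)
    (C := |M| * |x - k|) (fun z hz => ?_) (fun z hz => by rw [one_mul]; exact hlip z hz)
    left_mem_uIcc right_mem_uIcc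
  · have h6 : slope (f i) k x - f' i k =
        ((x - k : ℝ) : ℂ)⁻¹ * ((f i x - (x : ℂ) * f' i k) - (f i k - (k : ℂ) * f' i k)) := by
      rw [slope_def_module, Complex.real_smul]
      have : ((x - k : ℝ) : ℂ) ≠ 0 := by exact_mod_cast hxk'
      push_cast at this ⊢
      field_simp
      ring
    have h7 : dist (slope (f i) k x) (f' i k) < η / 3 := by
      rw [dist_eq_norm, h6, norm_mul, norm_inv, Complex.norm_real, Real.norm_eq_abs]
      rw [Real.norm_eq_abs] at hmv
      have hpos : 0 < |x - k| := abs_pos.2 hxk'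
      refine lt_of_le_of_lt ?_ hx3
      rw [inv_mul_le_iff₀ hpos]
      exact hmv.trans_eq (mul_comm _ _)
    calc dist (f' i k) g' ≤ dist (f' i k) (slope (f i) k x) + dist (slope (f i) k x) (slope g k x) +
          dist (slope g k x) g' := dist_triangle4 _ _ _ _
      _ < η := by
          rw [dist_comm (f' i k)]
          linarith
  · refine HasDerivWithinAt.sub (hi z (hsub hz)).1.hasDerivWithinAt ?_
    exact ((HasDerivAt.ofReal_comp (hasDerivAt_id' z)).mul_const _).hasDerivWithinAt

/-- The quantitative consequences of the assumptions on the kernel. -/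
structure KernelBounds (b : ℝ → ℝ) (c Λ : ℝ) : Prop where
  growth : SubexponentialGrowth b
  c_pos : 0 < c
  one_le : 1 ≤ Λ
  lower : ∀ z : ℂ, 0 < z.re → ∀ μ : ℝ, 0 < μ →
    c * (‖z‖ + μ * ‖laplace b z‖) ≤ ‖z + μ * laplace b z‖
  regular_one : ∀ z : ℂ, 0 < z.re → ‖z‖ * ‖deriv (laplace b) z‖ ≤ Λ * ‖laplace b z‖
  regular_two : ∀ z : ℂ, 0 < z.re → ‖z‖ ^ 2 * ‖deriv (deriv (laplace b)) z‖ ≤ Λ * ‖laplace b z‖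
  re_nonneg : ∀ z : ℂ, 0 < z.re → 0 ≤ (laplace b z).re
  boundary_lower : ∀ k : ℝ, 0 < k → ∀ μ : ℝ, 0 < μ →
    c * (k + μ * ‖boundary b k‖) ≤ ‖k * Complex.I + μ * boundary b k‖
  boundary_one : ∀ k : ℝ, 0 < k → k * ‖deriv (boundary b) k‖ ≤ Λ * ‖boundary b k‖
  boundary_two : ∀ k : ℝ, 0 < k → k ^ 2 * ‖deriv (deriv (boundary b)) k‖ ≤ Λ * ‖boundary b k‖
  tendsto_zero : ∀ k : ℝ, 0 < k →
    Tendsto (fun ε : ℝ => laplace b (ε + k * Complex.I)) (𝓝[>] 0) (𝓝 (boundary b k))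
  tendsto_one : ∀ k : ℝ, 0 < k →
    Tendsto (fun ε : ℝ => deriv (laplace b) (ε + k * Complex.I)) (𝓝[>] 0)
      (𝓝 (-Complex.I * deriv (boundary b) k))
  bounded : ∃ N : ℝ, 0 ≤ N ∧ ∀ z : ℂ, 0 < z.re → 1 ≤ ‖z‖ → ‖laplace b z‖ ≤ N
  sqrt_bound : ∀ μ : ℝ, 0 < μ → ∃ M : ℝ, 0 ≤ M ∧ ∀ z : ℂ, 0 < z.re →
    1 / (‖z‖ + μ * ‖laplace b z‖) ≤ M * ‖z‖ ^ (-(1 / 2) : ℝ)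

theorem tendsto_norm_add_mul_I {k : ℝ} (hk : 0 < k) :
    Tendsto (fun ε : ℝ => ‖(ε : ℂ) + k * Complex.I‖) (𝓝[>] 0) (𝓝 k) := by
  have hc : Continuous fun ε : ℝ => ‖(ε : ℂ) + k * Complex.I‖ := by fun_prop
  have := (hc.tendsto 0).mono_left (nhdsWithin_le_nhds (s := Ioi (0 : ℝ)))
  simpa [abs_of_pos hk] using this

/-- The Harnack inequality with one point sent to the axis. The inequalities between moduli are
strict so that they persist for ε + ik with ε small. -/
theorem RegularBound.norm_boundary {b : ℝ → ℝ} {C : ℝ} (h : RegularBound b C)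
    (hb : SubexponentialGrowth b) {k : ℝ} (hk : 0 < k) {g : ℂ}
    (hg : Tendsto (fun ε : ℝ => laplace b (ε + k * Complex.I)) (𝓝[>] 0) (𝓝 g)) {z : ℂ}
    (hz : 0 < z.re) (h1 : ‖z‖ < 2 * k) (h2 : k < 2 * ‖z‖) :
    ‖laplace b z‖ ≤ Real.exp (C * (1 + Real.pi)) * ‖g‖ ∧
      ‖g‖ ≤ Real.exp (C * (1 + Real.pi)) * ‖laplace b z‖ := by
  have hn := tendsto_norm_add_mul_I hk
  have e1 : ∀ᶠ ε : ℝ in 𝓝[>] 0, ‖z‖ < 2 * ‖(ε : ℂ) + k * Complex.I‖ :=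
    (hn.const_mul 2).eventually (lt_mem_nhds h1)
  have e2 : ∀ᶠ ε : ℝ in 𝓝[>] 0, ‖(ε : ℂ) + k * Complex.I‖ < 2 * ‖z‖ :=
    hn.eventually (gt_mem_nhds h2)
  constructor
  · refine ge_of_tendsto (hg.norm.const_mul _) ?_
    filter_upwards [e1, e2, self_mem_nhdsWithin] with ε a1 a2 hε
    exact h.norm_laplace_le hb (by simpa using hε) hz a2.le a1.le
  · refine le_of_tendsto hg.norm ?_
    filter_upwards [e1, e2, self_mem_nhdsWithin] with ε a1 a2 hε
    exact h.norm_laplace_le hb hz (by simpa using hε) a1.le a2.le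

theorem KernelAssumption.differentiableAt_boundary {b : ℝ → ℝ} {ρ : ℝ} (hb : KernelAssumption b ρ)
    {k : ℝ} (hk : 0 < k) : HasDerivAt (boundary b) (deriv (boundary b) k) k :=
  ((hb.contDiffOn_boundary.differentiableOn (by norm_num)).differentiableAt
    (Ioi_mem_nhds hk)).hasDerivAt

theorem KernelAssumption.contDiffOn_deriv_boundary {b : ℝ → ℝ} {ρ : ℝ} (hb : KernelAssumption b ρ) :
    ContDiffOn ℝ 1 (deriv (boundary b)) (Ioi 0) :=
  hb.contDiffOn_boundary.deriv_of_isOpen isOpen_Ioi (by norm_num)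

theorem KernelAssumption.differentiableAt_deriv_boundary {b : ℝ → ℝ} {ρ : ℝ}
    (hb : KernelAssumption b ρ) {k : ℝ} (hk : 0 < k) :
    HasDerivAt (deriv (boundary b)) (deriv (deriv (boundary b)) k) k :=
  ((hb.contDiffOn_deriv_boundary.differentiableOn (by norm_num)).differentiableAt
    (Ioi_mem_nhds hk)).hasDerivAt

/-- A bound on second derivatives along vertical lines that is uniform in ε and local in k,
expressed through g(k); it is what lets first derivatives converge to g'. -/
theorem RegularBound.boundary_hypotheses {b : ℝ → ℝ} {C ρ : ℝ} (h : RegularBound b C)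
    (hb : KernelAssumption b ρ) {k : ℝ} (hk : 0 < k) :
    ∀ᶠ ε : ℝ in 𝓝[>] 0, ∀ x ∈ Ioo (k - k / 4) (k + k / 4),
      HasDerivAt (fun x : ℝ => laplace b (ε + x * Complex.I))
        (deriv (laplace b) (ε + x * Complex.I) * Complex.I) x ∧
      HasDerivAt (fun x : ℝ => deriv (laplace b) (ε + x * Complex.I) * Complex.I)
        (deriv (deriv (laplace b)) (ε + x * Complex.I) * Complex.I * Complex.I) x ∧
      ‖deriv (deriv (laplace b)) (ε + x * Complex.I) * Complex.I * Complex.I‖ ≤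
        2 * C * Real.exp (C * (1 + Real.pi)) * ‖boundary b k‖ / k ^ 2 := by
  filter_upwards [Ioo_mem_nhdsGT (show (0 : ℝ) < k / 4 by positivity)] with ε hε x hx
  have hre : 0 < ((ε : ℂ) + x * Complex.I).re := by simpa using hε.1
  have hγ : HasDerivAt (fun x : ℝ => (ε : ℂ) + x * Complex.I) Complex.I x := by
    have := ((HasDerivAt.ofReal_comp (hasDerivAt_id' x)).mul_const Complex.I).const_add (ε : ℂ)
    exact this.congr_deriv (by simp)
  have d1 : HasDerivAt (fun x : ℝ => laplace b (ε + x * Complex.I))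
      (deriv (laplace b) (ε + x * Complex.I) * Complex.I) x :=
    HasDerivAt.comp (h₂ := laplace b) x (hb.subexponential.hasDerivAt_laplace hre) hγ
  have d2 : HasDerivAt (fun x : ℝ => deriv (laplace b) (ε + x * Complex.I))
      (deriv (deriv (laplace b)) (ε + x * Complex.I) * Complex.I) x :=
    HasDerivAt.comp (h₂ := deriv (laplace b)) x
      (hb.subexponential.hasDerivAt_deriv_laplace hre) hγ
  refine ⟨d1, d2.mul_const _, ?_⟩
  have n1 : 3 * k / 4 ≤ ‖(ε : ℂ) + x * Complex.I‖ := by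
    have := Complex.abs_im_le_norm ((ε : ℂ) + x * Complex.I)
    simp at this
    have h2 := le_abs_self x
    linarith [hx.1]
  have n2 : ‖(ε : ℂ) + x * Complex.I‖ < 2 * k := by
    refine (norm_add_le _ _).trans_lt ?_
    rw [norm_mul, Complex.norm_I, mul_one, Complex.norm_real, Complex.norm_real, Real.norm_eq_abs,
      Real.norm_eq_abs, abs_of_pos hε.1, abs_of_pos (by linarith [hx.1])]
    linarith [hx.2, hε.2]
  have n3 := (h.norm_boundary hb.subexponential hk (hb.tendsto_boundary k hk.ne') hre n2
    (by linarith)).1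
  have n4 := h.two _ hre
  rw [norm_mul, norm_mul, Complex.norm_I, mul_one, mul_one, le_div_iff₀ (by positivity)]
  set A := ‖deriv (deriv (laplace b)) (ε + x * Complex.I)‖
  -- The factor 2 in the bound absorbs (4/3)² = 16/9.
  have n5 : (3 * k / 4) ^ 2 ≤ ‖(ε : ℂ) + x * Complex.I‖ ^ 2 := by gcongr
  have n6 : (3 * k / 4) ^ 2 * A ≤ C * (Real.exp (C * (1 + Real.pi)) * ‖boundary b k‖) := by
    refine (mul_le_mul_of_nonneg_right n5 (norm_nonneg _)).trans (n4.trans ?_)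
    exact mul_le_mul_of_nonneg_left n3 h.nonneg
  have : 0 ≤ k ^ 2 * A := by positivity
  nlinarith

theorem RegularBound.tendsto_deriv_boundary {b : ℝ → ℝ} {C ρ : ℝ} (h : RegularBound b C)
    (hb : KernelAssumption b ρ) {k : ℝ} (hk : 0 < k) :
    Tendsto (fun ε : ℝ => deriv (laplace b) (ε + k * Complex.I) * Complex.I) (𝓝[>] 0)
      (𝓝 (deriv (boundary b) k)) :=
  tendsto_deriv_of_tendsto (f := fun (ε : ℝ) (x : ℝ) => laplace b (ε + x * Complex.I))
    (f' := fun (ε : ℝ) (x : ℝ) => deriv (laplace b) (ε + x * Complex.I) * Complex.I)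
    (show 0 < k / 4 by positivity) (h.boundary_hypotheses hb hk)
    (fun x hx => hb.tendsto_boundary x (by
      have : 0 < x := by linarith [hx.1]
      exact this.ne'))
    (hb.differentiableAt_boundary hk)

theorem RegularBound.norm_deriv_boundary_le {b : ℝ → ℝ} {C ρ : ℝ} (h : RegularBound b C)
    (hb : KernelAssumption b ρ) {k : ℝ} (hk : 0 < k) :
    k * ‖deriv (boundary b) k‖ ≤ C * ‖boundary b k‖ := by
  refine le_of_tendsto_of_tendsto ((tendsto_norm_add_mul_I hk).mul
    (h.tendsto_deriv_boundary hb hk).norm) ((hb.tendsto_boundary k hk.ne').norm.const_mul C) ?_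
  filter_upwards [self_mem_nhdsWithin] with ε hε
  rw [norm_mul, Complex.norm_I, mul_one]
  exact h.one _ (by simpa using hε)

/-- Convergence of second derivatives to g'' would require control of b̂'''. A Lipschitz bound for
the first derivatives is enough instead: it survives the limit ε → 0 and bounds the derivative of
g'. -/
theorem RegularBound.norm_deriv_deriv_boundary_le {b : ℝ → ℝ} {C ρ : ℝ} (h : RegularBound b C)
    (hb : KernelAssumption b ρ) {k : ℝ} (hk : 0 < k) :
    k ^ 2 * ‖deriv (deriv (boundary b)) k‖ ≤
      2 * C * Real.exp (C * (1 + Real.pi)) * ‖boundary b k‖ := by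
  set M := 2 * C * Real.exp (C * (1 + Real.pi)) * ‖boundary b k‖ / k ^ 2 with hM
  have hM0 : 0 ≤ M := by
    have := h.nonneg
    positivity
  have hkm : k ∈ Ioo (k - k / 4) (k + k / 4) := ⟨by linarith, by linarith⟩
  have key : ∀ᶠ x in 𝓝 k, ‖deriv (boundary b) x - deriv (boundary b) k‖ ≤ M * ‖x - k‖ := by
    filter_upwards [Ioo_mem_nhds hkm.1 hkm.2] with x hx
    have hx0 : 0 < x := by linarith [hx.1]
    refine le_of_tendsto ((h.tendsto_deriv_boundary hb hx0).sub
      (h.tendsto_deriv_boundary hb hk)).norm ?_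
    filter_upwards [h.boundary_hypotheses hb hk] with ε hε
    exact (convex_Ioo (k - k / 4) (k + k / 4)).norm_image_sub_le_of_norm_hasDerivWithin_le
      (f := fun x : ℝ => deriv (laplace b) (ε + x * Complex.I) * Complex.I)
      (fun z hz => (hε z hz).2.1.hasDerivWithinAt) (fun z hz => (hε z hz).2.2) hkm hx
  have := (hb.differentiableAt_deriv_boundary hk).le_of_lip' hM0 key
  rw [hM, le_div_iff₀ (by positivity)] at this
  linarith

theorem RegularBound.exists_sqrt_bound {b : ℝ → ℝ} {C ρ : ℝ} (h : RegularBound b C)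
    (hb : KernelAssumption b ρ) {μ : ℝ} (hμ : 0 < μ) : ∃ M : ℝ, 0 ≤ M ∧ ∀ z : ℂ, 0 < z.re →
      1 / (‖z‖ + μ * ‖laplace b z‖) ≤ M * ‖z‖ ^ (-(1 / 2) : ℝ) := by
  obtain ⟨C₁, hC₁, hg⟩ := hb.growth
  have hg2 := (hg μ hμ).2
  set K := Real.exp (C * (1 + Real.pi)) with hK
  have hK1 : 1 ≤ K := Real.one_le_exp (mul_nonneg h.nonneg (by linarith [Real.pi_pos]))
  set C₂ := C₁ / μ ^ (1 + 1 / ρ) with hC₂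
  have hC₂0 : 0 ≤ C₂ := by positivity
  refine ⟨√(8 * K ^ 2 * μ * C₂), Real.sqrt_nonneg _, fun z hz => ?_⟩
  have hr : 0 < ‖z‖ := norm_pos_iff.2 (by rintro rfl; simp at hz)
  set r := ‖z‖ with hr_def
  set S := r + μ * ‖laplace b z‖ with hS
  have hS0 : 0 < S := by positivity
  -- Only the summand 1/μ of the second integrand is used. On (r, 3r/2] the denominator is at most
  -- (2KS)² by the Harnack inequality, and the interval has length r/2; finiteness of the integral
  -- therefore bounds r/S², which is the claim squared.
  have hpt : ∀ k ∈ Ioc r (3 / 2 * r), ENNReal.ofReal (1 / μ / (2 * K * S) ^ 2) ≤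
      ENNReal.ofReal
        ((‖(k : ℂ) ^ 2 * iteratedDeriv 3 (boundary b) k‖
            + ‖(k : ℂ) * iteratedDeriv 2 (boundary b) k‖
            + ‖deriv (boundary b) k‖ + 1 / μ) / (|k| + μ * ‖boundary b k‖) ^ 2) := by
    intro k hk
    have hk0 : 0 < k := hr.trans hk.1
    have n1 := (h.norm_boundary hb.subexponential hk0 (hb.tendsto_boundary k hk0.ne') hz
      (by linarith [hk.1]) (by linarith [hk.2])).2
    refine ENNReal.ofReal_le_ofReal ?_
    rw [abs_of_pos hk0]
    gcongr
    · exact le_add_of_nonneg_left (by positivity)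
    · have : μ * ‖boundary b k‖ ≤ μ * (K * ‖laplace b z‖) := by gcongr
      have h2 : r ≤ K * r := by nlinarith
      have h3 : 0 ≤ μ * (K * ‖laplace b z‖) := by positivity
      rw [hS]
      linarith [hk.2]
  have hle : ENNReal.ofReal (1 / μ / (2 * K * S) ^ 2 * (r / 2)) ≤ ENNReal.ofReal C₂ := by
    calc ENNReal.ofReal (1 / μ / (2 * K * S) ^ 2 * (r / 2))
        = ∫⁻ _ in Ioc r (3 / 2 * r), ENNReal.ofReal (1 / μ / (2 * K * S) ^ 2) := by
          rw [setLIntegral_const, Real.volume_Ioc, ← ENNReal.ofReal_mul (by positivity)]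
          congr 2
          ring
      _ ≤ _ := setLIntegral_mono' measurableSet_Ioc hpt
      _ ≤ _ := lintegral_mono_set fun k hk => hr.trans hk.1
      _ ≤ ENNReal.ofReal C₂ := hg2
  rw [ENNReal.ofReal_le_ofReal_iff hC₂0] at hle
  have hle2 : r ≤ 8 * K ^ 2 * μ * C₂ * S ^ 2 := by
    have e : 1 / μ / (2 * K * S) ^ 2 * (r / 2) = r / (8 * K ^ 2 * μ * S ^ 2) := by
      field_simp
      ring
    rw [e, div_le_iff₀ (by positivity)] at hle
    linarith
  have hle3 : √r ≤ √(8 * K ^ 2 * μ * C₂) * S := by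
    calc √r ≤ √(8 * K ^ 2 * μ * C₂ * S ^ 2) := Real.sqrt_le_sqrt hle2
      _ = _ := by rw [Real.sqrt_mul (by positivity), Real.sqrt_sq hS0.le]
  rw [Real.rpow_neg hr.le, ← Real.sqrt_eq_rpow, ← div_eq_mul_inv,
    div_le_div_iff₀ hS0 (Real.sqrt_pos.2 hr), one_mul]
  exact hle3

theorem KernelAssumption.exists_kernelBounds {b : ℝ → ℝ} {ρ : ℝ} (hb : KernelAssumption b ρ) :
    ∃ c Λ : ℝ, KernelBounds b c Λ := by
  obtain ⟨C, hC⟩ := hb.regular.exists_regularBound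
  obtain ⟨κ, hκ, hκ1, hsec⟩ := hb.sectorial.exists_re_ge
  have hE : 1 ≤ Real.exp (C * (1 + Real.pi)) :=
    Real.one_le_exp (mul_nonneg hC.nonneg (by linarith [Real.pi_pos]))
  -- One constant for the interior, the axis, and the normalisation Λ ≥ 1; the exponential comes
  -- from the bound for g''.
  set Λ := 1 + 2 * C * Real.exp (C * (1 + Real.pi)) with hΛ
  have hC0 := hC.nonneg
  have hCΛ : C ≤ Λ := by nlinarith
  have hbd : ∀ k : ℝ, 0 < k → κ * ‖boundary b k‖ ≤ (boundary b k).re := by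
    intro k hk
    have ht := hb.tendsto_boundary k hk.ne'
    refine le_of_tendsto_of_tendsto (ht.norm.const_mul κ)
      ((Complex.continuous_re.tendsto _).comp ht) ?_
    filter_upwards [self_mem_nhdsWithin] with ε hε
    exact hsec _ (by simpa using hε)
  refine ⟨κ / 3, Λ, hb.subexponential, by positivity, by nlinarith, ?_, ?_, ?_, ?_, ?_, ?_, ?_, ?_,
    ?_, ?_, ?_⟩
  · exact fun z hz μ hμ => le_norm_add_mul hκ hκ1 hz.le (hsec z hz) hμ
  · exact fun z hz => (hC.one z hz).trans (by gcongr)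
  · exact fun z hz => (hC.two z hz).trans (by gcongr)
  · exact fun z hz => (mul_nonneg hκ.le (norm_nonneg _)).trans (hsec z hz)
  · intro k hk μ hμ
    have := le_norm_add_mul hκ hκ1 (z := k * Complex.I) (by simp) (hbd k hk) hμ
    simpa [abs_of_pos hk] using this
  · exact fun k hk => (hC.norm_deriv_boundary_le hb hk).trans (by gcongr)
  · exact fun k hk => (hC.norm_deriv_deriv_boundary_le hb hk).trans (by gcongr; linarith)
  · exact fun k hk => hb.tendsto_boundary k hk.ne'
  · intro k hk
    have := (hC.tendsto_deriv_boundary hb hk).const_mul (-Complex.I)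
    refine this.congr fun ε => ?_
    linear_combination -deriv (laplace b) (ε + k * Complex.I) * Complex.I_mul_I
  · exact hC.exists_norm_laplace_le hb.subexponential
  · exact fun μ hμ => hC.exists_sqrt_bound hb hμ

end Volterra

/-! ### Kernels of positive type. -/

namespace Volterra

open FourierTransform Convolution

/-- The convolution of an integrable function with a bounded almost everywhere continuous function
is continuous. -/
theorem continuous_convolution_of_ae_continuousAt {f β : ℝ → ℂ} (hβ : Integrable β)
    (hf : AEStronglyMeasurable f) {M : ℝ} (hM : ∀ x, ‖f x‖ ≤ M)
    (hc : ∀ᵐ x, ContinuousAt f x) :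
    Continuous (f ⋆[ContinuousLinearMap.mul ℂ ℂ] β) := by
  have e : f ⋆[ContinuousLinearMap.mul ℂ ℂ] β = fun x => ∫ t, f (x - t) * β t := by
    ext x
    rw [convolution_eq_swap]
    rfl
  rw [e, continuous_iff_continuousAt]
  intro x
  refine continuousAt_of_dominated (bound := fun t => M * ‖β t‖) (.of_forall fun y => ?_)
    (.of_forall fun y => .of_forall fun t => ?_) (hβ.norm.const_mul M) ?_
  · exact (hf.comp_quasiMeasurePreserving
      (quasiMeasurePreserving_sub_left_of_right_invariant volume y)).mul hβ.1
  · rw [norm_mul]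
    gcongr
    exact hM _
  · have : ∀ᵐ t, ContinuousAt f (x - t) :=
      (quasiMeasurePreserving_sub_left_of_right_invariant volume x).ae hc
    filter_upwards [this] with t ht
    have h2 : ContinuousAt (fun y => f (y - t)) x :=
      ContinuousAt.comp (f := fun y => y - t) ht (by fun_prop)
    exact h2.mul continuousAt_const

/-- One integration by parts, whose endpoint terms come from the jumps of the truncation at 0 and T.
The resulting decay 1/|ξ| is just enough for the square of the transform to be integrable. -/
theorem norm_fourier_indicator_le {f f' : ℝ → ℝ} {T M M' : ℝ} (hT : 0 < T)
    (hf : ContinuousOn f (Icc 0 T)) (hd : ∀ t ∈ Ioo 0 T, HasDerivAt f (f' t) t)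
    (hM : ∀ t ∈ Icc 0 T, |f t| ≤ M) (hM' : ∀ t ∈ Ioo 0 T, |f' t| ≤ M') (ξ : ℝ) :
    2 * Real.pi * |ξ| * ‖𝓕 (indicator (Ioo 0 T) fun t => (f t : ℂ)) ξ‖ ≤ 2 * M + T * M' := by
  set c : ℂ := ((-(2 * Real.pi * ξ) : ℝ) : ℂ) * Complex.I with hc
  have e1 : 𝓕 (indicator (Ioo 0 T) fun t => (f t : ℂ)) ξ = ∫ t in (0 : ℝ)..T, Complex.exp (c * t) * f t := by
    rw [Real.fourier_eq', intervalIntegral.integral_of_le hT.le, integral_Ioc_eq_integral_Ioo,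
      ← integral_indicator measurableSet_Ioo]
    congr 1 with t
    by_cases ht : t ∈ Ioo 0 T
    · rw [indicator_of_mem ht, indicator_of_mem ht, smul_eq_mul, hc]
      congr 2
      simp
      ring
    · rw [indicator_of_notMem ht, indicator_of_notMem ht, smul_zero]
  have hfi : IntervalIntegrable f' volume 0 T := by
    rw [intervalIntegrable_iff_integrableOn_Ioo_of_le hT.le]
    have h1 : IntegrableOn (deriv f) (Ioo 0 T) := by
      refine Measure.integrableOn_of_bounded (M := M') (by simp) (measurable_deriv f).aestronglyMeasurable ?_
      refine (ae_restrict_mem measurableSet_Ioo).mono fun t ht => ?_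
      rw [(hd t ht).deriv]
      exact hM' t ht
    exact h1.congr_fun (fun t ht => (hd t ht).deriv) measurableSet_Ioo
  have key := intervalIntegral.integral_mul_deriv_eq_deriv_mul_of_hasDerivAt
    (a := 0) (b := T) (u := fun t => (f t : ℂ)) (u' := fun t => (f' t : ℂ))
    (v := fun t : ℝ => Complex.exp (c * t)) (v' := fun t : ℝ => Complex.exp (c * t) * c)
    (by rw [uIcc_of_le hT.le]; exact Complex.continuous_ofReal.comp_continuousOn hf)
    (Continuous.continuousOn (by fun_prop))
    (by
      rw [min_eq_left hT.le, max_eq_right hT.le]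
      exact fun t ht => (hd t ht).ofReal_comp)
    (fun t _ => by
      have := ((HasDerivAt.ofReal_comp (hasDerivAt_id' t)).const_mul c).cexp
      simpa using this)
    ⟨hfi.1.ofReal, hfi.2.ofReal⟩ (Continuous.intervalIntegrable (by fun_prop) _ _)
  have hn : ∀ t : ℝ, ‖Complex.exp (c * t)‖ = 1 := by
    intro t
    rw [hc, show ((-(2 * Real.pi * ξ) : ℝ) : ℂ) * Complex.I * t = ((-(2 * Real.pi * ξ) * t : ℝ) : ℂ) * Complex.I by
      push_cast; ring, Complex.norm_exp_ofReal_mul_I]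
  have e2 : (∫ t in (0 : ℝ)..T, (f t : ℂ) * (Complex.exp (c * t) * c)) =
      c * ∫ t in (0 : ℝ)..T, Complex.exp (c * t) * f t := by
    rw [← intervalIntegral.integral_const_mul]
    congr 1 with t
    ring
  have hcn : ‖c‖ = 2 * Real.pi * |ξ| := by
    rw [hc, norm_mul, Complex.norm_I, mul_one, Complex.norm_real, norm_neg, norm_mul, norm_mul,
      Real.norm_eq_abs, Real.norm_eq_abs, Real.norm_eq_abs, abs_of_pos Real.pi_pos, abs_two]
  rw [e1, ← hcn, ← norm_mul, ← e2, key]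
  have h3 : ‖∫ t in (0 : ℝ)..T, (f' t : ℂ) * Complex.exp (c * t)‖ ≤ M' * |T - 0| := by
    refine intervalIntegral.norm_integral_le_of_norm_le_const_ae ?_
    have : ∀ᵐ t : ℝ, t ≠ T := by simp [ae_iff]
    filter_upwards [this] with t ht htm
    rw [uIoc_of_le hT.le] at htm
    rw [norm_mul, hn, mul_one, Complex.norm_real]
    exact hM' t ⟨htm.1, lt_of_le_of_ne htm.2 ht⟩
  rw [sub_zero, abs_of_pos hT] at h3
  refine (norm_sub_le _ _).trans ?_
  have h4 : ‖(f T : ℂ) * Complex.exp (c * T) - f 0 * Complex.exp (c * (0 : ℝ))‖ ≤ M + M := by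
    refine (norm_sub_le _ _).trans ?_
    rw [norm_mul, norm_mul, hn, hn, mul_one, mul_one, Complex.norm_real, Complex.norm_real]
    exact add_le_add (hM T ⟨hT.le, le_rfl⟩) (hM 0 ⟨le_rfl, hT.le⟩)
  linarith

/-- A kernel whose Fourier transform has nonnegative real part is of positive type. -/
theorem integral_mul_convolution_nonneg {β f f' : ℝ → ℝ} (hβ : Integrable β)
    (hβ0 : ∀ t ≤ 0, β t = 0) (hpos : ∀ ξ, 0 ≤ (𝓕 (fun t => (β t : ℂ)) ξ).re) {T M' : ℝ} (hT : 0 < T)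
    (hf : ContinuousOn f (Icc 0 T)) (hd : ∀ t ∈ Ioo 0 T, HasDerivAt f (f' t) t)
    (hM' : ∀ t ∈ Ioo 0 T, |f' t| ≤ M') :
    0 ≤ ∫ t in (0 : ℝ)..T, f t * ∫ τ in (0 : ℝ)..t, β (t - τ) * f τ := by
  obtain ⟨M, hM⟩ := isCompact_Icc.exists_bound_of_continuousOn hf
  have hM0 : 0 ≤ M := (norm_nonneg _).trans (hM 0 ⟨le_rfl, hT.le⟩)
  have hβC : Integrable fun t => (β t : ℂ) := hβ.ofReal
  set F : ℝ → ℂ := indicator (Ioo 0 T) fun t => (f t : ℂ) with hF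
  have hfc : ContinuousOn (fun t => (f t : ℂ)) (Icc 0 T) :=
    Complex.continuous_ofReal.comp_continuousOn hf
  have hFi : Integrable F :=
    (integrable_indicator_iff measurableSet_Ioo).2
      ((hfc.integrableOn_Icc).mono_set Ioo_subset_Icc_self)
  have hFM : ∀ x, ‖F x‖ ≤ M := by
    intro x
    by_cases hx : x ∈ Ioo 0 T
    · rw [hF, indicator_of_mem hx, Complex.norm_real]
      exact hM x (Ioo_subset_Icc_self hx)
    · rw [hF, indicator_of_notMem hx, norm_zero]
      exact hM0
  have hFc : ∀ᵐ x, ContinuousAt F x := by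
    have h0 : ∀ᵐ t : ℝ, t ≠ T := by simp [ae_iff]
    have h1 : ∀ᵐ t : ℝ, t ≠ 0 := by simp [ae_iff]
    filter_upwards [h0, h1] with t ht ht'
    have h2 : t ∉ frontier (Ioo 0 T) := by
      rw [frontier_Ioo hT]
      simp [ht, ht']
    by_cases hm : t ∈ Ioo 0 T
    · have : F =ᶠ[𝓝 t] fun t => (f t : ℂ) := by
        filter_upwards [isOpen_Ioo.mem_nhds hm] with y hy
        exact indicator_of_mem hy _
      refine ContinuousAt.congr ?_ this.symm
      exact hfc.continuousAt (Icc_mem_nhds hm.1 hm.2)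
    · have h3 : t ∈ interior (Ioo 0 T)ᶜ := by
        rw [interior_compl]
        intro h4
        exact h2 ⟨h4, by rwa [interior_Ioo]⟩
      have : F =ᶠ[𝓝 t] fun t => (0 : ℂ) := by
        filter_upwards [mem_interior_iff_mem_nhds.1 h3] with y hy
        exact indicator_of_notMem hy _
      exact ContinuousAt.congr continuousAt_const this.symm
  set G := F ⋆[ContinuousLinearMap.mul ℂ ℂ] (fun t => (β t : ℂ)) with hG
  have hGc : Continuous G := continuous_convolution_of_ae_continuousAt hβC hFi.1 hFM hFc
  have hGi : Integrable G := hFi.integrable_convolution _ hβC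
  have hGb : ∀ x, ‖G x‖ ≤ M * ∫ t, ‖(β t : ℂ)‖ := by
    intro x
    rw [hG, convolution_eq_swap, ← integral_const_mul]
    refine norm_integral_le_of_norm_le (hβC.norm.const_mul M) (.of_forall fun t => ?_)
    refine (norm_mul_le _ _).trans ?_
    gcongr
    exact hFM _
  -- The quadratic form is the value at 0 of F ⋆ β ⋆ F(-·), whose Fourier transform is β̂|F̂|².
  -- Since E is continuous and its transform integrable, inversion holds at the point 0 and
  -- expresses the form as an integral with nonnegative real part.
  set E := G ⋆[ContinuousLinearMap.mul ℂ ℂ] (fun t => F (-t)) with hE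
  have hEc : Continuous E := continuous_convolution_of_ae_continuousAt hFi.comp_neg hGi.1 hGb
    (.of_forall fun x => hGc.continuousAt)
  have hEi : Integrable E := hGi.integrable_convolution _ hFi.comp_neg
  have hconj : ∀ ξ, 𝓕 (fun t => F (-t)) ξ = (starRingEnd ℂ) (𝓕 F ξ) := by
    intro ξ
    rw [Real.fourier_eq', Real.fourier_eq', ← integral_conj, ← integral_neg_eq_self]
    congr 1 with t
    have h1 : (starRingEnd ℂ) (F t) = F t := by
      by_cases ht : t ∈ Ioo 0 T
      · rw [hF, indicator_of_mem ht, Complex.conj_ofReal]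
      · rw [hF, indicator_of_notMem ht, map_zero]
    rw [neg_neg, smul_eq_mul, smul_eq_mul, map_mul, h1, ← Complex.exp_conj]
    congr 2
    simp [Complex.conj_ofNat]
  have hEF : ∀ ξ, 𝓕 E ξ = 𝓕 (fun t => (β t : ℂ)) ξ * ((‖𝓕 F ξ‖ ^ 2 : ℝ) : ℂ) := by
    intro ξ
    rw [hE, Real.fourier_mul_convolution_eq hGi hFi.comp_neg, hG,
      Real.fourier_mul_convolution_eq hFi hβC, hconj]
    have := Complex.mul_conj' (𝓕 F ξ)
    push_cast
    rw [← this]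
    ring
  have hβb : ∀ ξ, ‖𝓕 (fun t => (β t : ℂ)) ξ‖ ≤ ∫ t, ‖(β t : ℂ)‖ := fun ξ =>
    VectorFourier.norm_fourierIntegral_le_integral_norm _ _ _ _ _
  have hFb : ∀ ξ, ‖𝓕 F ξ‖ ≤ ∫ t, ‖F t‖ := fun ξ =>
    VectorFourier.norm_fourierIntegral_le_integral_norm _ _ _ _ _
  -- Sum of the bounds for |F̂|² and ξ²|F̂|², so that |F̂|² ≤ K/(1 + ξ²).
  set K := (∫ t, ‖F t‖) ^ 2 + (2 * M + T * M') ^ 2 with hK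
  have hFdec : ∀ ξ, ‖𝓕 F ξ‖ ^ 2 ≤ K * (1 + ξ ^ 2)⁻¹ := by
    intro ξ
    have h1 := norm_fourier_indicator_le hT hf hd (fun t ht => hM t ht) hM' ξ
    have h2 : |ξ| * ‖𝓕 F ξ‖ ≤ 2 * M + T * M' := by
      refine le_trans ?_ h1
      have := Real.pi_gt_three
      have h3 : 0 ≤ |ξ| * ‖𝓕 F ξ‖ := by positivity
      nlinarith
    rw [← div_eq_mul_inv, le_div_iff₀ (by positivity)]
    have h3 : (|ξ| * ‖𝓕 F ξ‖) ^ 2 ≤ (2 * M + T * M') ^ 2 := by gcongr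
    have h4 : ‖𝓕 F ξ‖ ^ 2 ≤ (∫ t, ‖F t‖) ^ 2 := by
      have := hFb ξ
      gcongr
    rw [mul_pow, sq_abs] at h3
    linarith
  have hEint : Integrable (𝓕 E) := by
    refine Integrable.mono' ((integrable_inv_one_add_sq.const_mul K).const_mul (∫ t, ‖(β t : ℂ)‖)) ?_
      (.of_forall fun ξ => ?_)
    · exact (VectorFourier.fourierIntegral_continuous Real.continuous_fourierChar
        (by exact continuous_inner) hEi).aestronglyMeasurable
    · rw [hEF, norm_mul, Complex.norm_real, Real.norm_of_nonneg (sq_nonneg _)]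
      gcongr
      · exact hβb ξ
      · exact hFdec ξ
  have hinv := congrFun (hEc.fourierInv_fourier_eq hEi hEint) 0
  have hre : 0 ≤ (E 0).re := by
    rw [← hinv, fourierInv_real_eq]
    simp only [mul_zero, Complex.ofReal_zero, zero_mul, Complex.exp_zero, one_mul]
    rw [← RCLike.re_eq_complex_re, ← integral_re hEint]
    refine integral_nonneg fun ξ => ?_
    simp only [hEF, RCLike.re_eq_complex_re, Complex.re_mul_ofReal]
    exact mul_nonneg (hpos ξ) (sq_nonneg _)
  have hE0 : E 0 = ((∫ t in (0 : ℝ)..T, f t * ∫ τ in (0 : ℝ)..t, β (t - τ) * f τ : ℝ) : ℂ) := by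
    rw [hE, convolution_def, ← intervalIntegral.integral_ofReal, intervalIntegral.integral_of_le hT.le,
      integral_Ioc_eq_integral_Ioo, ← integral_indicator measurableSet_Ioo]
    congr 1 with t
    simp only [zero_sub, neg_neg, ContinuousLinearMap.mul_apply']
    by_cases ht : t ∈ Ioo 0 T
    · rw [indicator_of_mem ht, hF, indicator_of_mem ht, mul_comm]
      push_cast
      congr 1
      rw [hG, convolution_def, ← intervalIntegral.integral_ofReal,
        intervalIntegral.integral_of_le ht.1.le, integral_Ioc_eq_integral_Ioo,
        ← integral_indicator measurableSet_Ioo]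
      congr 1 with τ
      rw [ContinuousLinearMap.mul_apply']
      by_cases hτ : τ ∈ Ioo 0 t
      · rw [indicator_of_mem hτ, hF,
          indicator_of_mem (show τ ∈ Ioo 0 T from ⟨hτ.1, hτ.2.trans ht.2⟩)]
        push_cast
        ring
      · rw [indicator_of_notMem hτ]
        by_cases hτ0 : 0 < τ
        · have : t ≤ τ := by
            by_contra h
            exact hτ ⟨hτ0, not_le.1 h⟩
          rw [hβ0 _ (by linarith), Complex.ofReal_zero, mul_zero]
        · rw [hF, indicator_of_notMem (fun h => hτ0 h.1), zero_mul]
    · rw [indicator_of_notMem ht, hF, indicator_of_notMem ht, mul_zero]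
  rw [hE0, Complex.ofReal_re] at hre
  exact hre

end Volterra

/-! ### The scalar solution: energy estimate and Laplace transforms. -/

namespace Volterra

open FourierTransform

/-- The causal convolution of two functions on the half-line. -/
def causalConv (b u : ℝ → ℝ) (t : ℝ) : ℝ := ∫ τ in (0 : ℝ)..t, b (t - τ) * u τ

theorem SubexponentialGrowth.congr {U V : ℝ → ℝ} (hU : SubexponentialGrowth U)
    (h : U =ᵐ[volume.restrict (Ioi 0)] V) : SubexponentialGrowth V := by
  intro ε hε
  refine (hU ε hε).congr ?_
  filter_upwards [h] with t ht
  rw [ht]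

theorem laplace_congr {U V : ℝ → ℝ} (h : U =ᵐ[volume.restrict (Ioi 0)] V) :
    laplace U = laplace V := by
  ext z
  refine integral_congr_ae ?_
  filter_upwards [h] with t ht
  rw [ht]

theorem ae_restrict_Ioi_of_forall {U V : ℝ → ℝ} (h : ∀ t, 0 < t → U t = V t) :
    U =ᵐ[volume.restrict (Ioi 0)] V :=
  (ae_restrict_mem measurableSet_Ioi).mono fun t ht => h t ht

theorem SubexponentialGrowth.add {U V : ℝ → ℝ} (hU : SubexponentialGrowth U)
    (hV : SubexponentialGrowth V) : SubexponentialGrowth fun t => U t + V t := by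
  intro ε hε
  refine ((hU ε hε).add (hV ε hε)).congr (.of_forall fun t => ?_)
  simp only [Pi.add_apply]
  ring

theorem SubexponentialGrowth.const_mul {U : ℝ → ℝ} (hU : SubexponentialGrowth U) (c : ℝ) :
    SubexponentialGrowth fun t => c * U t := by
  intro ε hε
  refine ((hU ε hε).const_mul c).congr (.of_forall fun t => ?_)
  simp only
  ring

theorem SubexponentialGrowth.id_mul {U : ℝ → ℝ} (hU : SubexponentialGrowth U) :
    SubexponentialGrowth fun t => t * U t := by
  intro ε hε
  have := (hU.toC.mul_id ε hε).re
  refine this.congr (.of_forall fun t => ?_)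
  simp only
  rw [← Complex.ofReal_mul, ← Complex.ofReal_mul]
  exact Complex.ofReal_re _

theorem laplace_add {U V : ℝ → ℝ} (hU : SubexponentialGrowth U) (hV : SubexponentialGrowth V)
    {z : ℂ} (hz : 0 < z.re) : laplace (fun t => U t + V t) z = laplace U z + laplace V z := by
  rw [laplace, laplace, laplace, ← integral_add (hU.toC.integrableOn hz) (hV.toC.integrableOn hz)]
  congr 1 with t
  push_cast
  ring

theorem laplace_const_mul (U : ℝ → ℝ) (c : ℝ) (z : ℂ) :
    laplace (fun t => c * U t) z = c * laplace U z := by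
  rw [laplace, laplace, ← integral_const_mul]
  congr 1 with t
  push_cast
  ring

theorem laplace_id_mul {U : ℝ → ℝ} (hU : SubexponentialGrowth U) {z : ℂ} (hz : 0 < z.re) :
    laplace (fun t => t * U t) z = -deriv (laplace U) z := by
  rw [laplace_eq_laplaceC U, (hasDerivAt_laplaceC hU.toC hz).deriv, neg_neg, laplace, laplaceC]
  congr 1 with t
  push_cast
  ring

theorem subexponentialGrowth_of_bounded {U : ℝ → ℝ} (hU : ContinuousOn U (Ici 0)) {M : ℝ}
    (hM : ∀ t, 0 < t → |U t| ≤ M) : SubexponentialGrowth U := by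
  intro ε hε
  have h1 : IntegrableOn (fun t => Real.exp (-(ε * t))) (Ioi 0) := by
    have := integrableOn_exp_mul_Ioi (a := -ε) (by linarith) 0
    simpa using this
  refine Integrable.mul_bdd (c := M) h1 ?_ ?_
  · exact (hU.mono Ioi_subset_Ici_self).aestronglyMeasurable measurableSet_Ioi
  · exact (ae_restrict_mem measurableSet_Ioi).mono fun t ht => hM t ht

theorem subexponentialGrowth_one : SubexponentialGrowth fun _ => 1 :=
  subexponentialGrowth_of_bounded continuousOn_const (M := 1) (by simp)

theorem laplace_one {z : ℂ} (hz : 0 < z.re) : laplace (fun _ => 1) z = 1 / z := by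
  rw [laplace]
  have := integral_exp_mul_complex_Ioi (a := -z) (by simpa using hz) 0
  simp only [neg_mul] at this
  simpa using this

theorem SubexponentialGrowth.causalConv {b u : ℝ → ℝ} (hb : SubexponentialGrowth b)
    (hu : SubexponentialGrowth u) : SubexponentialGrowth (causalConv b u) := by
  intro ε hε
  have := (integrable_posConvolution (hu ε hε) (hb ε hε)
    (ContinuousLinearMap.mul ℝ ℝ)).integrableOn (s := Ioi 0)
  refine this.congr ?_
  filter_upwards [ae_restrict_mem measurableSet_Ioi] with t ht
  rw [posConvolution, indicator_of_mem ht, Volterra.causalConv,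
    ← intervalIntegral.integral_const_mul]
  congr 1 with τ
  rw [ContinuousLinearMap.mul_apply', show -(ε * t) = -(ε * τ) + -(ε * (t - τ)) by ring,
    Real.exp_add]
  ring

theorem laplace_causalConv {b u : ℝ → ℝ} (hb : SubexponentialGrowth b)
    (hu : SubexponentialGrowth u) {z : ℂ} (hz : 0 < z.re) :
    laplace (causalConv b u) z = laplace b z * laplace u z := by
  have := integral_posConvolution (hu.toC.integrableOn hz) (hb.toC.integrableOn hz)
    (ContinuousLinearMap.mul ℝ ℂ)
  rw [ContinuousLinearMap.mul_apply', mul_comm] at this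
  refine Eq.trans ?_ this
  rw [laplace]
  congr 1 with t
  rw [Volterra.causalConv, ← intervalIntegral.integral_ofReal, ← intervalIntegral.integral_const_mul]
  congr 1 with τ
  rw [ContinuousLinearMap.mul_apply', show -(z * t) = -(z * τ) + -(z * (t - τ : ℝ)) by push_cast; ring,
    Complex.exp_add]
  push_cast
  ring

theorem SubexponentialGrowth.intervalIntegrable {u : ℝ → ℝ} (hu : SubexponentialGrowth u) {x y : ℝ}
    (hx : 0 ≤ x) (hy : 0 ≤ y) : IntervalIntegrable u volume x y := by
  have h1 : IntervalIntegrable (fun t => Real.exp (-(1 * t)) * u t) volume x y := by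
    rw [intervalIntegrable_iff]
    refine (hu 1 one_pos).mono_set fun t ht => ?_
    exact lt_of_le_of_lt (le_min hx hy) ht.1
  have h2 := h1.continuousOn_mul (g := fun t => Real.exp t) (by fun_prop)
  refine h2.congr fun t _ => ?_
  rw [← mul_assoc, ← Real.exp_add]
  simp

/-- Uniqueness for the Laplace transform. -/
theorem ae_eq_of_laplace_eq {U V : ℝ → ℝ} (hU : SubexponentialGrowth U)
    (hV : SubexponentialGrowth V) (h : ∀ z : ℂ, 0 < z.re → laplace U z = laplace V z) :
    U =ᵐ[volume.restrict (Ioi 0)] V := by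
  have hW : SubexponentialGrowth fun t => U t + (-1) * V t := hU.add (hV.const_mul _)
  have hW0 : ∀ z : ℂ, 0 < z.re → laplaceC (fun t => ((U t + (-1) * V t : ℝ) : ℂ)) z = 0 := by
    intro z hz
    have := laplace_add hU (hV.const_mul (-1)) hz
    rw [laplace_const_mul, h z hz] at this
    rw [laplace_eq_laplaceC] at this
    rw [this]
    push_cast
    ring
  -- The single vertical line Re z = 1 already determines the function, by Fourier inversion.
  have hF : 𝓕 ((Ioi (0 : ℝ)).indicator fun t => (Real.exp (-(1 * t)) : ℂ) *
      ((U t + (-1) * V t : ℝ) : ℂ)) = 0 := by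
    ext ξ
    rw [fourier_indicator_eq_laplaceC (fun t => ((U t + (-1) * V t : ℝ) : ℂ))]
    exact hW0 _ (by simp)
  have key := ae_eq_fourierInv_fourier
    ((integrable_indicator_iff measurableSet_Ioi).2 (hW.toC 1 one_pos)) (by rw [hF]; exact integrable_zero _ _ _)
  rw [hF] at key
  rw [EventuallyEq, ae_restrict_iff' measurableSet_Ioi]
  filter_upwards [key] with t ht htm
  rw [indicator_of_mem htm, fourierInv_real_eq] at ht
  simp only [Pi.zero_apply, mul_zero, integral_zero, mul_eq_zero] at ht
  rcases ht with ht | ht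
  · exact absurd (Complex.ofReal_eq_zero.1 ht) (Real.exp_pos _).ne'
  · have := Complex.ofReal_eq_zero.1 ht
    linarith

/-- The energy estimate. -/
theorem IsScalarSolution.abs_le_one {b s : ℝ → ℝ} {μ : ℝ} (hb : SubexponentialGrowth b)
    (hre : ∀ z : ℂ, 0 < z.re → 0 ≤ (laplace b z).re) (hμ : 0 < μ)
    (hs : IsScalarSolution b μ s) {T : ℝ} (hT : 0 < T) : |s T| ≤ 1 := by
  -- The kernel need not be integrable. After multiplication by e^{-εt} the damped solution f
  -- satisfies f' = -εf - μ β ⋆ f with β integrable and of positive type; ε is removed at the end.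
  have main : ∀ ε : ℝ, 0 < ε → Real.exp (-(ε * T)) * |s T| ≤ 1 := by
    intro ε hε
    set β : ℝ → ℝ := indicator (Ioi 0) fun t => Real.exp (-(ε * t)) * b t with hβ
    set f : ℝ → ℝ := fun t => Real.exp (-(ε * t)) * s t with hf
    set f' : ℝ → ℝ := fun t => -ε * f t - μ * ∫ τ in (0 : ℝ)..t, β (t - τ) * f τ with hf'
    have hβi : Integrable β := (integrable_indicator_iff measurableSet_Ioi).2 (hb ε hε)
    have hβ0 : ∀ t ≤ 0, β t = 0 := fun t ht => indicator_of_notMem (not_lt.2 ht) _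
    have hβp : ∀ t, 0 < t → β t = Real.exp (-(ε * t)) * b t := fun t ht => indicator_of_mem ht _
    have hfc : ContinuousOn f (Icc 0 T) :=
      ContinuousOn.mul (by fun_prop) (hs.continuousOn.mono Icc_subset_Ici_self)
    have hd : ∀ t ∈ Ioo 0 T, HasDerivAt f (f' t) t := by
      intro t ht
      have h1 : HasDerivAt (fun t => Real.exp (-(ε * t))) (Real.exp (-(ε * t)) * -(ε * 1)) t :=
        ((hasDerivAt_id' t).const_mul ε).neg.exp
      refine (h1.mul (hs.equation t ht.1)).congr_deriv ?_
      have h2 : (∫ τ in (0 : ℝ)..t, β (t - τ) * f τ) =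
          Real.exp (-(ε * t)) * ∫ τ in (0 : ℝ)..t, b (t - τ) * s τ := by
        rw [← intervalIntegral.integral_const_mul]
        refine intervalIntegral.integral_congr_ae ?_
        have : ∀ᵐ τ : ℝ, τ ≠ t := by simp [ae_iff]
        filter_upwards [this] with τ hτ hτm
        rw [uIoc_of_le ht.1.le] at hτm
        rw [hβp _ (sub_pos.2 (lt_of_le_of_ne hτm.2 hτ)), hf,
          show -(ε * t) = -(ε * τ) + -(ε * (t - τ)) by ring, Real.exp_add]
        ring
      rw [hf', hf]
      simp only
      rw [h2]
      ring
    obtain ⟨M, hM⟩ := isCompact_Icc.exists_bound_of_continuousOn hfc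
    have hM0 : 0 ≤ M := (norm_nonneg _).trans (hM 0 ⟨le_rfl, hT.le⟩)
    have hconv : ∀ t ∈ Ioo 0 T, |∫ τ in (0 : ℝ)..t, β (t - τ) * f τ| ≤ M * ∫ τ, ‖β τ‖ := by
      intro t ht
      rw [← integral_sub_left_eq_self (fun τ => ‖β τ‖) volume t, ← integral_const_mul,
        intervalIntegral.integral_of_le ht.1.le, ← integral_indicator measurableSet_Ioc,
        ← Real.norm_eq_abs]
      refine norm_integral_le_of_norm_le ((hβi.comp_sub_left t).norm.const_mul M)
        (.of_forall fun τ => ?_)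
      by_cases hτ : τ ∈ Ioc 0 t
      · rw [indicator_of_mem hτ, norm_mul, mul_comm]
        gcongr
        exact hM τ ⟨hτ.1.le, hτ.2.trans ht.2.le⟩
      · rw [indicator_of_notMem hτ, norm_zero]
        positivity
    have hM' : ∀ t ∈ Ioo 0 T, |f' t| ≤ ε * M + μ * (M * ∫ τ, ‖β τ‖) := by
      intro t ht
      refine (abs_sub _ _).trans ?_
      rw [abs_mul (-ε), abs_mul μ, abs_neg, abs_of_pos hε, abs_of_pos hμ]
      gcongr
      · exact hM t (Ioo_subset_Icc_self ht)
      · exact hconv t ht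
    have hpos := integral_mul_convolution_nonneg hβi hβ0 (fun ξ => by
      have e : (fun t => (β t : ℂ)) =
          (Ioi (0 : ℝ)).indicator fun t => (Real.exp (-(ε * t)) : ℂ) * (b t : ℂ) := by
        ext t
        by_cases ht : t ∈ Ioi (0 : ℝ)
        · rw [hβ, indicator_of_mem ht, indicator_of_mem ht, Complex.ofReal_mul]
        · rw [hβ, indicator_of_notMem ht, indicator_of_notMem ht, Complex.ofReal_zero]
      rw [e, fourier_indicator_eq_laplaceC (fun t => (b t : ℂ)), ← laplace_eq_laplaceC]
      exact hre _ (by simpa using hε)) hT hfc hd hM'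
    have hmeas : IntervalIntegrable f' volume 0 T := by
      rw [intervalIntegrable_iff_integrableOn_Ioo_of_le hT.le]
      have h1 : IntegrableOn (deriv f) (Ioo 0 T) := by
        refine Measure.integrableOn_of_bounded (M := ε * M + μ * (M * ∫ τ, ‖β τ‖)) (by simp)
          (measurable_deriv f).aestronglyMeasurable ?_
        refine (ae_restrict_mem measurableSet_Ioo).mono fun t ht => ?_
        rw [(hd t ht).deriv]
        exact hM' t ht
      exact h1.congr_fun (fun t ht => (hd t ht).deriv) measurableSet_Ioo
    have hff' : IntervalIntegrable (fun t => f t * f' t) volume 0 T :=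
      hmeas.continuousOn_mul (by rwa [uIcc_of_le hT.le])
    have hff : IntervalIntegrable (fun t => f t * f t) volume 0 T :=
      ContinuousOn.intervalIntegrable (by rw [uIcc_of_le hT.le]; exact hfc.mul hfc)
    have hftc := intervalIntegral.integral_eq_sub_of_hasDerivAt_of_le hT.le
      (f := fun t => f t ^ 2) (f' := fun t => 2 * (f t * f' t)) (hfc.pow 2)
      (fun t ht => ((hd t ht).pow 2).congr_deriv (by simp; ring)) (hff'.const_mul 2)
    have h0 : f 0 = 1 := by simp [hf, hs.initial]
    have hint : (∫ t in (0 : ℝ)..T, 2 * (f t * f' t)) ≤ 0 := by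
      -- Energy identity: -(f²)' - 2εf² = 2μ f·(β ⋆ f), whose right side has nonnegative integral.
      have e : ∀ t, -1 * (2 * (f t * f' t)) - 2 * ε * (f t * f t) =
          2 * μ * (f t * ∫ τ in (0 : ℝ)..t, β (t - τ) * f τ) := by
        intro t
        rw [hf']
        ring
      have h1 : 0 ≤ ∫ t in (0 : ℝ)..T, (-1 * (2 * (f t * f' t)) - 2 * ε * (f t * f t)) := by
        simp_rw [e]
        rw [intervalIntegral.integral_const_mul]
        positivity
      rw [intervalIntegral.integral_sub ((hff'.const_mul 2).const_mul (-1)) (hff.const_mul _),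
        intervalIntegral.integral_const_mul (-1), intervalIntegral.integral_const_mul (2 * ε)] at h1
      have h2 : 0 ≤ ∫ t in (0 : ℝ)..T, f t * f t :=
        intervalIntegral.integral_nonneg hT.le fun t _ => mul_self_nonneg _
      have h3 : 0 ≤ 2 * ε * ∫ t in (0 : ℝ)..T, f t * f t := by positivity
      linarith
    rw [hftc, h0] at hint
    have : |f T| ≤ 1 := by
      rw [← sq_le_one_iff_abs_le_one]
      linarith
    rwa [hf, abs_mul, abs_of_pos (Real.exp_pos _)] at this
  have hlim : Tendsto (fun ε : ℝ => Real.exp (-(ε * T)) * |s T|) (𝓝[>] 0)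
      (𝓝 (Real.exp (-(0 * T)) * |s T|)) := by
    have hc : Continuous fun ε : ℝ => Real.exp (-(ε * T)) * |s T| := by fun_prop
    exact (hc.tendsto 0).mono_left nhdsWithin_le_nhds
  rw [zero_mul, neg_zero, Real.exp_zero, one_mul] at hlim
  exact le_of_tendsto hlim (by filter_upwards [self_mem_nhdsWithin] with ε hε using main ε hε)

/-- The Laplace transforms of a solution and of its first two derivatives. -/
structure SolutionTransforms (b : ℝ → ℝ) (μ : ℝ) (s : ℝ → ℝ) : Prop where
  growth : SubexponentialGrowth s
  growth_deriv : SubexponentialGrowth (deriv s)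
  growth_deriv_deriv : SubexponentialGrowth (deriv (deriv s))
  laplace_mul : ∀ z : ℂ, 0 < z.re → laplace s z * (z + μ * laplace b z) = 1
  laplace_deriv : ∀ z : ℂ, 0 < z.re → laplace (deriv s) z = -(μ * laplace b z * laplace s z)
  laplace_deriv_deriv : ∀ z : ℂ, 0 < z.re →
    laplace (deriv (deriv s)) z = -(z * (μ * laplace b z * laplace s z))
  absolutelyContinuous : ∀ x y : ℝ, 0 < x → x ≤ y → AbsolutelyContinuousOnInterval (deriv s) x y

theorem absolutelyContinuousOnInterval_congr {X : Type*} [PseudoMetricSpace X] {f g : ℝ → X}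
    {x y : ℝ} (hf : AbsolutelyContinuousOnInterval f x y) (h : ∀ t ∈ uIcc x y, f t = g t) :
    AbsolutelyContinuousOnInterval g x y := by
  rw [absolutelyContinuousOnInterval_iff] at hf ⊢
  intro ε hε
  obtain ⟨δ, hδ, hf⟩ := hf ε hε
  refine ⟨δ, hδ, fun E hE hE2 => lt_of_eq_of_lt ?_ (hf E hE hE2)⟩
  refine Finset.sum_congr rfl fun i hi => ?_
  rw [h _ (hE.1 i hi).1, h _ (hE.1 i hi).2]

/-- The equation and s = 1 + ∫ s' become algebraic after transformation. Differentiating b ⋆ s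
directly is not possible for b merely locally integrable, so its derivative v is written down and
identified through uniqueness of the Laplace transform. -/
theorem IsScalarSolution.solutionTransforms {b s : ℝ → ℝ} {μ : ℝ} (hb : SubexponentialGrowth b)
    (hre : ∀ z : ℂ, 0 < z.re → 0 ≤ (laplace b z).re) (hμ : 0 < μ)
    (hs : IsScalarSolution b μ s) : SolutionTransforms b μ s := by
  have g0 : SubexponentialGrowth s :=
    subexponentialGrowth_of_bounded hs.continuousOn fun t ht => hs.abs_le_one hb hre hμ ht
  have hd : ∀ t, 0 < t → deriv s t = -μ * causalConv b s t := by
    intro t ht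
    rw [(hs.equation t ht).deriv, causalConv]
    ring
  have g1 : SubexponentialGrowth (deriv s) :=
    ((hb.causalConv g0).const_mul (-μ)).congr
      (ae_restrict_Ioi_of_forall fun t ht => (hd t ht).symm)
  have l1 : ∀ z : ℂ, 0 < z.re → laplace (deriv s) z = -(μ * laplace b z * laplace s z) := by
    intro z hz
    rw [laplace_congr (ae_restrict_Ioi_of_forall hd), laplace_const_mul,
      laplace_causalConv hb g0 hz]
    push_cast
    ring
  have hftc : ∀ t, 0 < t → s t = 1 + causalConv (fun _ => 1) (deriv s) t := by
    intro t ht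
    have := intervalIntegral.integral_eq_sub_of_hasDerivAt_of_le ht.le
      (hs.continuousOn.mono Icc_subset_Ici_self)
      (fun x hx => (hs.equation x hx.1).differentiableAt.hasDerivAt)
      (g1.intervalIntegrable le_rfl ht.le)
    simp only [causalConv, one_mul]
    rw [this, hs.initial]
    ring
  have l0 : ∀ z : ℂ, 0 < z.re → z * laplace s z = 1 + laplace (deriv s) z := by
    intro z hz
    have hz0 : z ≠ 0 := by
      rintro rfl
      simp at hz
    rw [laplace_congr (ae_restrict_Ioi_of_forall hftc),
      laplace_add subexponentialGrowth_one (subexponentialGrowth_one.causalConv g1) hz,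
      laplace_causalConv subexponentialGrowth_one g1 hz, laplace_one hz]
    field_simp
  -- The formal derivative of b ⋆ s, given s(0) = 1; thus s'' should be -μv.
  set v : ℝ → ℝ := fun t => b t + causalConv b (deriv s) t with hv
  have gv : SubexponentialGrowth v := hb.add (hb.causalConv g1)
  have lv : ∀ z : ℂ, 0 < z.re → laplace v z = z * (laplace b z * laplace s z) := by
    intro z hz
    rw [hv, laplace_add hb (hb.causalConv g1) hz, laplace_causalConv hb g1 hz]
    linear_combination -laplace b z * l0 z hz
  have hae : deriv s =ᵐ[volume.restrict (Ioi 0)]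
      fun t => -μ * causalConv (fun _ => 1) v t := by
    refine ae_eq_of_laplace_eq g1 ((subexponentialGrowth_one.causalConv gv).const_mul _)
      fun z hz => ?_
    have hz0 : z ≠ 0 := by
      rintro rfl
      simp at hz
    rw [laplace_const_mul, laplace_causalConv subexponentialGrowth_one gv hz, laplace_one hz,
      lv z hz, l1 z hz]
    push_cast
    field_simp
  have hcv : ∀ t, causalConv (fun _ => 1) v t = ∫ τ in (0 : ℝ)..t, v τ := by
    intro t
    simp only [causalConv, one_mul]
  have hvc : ContinuousOn (fun t => ∫ τ in (0 : ℝ)..t, v τ) (Ici 0) := by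
    intro t ht
    have ht0 : (0 : ℝ) ≤ t := ht
    have h1 : ContinuousOn (fun t => ∫ τ in (0 : ℝ)..t, v τ) (uIcc 0 (t + 1)) :=
      intervalIntegral.continuousOn_primitive_interval' (gv.intervalIntegrable le_rfl (by linarith))
        left_mem_uIcc
    rw [uIcc_of_le (by linarith)] at h1
    refine (h1 t ⟨ht0, by linarith⟩).mono_of_mem_nhdsWithin ?_
    rw [← Ici_inter_Iic]
    exact inter_mem_nhdsWithin _ (Iic_mem_nhds (by linarith))
  -- Integrating once removes the exceptional null set. Since the integrand is continuous,
  -- differentiating back gives s' = -μ∫v at every t > 0, hence absolute continuity.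
  have hs2 : ∀ t, 0 < t → s t = 1 + ∫ τ in (0 : ℝ)..t, -μ * ∫ r in (0 : ℝ)..τ, v r := by
    intro t ht
    rw [hftc t ht, causalConv]
    congr 1
    refine intervalIntegral.integral_congr_ae ?_
    rw [EventuallyEq, ae_restrict_iff' measurableSet_Ioi] at hae
    filter_upwards [hae] with τ h1 h2
    rw [uIoc_of_le ht.le] at h2
    rw [one_mul, h1 h2.1, hcv]
  have hd2 : ∀ t, 0 < t → deriv s t = -μ * ∫ τ in (0 : ℝ)..t, v τ := by
    intro t ht
    have hc2 : ContinuousOn (fun t => -μ * ∫ τ in (0 : ℝ)..t, v τ) (Ici 0) :=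
      hvc.const_mul _
    have h1 : HasDerivAt (fun t => 1 + ∫ τ in (0 : ℝ)..t, -μ * ∫ r in (0 : ℝ)..τ, v r)
        (-μ * ∫ r in (0 : ℝ)..t, v r) t := by
      refine (intervalIntegral.integral_hasDerivAt_right ?_ ?_
        (hc2.continuousAt (Ici_mem_nhds ht))).const_add 1
      · exact ContinuousOn.intervalIntegrable (hc2.mono (by
          rw [uIcc_of_le ht.le]; exact Icc_subset_Ici_self))
      · exact hc2.stronglyMeasurableAtFilter_nhdsWithin measurableSet_Ici t |>.filter_mono
          (by rw [nhdsWithin_eq_nhds.2 (Ici_mem_nhds ht)])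
    have h2 : s =ᶠ[𝓝 t] fun t => 1 + ∫ τ in (0 : ℝ)..t, -μ * ∫ r in (0 : ℝ)..τ, v r := by
      filter_upwards [Ioi_mem_nhds ht] with x hx using hs2 x hx
    exact (h1.congr_of_eventuallyEq h2).deriv
  -- Lebesgue differentiation on each [0, n].
  have hdd : deriv (deriv s) =ᵐ[volume.restrict (Ioi 0)] fun t => -μ * v t := by
    have h1 : ∀ᵐ t : ℝ, ∀ n : ℕ, t ∈ uIcc (0 : ℝ) n →
        ∀ c ∈ uIcc (0 : ℝ) n, HasDerivAt (fun x => ∫ τ in c..x, v τ) (v t) t :=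
      ae_all_iff.2 fun n =>
        (gv.intervalIntegrable le_rfl n.cast_nonneg).ae_hasDerivAt_integral
    rw [EventuallyEq, ae_restrict_iff' measurableSet_Ioi]
    filter_upwards [h1] with t ht ht0
    obtain ⟨n, hn⟩ := exists_nat_ge t
    have ht0' : (0 : ℝ) < t := ht0
    have h2 := (ht n ⟨by simpa using ht0'.le, by simp [hn]⟩ 0 left_mem_uIcc).const_mul (-μ)
    refine (h2.congr_of_eventuallyEq ?_).deriv
    filter_upwards [Ioi_mem_nhds ht0'] with x hx using hd2 x hx
  refine ⟨g0, g1, (gv.const_mul (-μ)).congr hdd.symm, fun z hz => ?_, l1, fun z hz => ?_,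
    fun x y hx hxy => ?_⟩
  · linear_combination l0 z hz + l1 z hz
  · rw [laplace_congr hdd, laplace_const_mul, lv z hz]
    push_cast
    ring
  · have h1 : AbsolutelyContinuousOnInterval (fun t => ∫ τ in (0 : ℝ)..t, v τ) 0 y :=
      (gv.intervalIntegrable le_rfl
        (hx.le.trans hxy)).absolutelyContinuousOnInterval_intervalIntegral left_mem_uIcc
    have hsub : uIcc x y ⊆ uIcc 0 y := by
      rw [uIcc_of_le hxy, uIcc_of_le (hx.le.trans hxy)]
      exact Icc_subset_Icc_left hx.le
    refine absolutelyContinuousOnInterval_congr ((h1.mono hsub).const_mul (-μ)) fun t ht => ?_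
    rw [uIcc_of_le hxy] at ht
    exact (hd2 t (hx.trans_le ht.1)).symm

/-! ### Pointwise estimates of the resolvent symbol and its derivatives. -/

/-- The resolvent symbol `1 / (z + μ x)`, where `x` stands for the transform of the kernel at `z`. -/
def symbol (μ : ℝ) (z x : ℂ) : ℂ := (z + μ * x)⁻¹

/-- The first derivative of the resolvent symbol; `x₁` stands for the derivative of `x`. -/
def symbolOne (μ : ℝ) (z x x₁ : ℂ) : ℂ := -(1 + μ * x₁) * (z + μ * x)⁻¹ ^ 2

/-- The second derivative of the resolvent symbol. -/
def symbolTwo (μ : ℝ) (z x x₁ x₂ : ℂ) : ℂ :=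
  -(μ * x₂) * (z + μ * x)⁻¹ ^ 2 + 2 * (1 + μ * x₁) ^ 2 * (z + μ * x)⁻¹ ^ 3

/-- The third derivative of the resolvent symbol. -/
def symbolThree (μ : ℝ) (z x x₁ x₂ x₃ : ℂ) : ℂ :=
  -(μ * x₃) * (z + μ * x)⁻¹ ^ 2 + 6 * (μ * x₂) * (1 + μ * x₁) * (z + μ * x)⁻¹ ^ 3
    - 6 * (1 + μ * x₁) ^ 3 * (z + μ * x)⁻¹ ^ 4

/-- Pointwise conditions on the kernel transform and its derivatives, at a single point. -/
structure SymbolData (κ Λ μ : ℝ) (z x x₁ x₂ : ℂ) : Prop where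
  one_le_κ : 1 ≤ κ
  one_le_Λ : 1 ≤ Λ
  μ_pos : 0 < μ
  norm_pos : 0 < ‖z‖
  lower : ‖z‖ + μ * ‖x‖ ≤ κ * ‖z + μ * x‖
  one : ‖z‖ * ‖x₁‖ ≤ Λ * ‖x‖
  two : ‖z‖ ^ 2 * ‖x₂‖ ≤ Λ * ‖x‖

/-- The constant in the pointwise estimates of the symbols. -/
def symbolConst (κ Λ : ℝ) : ℝ := 24 * Λ ^ 2 * κ ^ 4

namespace SymbolData

variable {κ Λ μ : ℝ} {z x x₁ x₂ : ℂ}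

theorem size_pos (h : SymbolData κ Λ μ z x x₁ x₂) : 0 < ‖z‖ + μ * ‖x‖ := by
  have := h.norm_pos
  have := h.μ_pos
  positivity

theorem ne_zero (h : SymbolData κ Λ μ z x x₁ x₂) : z + μ * x ≠ 0 := by
  intro h0
  have := h.lower
  rw [h0, norm_zero, mul_zero] at this
  linarith [h.size_pos]

theorem norm_inv_le (h : SymbolData κ Λ μ z x x₁ x₂) :
    ‖(z + μ * x)⁻¹‖ ≤ κ * (‖z‖ + μ * ‖x‖)⁻¹ := by
  have h1 := norm_pos_iff.2 h.ne_zero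
  rw [norm_inv, inv_le_iff_one_le_mul₀ h1, mul_right_comm, ← div_eq_mul_inv,
    le_div_iff₀ h.size_pos, one_mul]
  exact h.lower

/-- Each factor z(1 + μx₁) produced by differentiation costs one power of the size |z| + μ|x|, which
one extra factor of the symbol pays for. The estimates below keep at most one factor 1 + μx₁ and
absorb the others this way. -/
theorem norm_mul_norm_le (h : SymbolData κ Λ μ z x x₁ x₂) :
    ‖z‖ * ‖1 + μ * x₁‖ ≤ Λ * (‖z‖ + μ * ‖x‖) := by
  have h1 : ‖1 + μ * x₁‖ ≤ 1 + μ * ‖x₁‖ := by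
    refine (norm_add_le _ _).trans ?_
    rw [norm_mul, norm_one, Complex.norm_real, Real.norm_of_nonneg h.μ_pos.le]
  have := mul_le_mul_of_nonneg_left h1 h.norm_pos.le
  have := mul_le_mul_of_nonneg_left h.one h.μ_pos.le
  have := mul_le_mul_of_nonneg_right h.one_le_Λ h.norm_pos.le
  linarith

theorem sq_le (h : SymbolData κ Λ μ z x x₁ x₂) :
    ‖(z + μ * x)⁻¹‖ ^ 2 ≤ κ ^ 4 * ((‖z‖ + μ * ‖x‖)⁻¹) ^ 2 := by
  have h1 := h.norm_inv_le
  have h2 : κ ^ 2 ≤ κ ^ 4 := pow_le_pow_right₀ h.one_le_κ (by norm_num)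
  calc ‖(z + μ * x)⁻¹‖ ^ 2 ≤ (κ * (‖z‖ + μ * ‖x‖)⁻¹) ^ 2 := by gcongr
    _ = κ ^ 2 * ((‖z‖ + μ * ‖x‖)⁻¹) ^ 2 := by ring
    _ ≤ _ := by gcongr

theorem mul_cube_le (h : SymbolData κ Λ μ z x x₁ x₂) :
    ‖z‖ * ‖1 + μ * x₁‖ * ‖(z + μ * x)⁻¹‖ ^ 3 ≤ Λ * κ ^ 4 * ((‖z‖ + μ * ‖x‖)⁻¹) ^ 2 := by
  have h1 := h.norm_inv_le
  have h2 : κ ^ 3 ≤ κ ^ 4 := pow_le_pow_right₀ h.one_le_κ (by norm_num)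
  have h3 := h.norm_mul_norm_le
  have hS := h.size_pos
  have hΛ := h.one_le_Λ
  have hκ := h.one_le_κ
  calc ‖z‖ * ‖1 + μ * x₁‖ * ‖(z + μ * x)⁻¹‖ ^ 3
      ≤ Λ * (‖z‖ + μ * ‖x‖) * (κ * (‖z‖ + μ * ‖x‖)⁻¹) ^ 3 := by gcongr
    _ = Λ * κ ^ 3 * ((‖z‖ + μ * ‖x‖)⁻¹) ^ 2 := by
      field_simp
    _ ≤ _ := by gcongr

theorem mul_fourth_le (h : SymbolData κ Λ μ z x x₁ x₂) :
    (‖z‖ * ‖1 + μ * x₁‖) ^ 2 * ‖(z + μ * x)⁻¹‖ ^ 4 ≤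
      Λ ^ 2 * κ ^ 4 * ((‖z‖ + μ * ‖x‖)⁻¹) ^ 2 := by
  have h1 := h.norm_inv_le
  have h3 := h.norm_mul_norm_le
  have hS := h.size_pos
  have hΛ := h.one_le_Λ
  have hκ := h.one_le_κ
  calc (‖z‖ * ‖1 + μ * x₁‖) ^ 2 * ‖(z + μ * x)⁻¹‖ ^ 4
      ≤ (Λ * (‖z‖ + μ * ‖x‖)) ^ 2 * (κ * (‖z‖ + μ * ‖x‖)⁻¹) ^ 4 := by gcongr
    _ = _ := by
      field_simp

theorem norm_sub_le (h : SymbolData κ Λ μ z x x₁ x₂) :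
    ‖μ * (x - z * x₁)‖ ≤ 2 * Λ * (μ * ‖x‖) := by
  have h1 : ‖x - z * x₁‖ ≤ ‖x‖ + ‖z‖ * ‖x₁‖ := by
    refine (_root_.norm_sub_le _ _).trans ?_
    rw [norm_mul]
  have h2 : ‖x - z * x₁‖ ≤ 2 * Λ * ‖x‖ := by
    nlinarith [h.one, h.one_le_Λ, norm_nonneg x]
  rw [norm_mul, Complex.norm_real, Real.norm_of_nonneg h.μ_pos.le]
  nlinarith [h.μ_pos]

theorem const_le (h : SymbolData κ Λ μ z x x₁ x₂) :
    κ ≤ symbolConst κ Λ / 24 ∧ κ ^ 4 ≤ symbolConst κ Λ / 24 ∧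
      Λ * κ ^ 4 ≤ symbolConst κ Λ / 24 ∧ Λ ^ 2 * κ ^ 4 = symbolConst κ Λ / 24 := by
  have h1 : κ ≤ κ ^ 4 := le_self_pow₀ h.one_le_κ (by norm_num)
  have hκ : 0 ≤ κ ^ 4 := pow_nonneg (zero_le_one.trans h.one_le_κ) _
  have h2 : 1 * κ ^ 4 ≤ Λ * κ ^ 4 := mul_le_mul_of_nonneg_right h.one_le_Λ hκ
  have h3 : Λ * κ ^ 4 ≤ Λ ^ 2 * κ ^ 4 :=
    mul_le_mul_of_nonneg_right (le_self_pow₀ h.one_le_Λ (by norm_num)) hκ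
  have h4 : Λ ^ 2 * κ ^ 4 = symbolConst κ Λ / 24 := by
    rw [symbolConst]
    ring
  exact ⟨by linarith, by linarith, by linarith, h4⟩

theorem norm_symbol_le (h : SymbolData κ Λ μ z x x₁ x₂) :
    ‖symbol μ z x‖ ≤ symbolConst κ Λ * (‖z‖ + μ * ‖x‖)⁻¹ := by
  have hS := inv_pos.2 h.size_pos
  have := h.const_le.1
  have hκ := h.one_le_κ
  refine h.norm_inv_le.trans ?_
  gcongr
  linarith

theorem one_sub_eq (h : SymbolData κ Λ μ z x x₁ x₂) :
    1 - z * symbol μ z x = μ * x * (z + μ * x)⁻¹ := by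
  have := h.ne_zero
  rw [symbol]
  field_simp
  ring

theorem norm_one_sub_le (h : SymbolData κ Λ μ z x x₁ x₂) :
    ‖1 - z * symbol μ z x‖ ≤ symbolConst κ Λ * (μ * ‖x‖) * (‖z‖ + μ * ‖x‖)⁻¹ := by
  have hS := inv_pos.2 h.size_pos
  have h1 := h.const_le.1
  have hκ := h.one_le_κ
  have hμ := h.μ_pos
  rw [h.one_sub_eq, norm_mul, norm_mul, Complex.norm_real, Real.norm_of_nonneg hμ.le]
  calc μ * ‖x‖ * ‖(z + μ * x)⁻¹‖ ≤ μ * ‖x‖ * (κ * (‖z‖ + μ * ‖x‖)⁻¹) := by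
        gcongr
        exact h.norm_inv_le
    _ = κ * (μ * ‖x‖) * (‖z‖ + μ * ‖x‖)⁻¹ := by ring
    _ ≤ _ := by
      gcongr
      linarith

/-- The decisive cancellation: in the derivative of zσ the terms free of x drop out, leaving a
multiple of μ(x - z x₁). Its bound carries μ|x| and so matches the first integral condition. -/
theorem add_mul_eq (h : SymbolData κ Λ μ z x x₁ x₂) :
    symbol μ z x + z * symbolOne μ z x x₁ = μ * (x - z * x₁) * (z + μ * x)⁻¹ ^ 2 := by
  have := h.ne_zero
  rw [symbol, symbolOne]
  field_simp
  ring

theorem norm_add_mul_aux (h : SymbolData κ Λ μ z x x₁ x₂) :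
    ‖symbol μ z x + z * symbolOne μ z x x₁‖ ≤
      2 * (symbolConst κ Λ / 24) * (μ * ‖x‖) * ((‖z‖ + μ * ‖x‖)⁻¹) ^ 2 := by
  have hμ := h.μ_pos
  have hΛ := h.one_le_Λ
  rw [h.add_mul_eq, norm_mul, norm_pow]
  calc ‖μ * (x - z * x₁)‖ * ‖(z + μ * x)⁻¹‖ ^ 2
      ≤ (2 * Λ * (μ * ‖x‖)) * (κ ^ 4 * ((‖z‖ + μ * ‖x‖)⁻¹) ^ 2) := by
        gcongr
        · exact h.norm_sub_le
        · exact h.sq_le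
    _ = 2 * (Λ * κ ^ 4) * (μ * ‖x‖) * ((‖z‖ + μ * ‖x‖)⁻¹) ^ 2 := by ring
    _ ≤ _ := by
      gcongr
      exact h.const_le.2.2.1

theorem const_pos (h : SymbolData κ Λ μ z x x₁ x₂) : 0 < symbolConst κ Λ := by
  have := h.one_le_κ
  have := h.one_le_Λ
  rw [symbolConst]
  positivity

theorem norm_add_mul_le (h : SymbolData κ Λ μ z x x₁ x₂) :
    ‖symbol μ z x + z * symbolOne μ z x x₁‖ ≤
      symbolConst κ Λ * (μ * ‖x‖) * ((‖z‖ + μ * ‖x‖)⁻¹) ^ 2 := by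
  have hμ := h.μ_pos
  have := h.const_pos
  refine h.norm_add_mul_aux.trans ?_
  gcongr
  linarith

/-- The second derivative of zσ, multiplied by z, again has a factor μ(z²x₂) or μ(x - z x₁) in every
term, hence the same bound with μ|x|. -/
theorem two_mul_add_eq (h : SymbolData κ Λ μ z x x₁ x₂) :
    z * (2 * symbolOne μ z x x₁ + z * symbolTwo μ z x x₁ x₂) =
      -(μ * (z ^ 2 * x₂)) * (z + μ * x)⁻¹ ^ 2
        - 2 * (μ * (x - z * x₁)) * (z * (1 + μ * x₁) * (z + μ * x)⁻¹ ^ 3) := by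
  have := h.ne_zero
  rw [symbolOne, symbolTwo]
  field_simp
  ring

theorem norm_two_mul_add_aux (h : SymbolData κ Λ μ z x x₁ x₂) :
    ‖z * (2 * symbolOne μ z x x₁ + z * symbolTwo μ z x x₁ x₂)‖ ≤
      5 * (symbolConst κ Λ / 24) * (μ * ‖x‖) * ((‖z‖ + μ * ‖x‖)⁻¹) ^ 2 := by
  have hμ := h.μ_pos
  have hΛ := h.one_le_Λ
  rw [h.two_mul_add_eq]
  set σ := ((‖z‖ + μ * ‖x‖)⁻¹) ^ 2 with hσ
  have h1 : ‖-(μ * (z ^ 2 * x₂)) * (z + μ * x)⁻¹ ^ 2‖ ≤ Λ * κ ^ 4 * (μ * ‖x‖) * σ := by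
    rw [norm_mul, norm_neg, norm_mul, norm_mul, norm_pow, norm_pow, Complex.norm_real,
      Real.norm_of_nonneg hμ.le]
    calc μ * (‖z‖ ^ 2 * ‖x₂‖) * ‖(z + μ * x)⁻¹‖ ^ 2 ≤ μ * (Λ * ‖x‖) * (κ ^ 4 * σ) :=
          mul_le_mul (mul_le_mul_of_nonneg_left h.two hμ.le) h.sq_le (by positivity)
            (by positivity)
      _ = _ := by ring
  have h2 : ‖2 * (μ * (x - z * x₁)) * (z * (1 + μ * x₁) * (z + μ * x)⁻¹ ^ 3)‖ ≤
      4 * (Λ ^ 2 * κ ^ 4) * (μ * ‖x‖) * σ := by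
    rw [norm_mul, norm_mul, norm_mul (z * (1 + μ * x₁)), norm_mul z, norm_pow, Complex.norm_ofNat]
    calc 2 * ‖μ * (x - z * x₁)‖ * (‖z‖ * ‖1 + μ * x₁‖ * ‖(z + μ * x)⁻¹‖ ^ 3)
        ≤ 2 * (2 * Λ * (μ * ‖x‖)) * (Λ * κ ^ 4 * σ) :=
          mul_le_mul (mul_le_mul_of_nonneg_left h.norm_sub_le zero_le_two) h.mul_cube_le
            (by positivity) (by positivity)
      _ = _ := by ring
  refine (_root_.norm_sub_le _ _).trans ?_
  have h3 : Λ * κ ^ 4 * (μ * ‖x‖) * σ ≤ symbolConst κ Λ / 24 * (μ * ‖x‖) * σ := by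
    gcongr
    exact h.const_le.2.2.1
  rw [h.const_le.2.2.2] at h2
  linarith

theorem norm_two_mul_add_le (h : SymbolData κ Λ μ z x x₁ x₂) :
    ‖2 * symbolOne μ z x x₁ + z * symbolTwo μ z x x₁ x₂‖ ≤
      symbolConst κ Λ * (‖z‖ * (‖z‖ + μ * ‖x‖))⁻¹ := by
  have hμ := h.μ_pos
  have hS := h.size_pos
  have hr := h.norm_pos
  have h1 := h.norm_two_mul_add_aux
  have hK := h.const_pos
  rw [norm_mul] at h1
  have h2 : (μ * ‖x‖) * ((‖z‖ + μ * ‖x‖)⁻¹) ^ 2 ≤ (‖z‖ + μ * ‖x‖)⁻¹ := by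
    calc (μ * ‖x‖) * ((‖z‖ + μ * ‖x‖)⁻¹) ^ 2
        ≤ (‖z‖ + μ * ‖x‖) * ((‖z‖ + μ * ‖x‖)⁻¹) ^ 2 := by
          gcongr
          linarith
      _ = _ := by field_simp
  have h3 : ‖z‖ * ‖2 * symbolOne μ z x x₁ + z * symbolTwo μ z x x₁ x₂‖ ≤
      symbolConst κ Λ * (‖z‖ + μ * ‖x‖)⁻¹ := by
    refine h1.trans ?_
    rw [mul_assoc]
    gcongr
    linarith
  rw [mul_inv, mul_left_comm, inv_mul_eq_div, le_div_iff₀ hr, mul_comm]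
  exact h3

theorem norm_transform_le (h : SymbolData κ Λ μ z x x₁ x₂) :
    ‖1 - 2 * z * symbol μ z x - z ^ 2 * symbolOne μ z x x₁‖ ≤
      symbolConst κ Λ * (μ * ‖x‖) * (‖z‖ + μ * ‖x‖)⁻¹ := by
  have hμ := h.μ_pos
  have hS := h.size_pos
  have hK := h.const_pos
  have e : 1 - 2 * z * symbol μ z x - z ^ 2 * symbolOne μ z x x₁ =
      μ * x * (z + μ * x)⁻¹ - z * (symbol μ z x + z * symbolOne μ z x x₁) := by
    rw [← h.one_sub_eq]
    ring
  have h1 : ‖μ * x * (z + μ * x)⁻¹‖ ≤ symbolConst κ Λ / 24 * (μ * ‖x‖) * (‖z‖ + μ * ‖x‖)⁻¹ := by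
    rw [norm_mul, norm_mul, Complex.norm_real, Real.norm_of_nonneg hμ.le]
    calc μ * ‖x‖ * ‖(z + μ * x)⁻¹‖ ≤ μ * ‖x‖ * (κ * (‖z‖ + μ * ‖x‖)⁻¹) := by
          gcongr
          exact h.norm_inv_le
      _ = κ * (μ * ‖x‖) * (‖z‖ + μ * ‖x‖)⁻¹ := by ring
      _ ≤ _ := by
        gcongr
        exact h.const_le.1
  have h2 : ‖z * (symbol μ z x + z * symbolOne μ z x x₁)‖ ≤
      2 * (symbolConst κ Λ / 24) * (μ * ‖x‖) * (‖z‖ + μ * ‖x‖)⁻¹ := by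
    rw [norm_mul]
    calc ‖z‖ * ‖symbol μ z x + z * symbolOne μ z x x₁‖ ≤ (‖z‖ + μ * ‖x‖) *
          (2 * (symbolConst κ Λ / 24) * (μ * ‖x‖) * ((‖z‖ + μ * ‖x‖)⁻¹) ^ 2) := by
          gcongr
          · have : 0 ≤ μ * ‖x‖ := by positivity
            linarith
          · exact h.norm_add_mul_aux
      _ = _ := by field_simp
  rw [e]
  refine (_root_.norm_sub_le _ _).trans ((add_le_add h1 h2).trans ?_)
  rw [← add_mul, ← add_mul]
  gcongr
  linarith

theorem norm_transform_deriv_le (h : SymbolData κ Λ μ z x x₁ x₂) :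
    ‖2 * symbol μ z x + 4 * z * symbolOne μ z x x₁ + z ^ 2 * symbolTwo μ z x x₁ x₂‖ ≤
      symbolConst κ Λ * (μ * ‖x‖) * ((‖z‖ + μ * ‖x‖)⁻¹) ^ 2 := by
  have hμ := h.μ_pos
  have hK := h.const_pos
  have e : 2 * symbol μ z x + 4 * z * symbolOne μ z x x₁ + z ^ 2 * symbolTwo μ z x x₁ x₂ =
      2 * (symbol μ z x + z * symbolOne μ z x x₁) +
        z * (2 * symbolOne μ z x x₁ + z * symbolTwo μ z x x₁ x₂) := by
    ring
  rw [e]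
  refine (norm_add_le _ _).trans ?_
  rw [norm_mul, Complex.norm_ofNat]
  have h1 := h.norm_add_mul_aux
  have h2 := h.norm_two_mul_add_aux
  have h3 : 0 ≤ symbolConst κ Λ * (μ * ‖x‖) * ((‖z‖ + μ * ‖x‖)⁻¹) ^ 2 := by positivity
  linarith

theorem norm_symbolOne_le (h : SymbolData κ Λ μ z x x₁ x₂) :
    ‖symbolOne μ z x x₁‖ ≤
      symbolConst κ Λ / 24 * ‖1 + μ * x₁‖ * ((‖z‖ + μ * ‖x‖)⁻¹) ^ 2 := by
  rw [symbolOne, norm_mul, norm_neg, norm_pow]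
  calc ‖1 + μ * x₁‖ * ‖(z + μ * x)⁻¹‖ ^ 2
      ≤ ‖1 + μ * x₁‖ * (κ ^ 4 * ((‖z‖ + μ * ‖x‖)⁻¹) ^ 2) := by
        gcongr
        exact h.sq_le
    _ = κ ^ 4 * ‖1 + μ * x₁‖ * ((‖z‖ + μ * ‖x‖)⁻¹) ^ 2 := by ring
    _ ≤ _ := by
      gcongr
      exact h.const_le.2.1

/-- The cruder companion of `norm_symbolOne_le`, with 1 + μx₁ absorbed: it gives decay in the
interior, whereas the unprimed form is the one integrated on the axis. -/
theorem norm_symbolOne_le' (h : SymbolData κ Λ μ z x x₁ x₂) :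
    ‖symbolOne μ z x x₁‖ ≤ symbolConst κ Λ * (‖z‖ * (‖z‖ + μ * ‖x‖))⁻¹ := by
  have hr := h.norm_pos
  have hS := h.size_pos
  have hκ := h.one_le_κ
  have hΛ := h.one_le_Λ
  have h1 : ‖z‖ * ‖symbolOne μ z x x₁‖ ≤ symbolConst κ Λ * (‖z‖ + μ * ‖x‖)⁻¹ := by
    rw [symbolOne, norm_mul, norm_neg, norm_pow, ← mul_assoc]
    calc ‖z‖ * ‖1 + μ * x₁‖ * ‖(z + μ * x)⁻¹‖ ^ 2
        ≤ Λ * (‖z‖ + μ * ‖x‖) * (κ ^ 4 * ((‖z‖ + μ * ‖x‖)⁻¹) ^ 2) :=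
          mul_le_mul h.norm_mul_norm_le h.sq_le (by positivity) (by positivity)
      _ = Λ * κ ^ 4 * (‖z‖ + μ * ‖x‖)⁻¹ := by field_simp
      _ ≤ _ := by
        gcongr
        linarith [h.const_le.2.2.1, h.const_pos]
  rw [mul_inv, mul_left_comm, inv_mul_eq_div, le_div_iff₀ hr, mul_comm]
  exact h1

theorem norm_mul_symbolTwo_le (h : SymbolData κ Λ μ z x x₁ x₂) :
    ‖z * symbolTwo μ z x x₁ x₂‖ ≤ symbolConst κ Λ / 24 *
      (μ * (‖z‖ * ‖x₂‖) + 2 * ‖1 + μ * x₁‖) * ((‖z‖ + μ * ‖x‖)⁻¹) ^ 2 := by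
  have hμ := h.μ_pos
  set σ := ((‖z‖ + μ * ‖x‖)⁻¹) ^ 2 with hσ
  have e : z * symbolTwo μ z x x₁ x₂ = -(μ * (z * x₂)) * (z + μ * x)⁻¹ ^ 2 +
      2 * (1 + μ * x₁) * (z * (1 + μ * x₁) * (z + μ * x)⁻¹ ^ 3) := by
    rw [symbolTwo]
    ring
  rw [e]
  refine (norm_add_le _ _).trans ?_
  rw [norm_mul, norm_neg, norm_mul, norm_mul, norm_pow, Complex.norm_real,
    Real.norm_of_nonneg hμ.le, norm_mul, norm_mul (2 : ℂ), Complex.norm_ofNat,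
    norm_mul (z * (1 + μ * x₁)), norm_mul z, norm_pow]
  calc μ * (‖z‖ * ‖x₂‖) * ‖(z + μ * x)⁻¹‖ ^ 2 +
        2 * ‖1 + μ * x₁‖ * (‖z‖ * ‖1 + μ * x₁‖ * ‖(z + μ * x)⁻¹‖ ^ 3)
      ≤ μ * (‖z‖ * ‖x₂‖) * (κ ^ 4 * σ) + 2 * ‖1 + μ * x₁‖ * (Λ * κ ^ 4 * σ) :=
        add_le_add (mul_le_mul_of_nonneg_left h.sq_le (by positivity))
          (mul_le_mul_of_nonneg_left h.mul_cube_le (by positivity))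
    _ ≤ μ * (‖z‖ * ‖x₂‖) * (symbolConst κ Λ / 24 * σ) +
        2 * ‖1 + μ * x₁‖ * (symbolConst κ Λ / 24 * σ) := by
        gcongr
        · exact h.const_le.2.1
        · exact h.const_le.2.2.1
    _ = _ := by ring

theorem norm_mul_symbolThree_le (h : SymbolData κ Λ μ z x x₁ x₂) (x₃ : ℂ) :
    ‖z ^ 2 * symbolThree μ z x x₁ x₂ x₃‖ ≤ symbolConst κ Λ / 24 *
      (μ * (‖z‖ ^ 2 * ‖x₃‖) + 6 * (μ * (‖z‖ * ‖x₂‖)) + 6 * ‖1 + μ * x₁‖) *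
        ((‖z‖ + μ * ‖x‖)⁻¹) ^ 2 := by
  have hμ := h.μ_pos
  set σ := ((‖z‖ + μ * ‖x‖)⁻¹) ^ 2 with hσ
  have e : z ^ 2 * symbolThree μ z x x₁ x₂ x₃ = -(μ * (z ^ 2 * x₃)) * (z + μ * x)⁻¹ ^ 2 +
      6 * (μ * (z * x₂)) * (z * (1 + μ * x₁) * (z + μ * x)⁻¹ ^ 3) -
      6 * (1 + μ * x₁) * ((z * (1 + μ * x₁)) ^ 2 * (z + μ * x)⁻¹ ^ 4) := by
    rw [symbolThree]
    ring
  have n1 : ‖-(μ * (z ^ 2 * x₃)) * (z + μ * x)⁻¹ ^ 2‖ ≤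
      μ * (‖z‖ ^ 2 * ‖x₃‖) * (symbolConst κ Λ / 24 * σ) := by
    rw [norm_mul, norm_neg, norm_mul, norm_mul, norm_pow, norm_pow, Complex.norm_real,
      Real.norm_of_nonneg hμ.le]
    gcongr
    refine h.sq_le.trans ?_
    gcongr
    exact h.const_le.2.1
  have n2 : ‖6 * (μ * (z * x₂)) * (z * (1 + μ * x₁) * (z + μ * x)⁻¹ ^ 3)‖ ≤
      6 * (μ * (‖z‖ * ‖x₂‖)) * (symbolConst κ Λ / 24 * σ) := by
    rw [norm_mul, norm_mul (6 : ℂ), Complex.norm_ofNat, norm_mul (μ : ℂ), norm_mul z,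
      Complex.norm_real, Real.norm_of_nonneg hμ.le, norm_mul (z * (1 + μ * x₁)), norm_mul z,
      norm_pow]
    refine mul_le_mul_of_nonneg_left (h.mul_cube_le.trans ?_) (by positivity)
    gcongr
    exact h.const_le.2.2.1
  have n3 : ‖6 * (1 + μ * x₁) * ((z * (1 + μ * x₁)) ^ 2 * (z + μ * x)⁻¹ ^ 4)‖ ≤
      6 * ‖1 + μ * x₁‖ * (symbolConst κ Λ / 24 * σ) := by
    rw [norm_mul, norm_mul (6 : ℂ), Complex.norm_ofNat, norm_mul ((z * (1 + μ * x₁)) ^ 2),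
      norm_pow, norm_pow, norm_mul z]
    refine mul_le_mul_of_nonneg_left (h.mul_fourth_le.trans ?_) (by positivity)
    rw [h.const_le.2.2.2]
  rw [e]
  refine (_root_.norm_sub_le _ _).trans ((add_le_add ((norm_add_le _ _).trans
    (add_le_add n1 n2)) n3).trans ?_)
  apply le_of_eq
  ring

end SymbolData

/-! ### Differentiating the symbols, and transferring the estimates to the solution. -/

section Derivatives

variable {𝕜 : Type*} [NontriviallyNormedField 𝕜] [NormedAlgebra 𝕜 ℂ]
  {Z X X₁ X₂ : 𝕜 → ℂ} {ζ x₁ x₂ x₃ : ℂ} {t : 𝕜} {μ : ℝ}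

/-- The curve parameter and its velocity ζ are left general so that one computation serves both z in
the half-plane (ζ = 1) and z = ik with k real (ζ = i). -/
theorem hasDerivAt_inv_add_mul (hZ : HasDerivAt Z ζ t) (hX : HasDerivAt X (ζ * x₁) t)
    (h0 : Z t + μ * X t ≠ 0) : HasDerivAt (fun t => (Z t + μ * X t)⁻¹)
      (ζ * symbolOne μ (Z t) (X t) x₁) t := by
  refine ((hZ.add (hX.const_mul (μ : ℂ))).inv h0).congr_deriv ?_
  simp only [symbolOne, Pi.add_apply]
  field_simp

theorem hasDerivAt_symbol (hZ : HasDerivAt Z ζ t) (hX : HasDerivAt X (ζ * x₁) t)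
    (h0 : Z t + μ * X t ≠ 0) : HasDerivAt (fun t => symbol μ (Z t) (X t))
      (ζ * symbolOne μ (Z t) (X t) x₁) t :=
  hasDerivAt_inv_add_mul hZ hX h0

theorem hasDerivAt_symbolOne (hZ : HasDerivAt Z ζ t) (hX : HasDerivAt X (ζ * X₁ t) t)
    (hX₁ : HasDerivAt X₁ (ζ * x₂) t) (h0 : Z t + μ * X t ≠ 0) :
    HasDerivAt (fun t => symbolOne μ (Z t) (X t) (X₁ t))
      (ζ * symbolTwo μ (Z t) (X t) (X₁ t) x₂) t := by
  have h1 := hasDerivAt_inv_add_mul hZ hX h0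
  refine (((hX₁.const_mul (μ : ℂ)).const_add 1).neg.mul (h1.pow 2)).congr_deriv ?_
  simp only [symbolOne, symbolTwo, Pi.pow_apply, Pi.neg_apply]
  push_cast
  ring

theorem hasDerivAt_symbolTwo (hZ : HasDerivAt Z ζ t) (hX : HasDerivAt X (ζ * X₁ t) t)
    (hX₁ : HasDerivAt X₁ (ζ * X₂ t) t) (hX₂ : HasDerivAt X₂ (ζ * x₃) t) (h0 : Z t + μ * X t ≠ 0) :
    HasDerivAt (fun t => symbolTwo μ (Z t) (X t) (X₁ t) (X₂ t))
      (ζ * symbolThree μ (Z t) (X t) (X₁ t) (X₂ t) x₃) t := by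
  have h1 := hasDerivAt_inv_add_mul hZ hX h0
  have h2 := (hX₁.const_mul (μ : ℂ)).const_add 1
  refine (((hX₂.const_mul (μ : ℂ)).neg.mul (h1.pow 2)).add
    (((h2.pow 2).const_mul 2).mul (h1.pow 3))).congr_deriv ?_
  simp only [symbolOne, symbolThree, Pi.pow_apply, Pi.neg_apply]
  push_cast
  ring

end Derivatives

variable {b : ℝ → ℝ} {c Λ μ : ℝ}

theorem KernelBounds.symbolData (hK : KernelBounds b c Λ) (hμ : 0 < μ) {z : ℂ} (hz : 0 < z.re) :
    SymbolData (1 + c⁻¹) Λ μ z (laplace b z) (deriv (laplace b) z)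
      (deriv (deriv (laplace b)) z) where
  one_le_κ := by
    have := inv_pos.2 hK.c_pos
    linarith
  one_le_Λ := hK.one_le
  μ_pos := hμ
  norm_pos := norm_pos_iff.2 (by rintro rfl; simp at hz)
  lower := by
    have h1 := hK.lower z hz μ hμ
    rw [mul_comm, ← le_div_iff₀ hK.c_pos, div_eq_inv_mul] at h1
    rw [add_mul, one_mul]
    linarith [norm_nonneg (z + μ * laplace b z)]
  one := hK.regular_one z hz
  two := hK.regular_two z hz

/-- On the axis d/dz = -i d/dk, so -i g' and -g'' take the place of the first two derivatives of b̂.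
-/
theorem KernelBounds.symbolData_boundary (hK : KernelBounds b c Λ) (hμ : 0 < μ) {k : ℝ}
    (hk : 0 < k) :
    SymbolData (1 + c⁻¹) Λ μ (k * Complex.I) (boundary b k) (-Complex.I * deriv (boundary b) k)
      (-deriv (deriv (boundary b)) k) where
  one_le_κ := by
    have := inv_pos.2 hK.c_pos
    linarith
  one_le_Λ := hK.one_le
  μ_pos := hμ
  norm_pos := by simpa using hk.ne'
  lower := by
    have h1 := hK.boundary_lower k hk μ hμ
    rw [mul_comm, ← le_div_iff₀ hK.c_pos, div_eq_inv_mul] at h1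
    have h2 : ‖(k : ℂ) * Complex.I‖ = k := by simp [abs_of_pos hk]
    rw [add_mul, one_mul, h2]
    linarith [norm_nonneg (k * Complex.I + μ * boundary b k)]
  one := by
    have h2 : ‖(k : ℂ) * Complex.I‖ = k := by simp [abs_of_pos hk]
    rw [h2, norm_mul, norm_neg, Complex.norm_I, one_mul]
    exact hK.boundary_one k hk
  two := by
    have h2 : ‖(k : ℂ) * Complex.I‖ = k := by simp [abs_of_pos hk]
    rw [h2, norm_neg]
    exact hK.boundary_two k hk

theorem KernelBounds.hasDerivAt_symbol (hK : KernelBounds b c Λ) (hμ : 0 < μ) {z : ℂ}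
    (hz : 0 < z.re) :
    HasDerivAt (fun z => symbol μ z (laplace b z))
      (symbolOne μ z (laplace b z) (deriv (laplace b) z)) z := by
  have := Volterra.hasDerivAt_symbol (μ := μ) (hasDerivAt_id' z) (x₁ := deriv (laplace b) z)
    (by rw [one_mul]; exact hK.growth.hasDerivAt_laplace hz) (hK.symbolData hμ hz).ne_zero
  rwa [one_mul] at this

theorem KernelBounds.hasDerivAt_symbolOne (hK : KernelBounds b c Λ) (hμ : 0 < μ) {z : ℂ}
    (hz : 0 < z.re) :
    HasDerivAt (fun z => symbolOne μ z (laplace b z) (deriv (laplace b) z))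
      (symbolTwo μ z (laplace b z) (deriv (laplace b) z) (deriv (deriv (laplace b)) z)) z := by
  have := Volterra.hasDerivAt_symbolOne (μ := μ) (hasDerivAt_id' z) (X₁ := deriv (laplace b))
    (x₂ := deriv (deriv (laplace b)) z)
    (by rw [one_mul]; exact hK.growth.hasDerivAt_laplace hz)
    (by rw [one_mul]; exact hK.growth.hasDerivAt_deriv_laplace hz) (hK.symbolData hμ hz).ne_zero
  rwa [one_mul] at this

/-- The interior bounds on a transform that are needed for the boundary variation estimates. -/
theorem KernelBounds.exists_interior_bound (hK : KernelBounds b c Λ) (hμ : 0 < μ) (K : ℝ)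
    (hK0 : 0 ≤ K) :
    ∃ M : ℝ, ∀ z : ℂ, 0 < z.re →
      (K * (‖z‖ + μ * ‖laplace b z‖)⁻¹ ≤ M * ‖z‖ ^ (-(1 / 2) : ℝ)) ∧
      (K * (μ * ‖laplace b z‖) * (‖z‖ + μ * ‖laplace b z‖)⁻¹ ≤ M * ‖z‖ ^ (-(1 / 2) : ℝ)) ∧
      (1 ≤ ‖z‖ → K * (‖z‖ * (‖z‖ + μ * ‖laplace b z‖))⁻¹ ≤ M / ‖z‖ ^ 2) ∧
      (1 ≤ ‖z‖ → K * (μ * ‖laplace b z‖) * ((‖z‖ + μ * ‖laplace b z‖)⁻¹) ^ 2 ≤ M / ‖z‖ ^ 2) := by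
  obtain ⟨M₀, hM₀, hM⟩ := hK.sqrt_bound μ hμ
  obtain ⟨N, hN, hNb⟩ := hK.bounded
  refine ⟨K * (M₀ + 1 + μ * N), fun z hz => ?_⟩
  have hr : 0 < ‖z‖ := (hK.symbolData hμ hz).norm_pos
  have hS := (hK.symbolData hμ hz).size_pos
  set r := ‖z‖ with hr_def
  set m := μ * ‖laplace b z‖ with hm_def
  have hm : 0 ≤ m := by positivity
  have hp : 0 < r ^ (-(1 / 2) : ℝ) := Real.rpow_pos_of_pos hr _
  have hμN : 0 ≤ μ * N := by positivity
  have hrS : r ≤ r + m := by linarith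
  have hm2 : 1 ≤ r → m ≤ μ * N := fun h1 => by
    have := hNb z hz h1
    rw [hm_def]
    gcongr
  have hS' : (r + m)⁻¹ ≤ r⁻¹ := inv_anti₀ hr hrS
  refine ⟨?_, ?_, ?_, ?_⟩
  · rw [mul_assoc]
    gcongr
    have := hM z hz
    rw [one_div] at this
    refine this.trans ?_
    gcongr
    linarith
  · rw [mul_assoc K m, mul_assoc K]
    refine mul_le_mul_of_nonneg_left ?_ hK0
    -- For |z| ≥ 1 boundedness of b̂ gives decay 1/r ≤ r^(-1/2); for |z| ≤ 1 the trivial bound 1 is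
    -- already below r^(-1/2).
    rcases le_total 1 r with h1 | h1
    · calc m * (r + m)⁻¹ ≤ μ * N * r⁻¹ := by
            gcongr
            exact hm2 h1
        _ ≤ μ * N * r ^ (-(1 / 2) : ℝ) := by
            gcongr
            rw [← Real.rpow_neg_one]
            exact Real.rpow_le_rpow_of_exponent_le h1 (by norm_num)
        _ ≤ _ := by
            gcongr
            linarith
    · calc m * (r + m)⁻¹ ≤ 1 := by
            rw [← div_eq_mul_inv, div_le_one hS]
            linarith
        _ ≤ r ^ (-(1 / 2) : ℝ) := Real.one_le_rpow_of_pos_of_le_one_of_nonpos hr h1 (by norm_num)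
        _ ≤ (M₀ + 1 + μ * N) * r ^ (-(1 / 2) : ℝ) := by
            refine le_mul_of_one_le_left hp.le ?_
            linarith
  · intro h1
    rw [mul_inv, mul_div_assoc]
    gcongr
    calc r⁻¹ * (r + m)⁻¹ ≤ r⁻¹ * r⁻¹ := by gcongr
      _ = 1 / r ^ 2 := by field_simp
      _ ≤ _ := by
        gcongr
        linarith
  · intro h1
    rw [mul_assoc, mul_div_assoc]
    gcongr
    calc m * (r + m)⁻¹ ^ 2 ≤ μ * N * r⁻¹ ^ 2 := by
          gcongr
          exact hm2 h1
      _ = μ * N / r ^ 2 := by field_simp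
      _ ≤ _ := by
        gcongr
        linarith

variable {s : ℝ → ℝ}

theorem SolutionTransforms.laplace_eq_symbol (hs : SolutionTransforms b μ s) {z : ℂ}
    (hz : 0 < z.re) :
    laplace s z = symbol μ z (laplace b z) := by
  rw [symbol]
  exact eq_inv_of_mul_eq_one_left (hs.laplace_mul z hz)

theorem SolutionTransforms.laplace_deriv_eq_symbol (hs : SolutionTransforms b μ s) {z : ℂ}
    (hz : 0 < z.re) :
    laplace (deriv s) z = z * symbol μ z (laplace b z) - 1 := by
  rw [hs.laplace_deriv z hz, ← hs.laplace_eq_symbol hz]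
  linear_combination -hs.laplace_mul z hz

theorem SolutionTransforms.laplace_deriv_deriv_eq_symbol (hs : SolutionTransforms b μ s) {z : ℂ}
    (hz : 0 < z.re) :
    laplace (deriv (deriv s)) z = z * (z * symbol μ z (laplace b z) - 1) := by
  rw [hs.laplace_deriv_deriv z hz, ← hs.laplace_eq_symbol hz]
  linear_combination -z * hs.laplace_mul z hz

theorem eventuallyEq_of_forall_re_pos {F G : ℂ → ℂ} (h : ∀ z : ℂ, 0 < z.re → F z = G z) {z : ℂ}
    (hz : 0 < z.re) : F =ᶠ[𝓝 z] G := by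
  filter_upwards [isOpen_re_pos.mem_nhds hz] with w hw using h w hw

theorem KernelBounds.laplace_mul_deriv_solution (hK : KernelBounds b c Λ) (hμ : 0 < μ)
    (hs : SolutionTransforms b μ s) {z : ℂ} (hz : 0 < z.re) :
    laplace (fun t => t * deriv s t) z = -(symbol μ z (laplace b z) +
      z * symbolOne μ z (laplace b z) (deriv (laplace b) z)) := by
  rw [laplace_id_mul hs.growth_deriv hz,
    (eventuallyEq_of_forall_re_pos (fun w hw => hs.laplace_deriv_eq_symbol hw) hz).deriv_eq]
  have := ((hasDerivAt_id' z).mul (hK.hasDerivAt_symbol hμ hz)).sub_const 1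
  rw [HasDerivAt.deriv (by exact this), one_mul]

theorem KernelBounds.laplace_mul_deriv_deriv_solution (hK : KernelBounds b c Λ) (hμ : 0 < μ)
    (hs : SolutionTransforms b μ s) {z : ℂ} (hz : 0 < z.re) :
    laplace (fun t => t * deriv (deriv s) t) z = 1 - 2 * z * symbol μ z (laplace b z) -
      z ^ 2 * symbolOne μ z (laplace b z) (deriv (laplace b) z) := by
  rw [laplace_id_mul hs.growth_deriv_deriv hz,
    (eventuallyEq_of_forall_re_pos
      (fun w hw => hs.laplace_deriv_deriv_eq_symbol hw) hz).deriv_eq]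
  have := (hasDerivAt_id' z).mul (((hasDerivAt_id' z).mul (hK.hasDerivAt_symbol hμ hz)).sub_const 1)
  rw [HasDerivAt.deriv (by exact this)]
  simp only [Pi.mul_apply]
  ring

/-- Both interior bounds for the four transforms entering the estimates of the solution. -/
theorem KernelBounds.exists_solution_interior_bound (hK : KernelBounds b c Λ) (hμ : 0 < μ)
    (hs : SolutionTransforms b μ s) :
    ∃ M : ℝ, ∀ U ∈ ({s, deriv s, (fun t => t * deriv s t), fun t => t * deriv (deriv s) t} :
        Set (ℝ → ℝ)),
      (∀ z : ℂ, 0 < z.re → ‖laplace U z‖ ≤ M * ‖z‖ ^ (-(1 / 2) : ℝ)) ∧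
      ∀ z : ℂ, 0 < z.re → 1 ≤ ‖z‖ → ‖deriv (laplace U) z‖ ≤ M / ‖z‖ ^ 2 := by
  have hK0 := (hK.symbolData hμ (z := 1) (by simp)).const_pos.le
  obtain ⟨M, hM⟩ := hK.exists_interior_bound hμ (symbolConst (1 + c⁻¹) Λ) hK0
  have hd0 : ∀ z : ℂ, 0 < z.re → deriv (laplace s) z =
      symbolOne μ z (laplace b z) (deriv (laplace b) z) := fun z hz => by
    rw [(eventuallyEq_of_forall_re_pos (fun w hw => hs.laplace_eq_symbol hw) hz).deriv_eq]
    exact (hK.hasDerivAt_symbol hμ hz).deriv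
  have hd1 : ∀ z : ℂ, 0 < z.re → deriv (laplace (deriv s)) z =
      symbol μ z (laplace b z) + z * symbolOne μ z (laplace b z) (deriv (laplace b) z) :=
    fun z hz => by
      rw [← neg_inj, ← laplace_id_mul hs.growth_deriv hz, hK.laplace_mul_deriv_solution hμ hs hz]
  have hd2 : ∀ z : ℂ, 0 < z.re → deriv (laplace fun t => t * deriv s t) z =
      -(2 * symbolOne μ z (laplace b z) (deriv (laplace b) z) + z * symbolTwo μ z (laplace b z)
        (deriv (laplace b) z) (deriv (deriv (laplace b)) z)) := fun z hz => by
    rw [(eventuallyEq_of_forall_re_pos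
      (fun w hw => hK.laplace_mul_deriv_solution hμ hs hw) hz).deriv_eq]
    have := ((hK.hasDerivAt_symbol hμ hz).add
      ((hasDerivAt_id' z).mul (hK.hasDerivAt_symbolOne hμ hz))).neg
    rw [HasDerivAt.deriv (by exact this)]
    ring
  have hd3 : ∀ z : ℂ, 0 < z.re → deriv (laplace fun t => t * deriv (deriv s) t) z =
      -(2 * symbol μ z (laplace b z) +
        4 * z * symbolOne μ z (laplace b z) (deriv (laplace b) z) + z ^ 2 * symbolTwo μ z
        (laplace b z) (deriv (laplace b) z) (deriv (deriv (laplace b)) z)) := fun z hz => by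
    rw [(eventuallyEq_of_forall_re_pos
      (fun w hw => hK.laplace_mul_deriv_deriv_solution hμ hs hw) hz).deriv_eq]
    have := ((((hasDerivAt_id' z).const_mul 2).mul (hK.hasDerivAt_symbol hμ hz)).const_sub 1).sub
      (((hasDerivAt_id' z).pow 2).mul (hK.hasDerivAt_symbolOne hμ hz))
    rw [HasDerivAt.deriv (by exact this)]
    simp only [Pi.pow_apply]
    push_cast
    ring
  refine ⟨M, ?_⟩
  rintro U (rfl | rfl | rfl | rfl)
  · refine ⟨fun z hz => ?_, fun z hz h1 => ?_⟩
    · rw [hs.laplace_eq_symbol hz]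
      exact (hK.symbolData hμ hz).norm_symbol_le.trans (hM z hz).1
    · rw [hd0 z hz]
      exact (hK.symbolData hμ hz).norm_symbolOne_le'.trans ((hM z hz).2.2.1 h1)
  · refine ⟨fun z hz => ?_, fun z hz h1 => ?_⟩
    · rw [hs.laplace_deriv_eq_symbol hz, norm_sub_rev]
      exact (hK.symbolData hμ hz).norm_one_sub_le.trans (hM z hz).2.1
    · rw [hd1 z hz]
      exact (hK.symbolData hμ hz).norm_add_mul_le.trans ((hM z hz).2.2.2 h1)
  · refine ⟨fun z hz => ?_, fun z hz h1 => ?_⟩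
    · rw [hK.laplace_mul_deriv_solution hμ hs hz, norm_neg]
      refine (hK.symbolData hμ hz).norm_add_mul_le.trans (le_trans ?_ (hM z hz).1)
      have hS := (hK.symbolData hμ hz).size_pos
      have h2 : μ * ‖laplace b z‖ * (‖z‖ + μ * ‖laplace b z‖)⁻¹ ≤ 1 := by
        rw [← div_eq_mul_inv, div_le_one hS]
        linarith [norm_nonneg z]
      calc symbolConst (1 + c⁻¹) Λ * (μ * ‖laplace b z‖) * ((‖z‖ + μ * ‖laplace b z‖)⁻¹) ^ 2
          = symbolConst (1 + c⁻¹) Λ * (μ * ‖laplace b z‖ * (‖z‖ + μ * ‖laplace b z‖)⁻¹) *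
            (‖z‖ + μ * ‖laplace b z‖)⁻¹ := by ring
        _ ≤ symbolConst (1 + c⁻¹) Λ * 1 * (‖z‖ + μ * ‖laplace b z‖)⁻¹ := by gcongr
        _ = _ := by rw [mul_one]
    · rw [hd2 z hz, norm_neg]
      exact (hK.symbolData hμ hz).norm_two_mul_add_le.trans ((hM z hz).2.2.1 h1)
  · refine ⟨fun z hz => ?_, fun z hz h1 => ?_⟩
    · rw [hK.laplace_mul_deriv_deriv_solution hμ hs hz]
      exact (hK.symbolData hμ hz).norm_transform_le.trans (hM z hz).2.1
    · rw [hd3 z hz, norm_neg]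
      exact (hK.symbolData hμ hz).norm_transform_deriv_le.trans ((hM z hz).2.2.2 h1)

/-! ### The fundamental theorem of calculus and the boundary symbols. -/

theorem enorm_integral_le_lintegral_Ioc {f : ℝ → ℂ} {x y : ℝ} (hxy : x ≤ y) :
    ‖∫ s in x..y, f s‖ₑ ≤ ∫⁻ s in Ioc x y, ‖f s‖ₑ := by
  rw [intervalIntegral.integral_of_le hxy]
  exact enorm_integral_le_lintegral_enorm _

theorem sub_eq_integral_deriv {φ φ' : ℝ → ℂ} (hd : ∀ k, 0 < k → HasDerivAt φ (φ' k) k)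
    (hc : ContinuousOn φ' (Ioi 0)) {x y : ℝ} (hx : 0 < x) (hxy : x ≤ y) :
    φ y - φ x = ∫ s in x..y, deriv φ s := by
  have hsub : uIcc x y ⊆ Ioi 0 := by
    rw [uIcc_of_le hxy]
    exact fun t ht => hx.trans_le ht.1
  rw [intervalIntegral.integral_deriv_eq_sub (fun t ht => (hd t (hsub ht)).differentiableAt)]
  refine ContinuousOn.intervalIntegrable ((hc.mono hsub).congr fun t ht => ?_)
  exact (hd t (hsub ht)).deriv

theorem enorm_sub_le_lintegral_deriv {φ φ' : ℝ → ℂ} (hd : ∀ k, 0 < k → HasDerivAt φ (φ' k) k)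
    (hc : ContinuousOn φ' (Ioi 0)) {x y : ℝ} (hx : 0 < x) (hxy : x ≤ y) :
    ‖φ y - φ x‖ₑ ≤ ∫⁻ s in Ioc x y, ‖deriv φ s‖ₑ := by
  rw [sub_eq_integral_deriv hd hc hx hxy]
  exact enorm_integral_le_lintegral_Ioc hxy

theorem absolutelyContinuousOnInterval_of_dist_le {X Y : Type*} [PseudoMetricSpace X]
    [PseudoMetricSpace Y] {f : ℝ → X} {g : ℝ → Y} {x y : ℝ}
    (hf : AbsolutelyContinuousOnInterval f x y) (h : ∀ s t, dist (g s) (g t) ≤ dist (f s) (f t)) :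
    AbsolutelyContinuousOnInterval g x y :=
  squeeze_zero (fun _ => Finset.sum_nonneg fun _ _ => dist_nonneg)
    (fun _ => Finset.sum_le_sum fun _ _ => h _ _) hf

theorem absolutelyContinuousOnInterval_re {φ : ℝ → ℂ} {x y : ℝ}
    (h : AbsolutelyContinuousOnInterval φ x y) :
    AbsolutelyContinuousOnInterval (fun t => (φ t).re) x y :=
  absolutelyContinuousOnInterval_of_dist_le h fun s t => by
    rw [Real.dist_eq, dist_eq_norm, ← Complex.sub_re]
    exact Complex.abs_re_le_norm _

theorem absolutelyContinuousOnInterval_im {φ : ℝ → ℂ} {x y : ℝ}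
    (h : AbsolutelyContinuousOnInterval φ x y) :
    AbsolutelyContinuousOnInterval (fun t => (φ t).im) x y :=
  absolutelyContinuousOnInterval_of_dist_le h fun s t => by
    rw [Real.dist_eq, dist_eq_norm, ← Complex.sub_im]
    exact Complex.abs_im_le_norm _

theorem ae_hasDerivAt_of_absolutelyContinuous {φ : ℝ → ℂ} {x y : ℝ}
    (h : AbsolutelyContinuousOnInterval φ x y) : ∀ᵐ t, t ∈ uIcc x y →
      HasDerivAt φ (((deriv (fun t => (φ t).re) t : ℝ) : ℂ) +
        ((deriv (fun t => (φ t).im) t : ℝ) : ℂ) * Complex.I) t := by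
  filter_upwards [(absolutelyContinuousOnInterval_re h).ae_differentiableAt,
    (absolutelyContinuousOnInterval_im h).ae_differentiableAt] with t h1 h2 ht
  have := (h1 ht).hasDerivAt.ofReal_comp.add ((h2 ht).hasDerivAt.ofReal_comp.mul_const Complex.I)
  refine this.congr_of_eventuallyEq (.of_forall fun s => ?_)
  exact (Complex.re_add_im _).symm

/-- The fundamental theorem of calculus for absolutely continuous complex functions. -/
theorem integral_deriv_of_absolutelyContinuous {φ : ℝ → ℂ} {x y : ℝ}
    (h : AbsolutelyContinuousOnInterval φ x y) : ∫ t in x..y, deriv φ t = φ y - φ x := by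
  have h1 := absolutelyContinuousOnInterval_re h
  have h2 := absolutelyContinuousOnInterval_im h
  have i1 := h1.intervalIntegrable_deriv
  have i2 := h2.intervalIntegrable_deriv
  have e : (∫ t in x..y, deriv φ t) = ∫ t in x..y, (((deriv (fun t => (φ t).re) t : ℝ) : ℂ) +
        ((deriv (fun t => (φ t).im) t : ℝ) : ℂ) * Complex.I) := by
    refine intervalIntegral.integral_congr_ae ?_
    filter_upwards [ae_hasDerivAt_of_absolutelyContinuous h] with t ht htm
    exact (ht (uIoc_subset_uIcc htm)).deriv
  have j1 : IntervalIntegrable (fun t => ((deriv (fun t => (φ t).re) t : ℝ) : ℂ)) volume x y :=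
    ⟨i1.1.ofReal, i1.2.ofReal⟩
  have j2 : IntervalIntegrable (fun t => ((deriv (fun t => (φ t).im) t : ℝ) : ℂ)) volume x y :=
    ⟨i2.1.ofReal, i2.2.ofReal⟩
  rw [e, intervalIntegral.integral_add j1 (j2.mul_const _), intervalIntegral.integral_mul_const,
    intervalIntegral.integral_ofReal, intervalIntegral.integral_ofReal, h1.integral_deriv_eq_sub,
    h2.integral_deriv_eq_sub]
  apply Complex.ext <;> simp

/-- The boundary values of the resolvent symbol. -/
def boundarySymbol (b : ℝ → ℝ) (μ k : ℝ) : ℂ := symbol μ (k * Complex.I) (boundary b k)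

/-- The boundary values of the derivative of the resolvent symbol. -/
def boundarySymbolOne (b : ℝ → ℝ) (μ k : ℝ) : ℂ :=
  symbolOne μ (k * Complex.I) (boundary b k) (-Complex.I * deriv (boundary b) k)

/-- The boundary values of the second derivative of the resolvent symbol. -/
def boundarySymbolTwo (b : ℝ → ℝ) (μ k : ℝ) : ℂ :=
  symbolTwo μ (k * Complex.I) (boundary b k) (-Complex.I * deriv (boundary b) k)
    (-deriv (deriv (boundary b)) k)

/-- The boundary values of the third derivative of the resolvent symbol. -/
def boundarySymbolThree (b : ℝ → ℝ) (μ k : ℝ) : ℂ :=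
  symbolThree μ (k * Complex.I) (boundary b k) (-Complex.I * deriv (boundary b) k)
    (-deriv (deriv (boundary b)) k) (Complex.I * deriv (deriv (deriv (boundary b))) k)

end Volterra

/-! ### Regularity and limits of the boundary symbols. -/

namespace Volterra

variable {b : ℝ → ℝ} {c Λ μ ρ : ℝ}

theorem hasDerivAt_mul_I (k : ℝ) :
    HasDerivAt (fun k : ℝ => (k : ℂ) * Complex.I) Complex.I k :=
  ((HasDerivAt.ofReal_comp (hasDerivAt_id' k)).mul_const Complex.I).congr_deriv (by simp)

theorem hasDerivAt_boundarySymbol (hb : KernelAssumption b ρ) (hK : KernelBounds b c Λ)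
    (hμ : 0 < μ) {k : ℝ} (hk : 0 < k) :
    HasDerivAt (boundarySymbol b μ) (Complex.I * boundarySymbolOne b μ k) k := by
  refine hasDerivAt_symbol (hasDerivAt_mul_I k) ?_ (hK.symbolData_boundary hμ hk).ne_zero
  refine (hb.differentiableAt_boundary hk).congr_deriv ?_
  linear_combination deriv (boundary b) k * Complex.I_mul_I

theorem hasDerivAt_boundarySymbolOne (hb : KernelAssumption b ρ) (hK : KernelBounds b c Λ)
    (hμ : 0 < μ) {k : ℝ} (hk : 0 < k) :
    HasDerivAt (boundarySymbolOne b μ) (Complex.I * boundarySymbolTwo b μ k) k := by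
  refine hasDerivAt_symbolOne (X₁ := fun k => -Complex.I * deriv (boundary b) k)
    (hasDerivAt_mul_I k) ?_ ?_ (hK.symbolData_boundary hμ hk).ne_zero
  · refine (hb.differentiableAt_boundary hk).congr_deriv ?_
    linear_combination deriv (boundary b) k * Complex.I_mul_I
  · refine ((hb.differentiableAt_deriv_boundary hk).const_mul (-Complex.I)).congr_deriv ?_
    ring

theorem hasDerivAt_boundarySymbolTwo (hb : KernelAssumption b ρ) (hK : KernelBounds b c Λ)
    (hμ : 0 < μ) {k : ℝ} (hk : 0 < k)
    (h3 : DifferentiableAt ℝ (deriv (deriv (boundary b))) k) :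
    HasDerivAt (boundarySymbolTwo b μ) (Complex.I * boundarySymbolThree b μ k) k := by
  refine hasDerivAt_symbolTwo (X₁ := fun k => -Complex.I * deriv (boundary b) k)
    (X₂ := fun k => -deriv (deriv (boundary b)) k)
    (hasDerivAt_mul_I k) ?_ ?_ ?_ (hK.symbolData_boundary hμ hk).ne_zero
  · refine (hb.differentiableAt_boundary hk).congr_deriv ?_
    linear_combination deriv (boundary b) k * Complex.I_mul_I
  · refine ((hb.differentiableAt_deriv_boundary hk).const_mul (-Complex.I)).congr_deriv ?_
    ring
  · refine h3.hasDerivAt.neg.congr_deriv ?_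
    linear_combination -deriv (deriv (deriv (boundary b))) k * Complex.I_mul_I

theorem contDiffOn_inv_boundary (hb : KernelAssumption b ρ) (hK : KernelBounds b c Λ)
    (hμ : 0 < μ) :
    ContDiffOn ℝ 1 (fun k : ℝ => (k * Complex.I + μ * boundary b k)⁻¹) (Ioi 0) := by
  have h1 : ContDiffOn ℝ 1 (boundary b) (Ioi 0) := hb.contDiffOn_boundary.of_le (by norm_num)
  have h2 : ContDiffOn ℝ 1 (fun k : ℝ => (k : ℂ)) (Ioi 0) := Complex.ofRealCLM.contDiff.contDiffOn
  exact ((h2.mul contDiffOn_const).add (contDiffOn_const.mul h1)).inv fun k hk =>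
    (hK.symbolData_boundary hμ hk).ne_zero

theorem continuousOn_boundarySymbol (hb : KernelAssumption b ρ) (hK : KernelBounds b c Λ)
    (hμ : 0 < μ) : ContinuousOn (boundarySymbol b μ) (Ioi 0) := fun _ hk =>
  (hasDerivAt_boundarySymbol hb hK hμ hk).continuousAt.continuousWithinAt

theorem continuousOn_boundarySymbolOne (hb : KernelAssumption b ρ) (hK : KernelBounds b c Λ)
    (hμ : 0 < μ) : ContinuousOn (boundarySymbolOne b μ) (Ioi 0) := fun _ hk =>
  (hasDerivAt_boundarySymbolOne hb hK hμ hk).continuousAt.continuousWithinAt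

theorem continuousOn_boundarySymbolTwo (hb : KernelAssumption b ρ) (hK : KernelBounds b c Λ)
    (hμ : 0 < μ) : ContinuousOn (boundarySymbolTwo b μ) (Ioi 0) := by
  have h1 := (contDiffOn_inv_boundary hb hK hμ).continuousOn
  have h2 := hb.contDiffOn_deriv_boundary.continuousOn
  have h3 : ContinuousOn (deriv (deriv (boundary b))) (Ioi 0) :=
    hb.contDiffOn_deriv_boundary.continuousOn_deriv_of_isOpen isOpen_Ioi le_rfl
  unfold boundarySymbolTwo symbolTwo
  fun_prop

/-- The boundary values of the transform of `t s̈`. -/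
def boundaryTransform (b : ℝ → ℝ) (μ k : ℝ) : ℂ :=
  1 - 2 * (k * Complex.I) * boundarySymbol b μ k - (k * Complex.I) ^ 2 * boundarySymbolOne b μ k

/-- The derivative of the boundary values of the transform of `t s̈`. -/
def boundaryTransformDeriv (b : ℝ → ℝ) (μ k : ℝ) : ℂ :=
  -Complex.I * (2 * boundarySymbol b μ k + 4 * (k * Complex.I) * boundarySymbolOne b μ k +
    (k * Complex.I) ^ 2 * boundarySymbolTwo b μ k)

theorem hasDerivAt_boundaryTransform (hb : KernelAssumption b ρ) (hK : KernelBounds b c Λ)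
    (hμ : 0 < μ) {k : ℝ} (hk : 0 < k) :
    HasDerivAt (boundaryTransform b μ) (boundaryTransformDeriv b μ k) k := by
  have h0 := hasDerivAt_mul_I k
  have := (((h0.const_mul 2).mul (hasDerivAt_boundarySymbol hb hK hμ hk)).const_sub 1).sub
    ((h0.pow 2).mul (hasDerivAt_boundarySymbolOne hb hK hμ hk))
  refine this.congr_deriv ?_
  simp only [boundaryTransformDeriv, Pi.pow_apply]
  push_cast
  ring

theorem hasDerivAt_boundaryTransformDeriv (hb : KernelAssumption b ρ) (hK : KernelBounds b c Λ)
    (hμ : 0 < μ) {k : ℝ} (hk : 0 < k)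
    (h3 : DifferentiableAt ℝ (deriv (deriv (boundary b))) k) :
    HasDerivAt (boundaryTransformDeriv b μ) (6 * boundarySymbolOne b μ k +
      6 * (k * Complex.I * boundarySymbolTwo b μ k) +
      (k * Complex.I) ^ 2 * boundarySymbolThree b μ k) k := by
  have h0 := hasDerivAt_mul_I k
  have := ((((hasDerivAt_boundarySymbol hb hK hμ hk).const_mul 2).add
    ((h0.const_mul 4).mul (hasDerivAt_boundarySymbolOne hb hK hμ hk))).add
    ((h0.pow 2).mul (hasDerivAt_boundarySymbolTwo hb hK hμ hk h3))).const_mul (-Complex.I)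
  refine this.congr_deriv ?_
  simp only [Pi.pow_apply]
  push_cast
  linear_combination -(6 * boundarySymbolOne b μ k +
      6 * (k * Complex.I * boundarySymbolTwo b μ k) +
      (k * Complex.I) ^ 2 * boundarySymbolThree b μ k) * Complex.I_mul_I

theorem continuousOn_boundaryTransformDeriv (hb : KernelAssumption b ρ) (hK : KernelBounds b c Λ)
    (hμ : 0 < μ) : ContinuousOn (boundaryTransformDeriv b μ) (Ioi 0) := by
  have h0 := continuousOn_boundarySymbol hb hK hμ
  have h1 := continuousOn_boundarySymbolOne hb hK hμ
  have h2 := continuousOn_boundarySymbolTwo hb hK hμ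
  unfold boundaryTransformDeriv
  fun_prop

/-- The function is affine in g'' with coefficients built from g, g' and the inverse of ik + μg,
which are C¹. Only g'' itself is merely absolutely continuous. -/
theorem absolutelyContinuous_boundaryTransformDeriv (hb : KernelAssumption b ρ)
    (hK : KernelBounds b c Λ) (hμ : 0 < μ) {x y : ℝ} (hx : 0 < x) (hxy : x ≤ y) :
    AbsolutelyContinuousOnInterval (boundaryTransformDeriv b μ) x y := by
  have hsub : uIcc x y ⊆ Ioi 0 := by
    rw [uIcc_of_le hxy]
    exact fun t ht => hx.trans_le ht.1
  set P : ℝ → ℂ := fun k => (k * Complex.I + μ * boundary b k)⁻¹ with hP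
  have h1 : ContDiffOn ℝ 1 P (Ioi 0) := contDiffOn_inv_boundary hb hK hμ
  have h2 := hb.contDiffOn_deriv_boundary
  have h3 : ContDiffOn ℝ 1 (fun k : ℝ => (k : ℂ)) (Ioi 0) := Complex.ofRealCLM.contDiff.contDiffOn
  set α : ℝ → ℂ := fun k => -Complex.I * (2 * P k +
    4 * (k * Complex.I) * (-(1 + μ * (-Complex.I * deriv (boundary b) k)) * P k ^ 2) +
    (k * Complex.I) ^ 2 * (2 * (1 + μ * (-Complex.I * deriv (boundary b) k)) ^ 2 * P k ^ 3)) with hα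
  set γ : ℝ → ℂ := fun k => -Complex.I * ((k * Complex.I) ^ 2 * (μ * P k ^ 2)) with hγ
  have a1 : ContDiffOn ℝ 1 α (uIcc x y) := by
    refine ContDiffOn.mono ?_ hsub
    rw [hα]
    fun_prop
  have a2 : ContDiffOn ℝ 1 γ (uIcc x y) := by
    refine ContDiffOn.mono ?_ hsub
    rw [hγ]
    fun_prop
  have a3 : AbsolutelyContinuousOnInterval (deriv (deriv (boundary b))) x y := by
    have := hb.absCont_boundary x y hx hxy
    rwa [iteratedDeriv_succ, iteratedDeriv_one] at this
  refine absolutelyContinuousOnInterval_congr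
    (a1.absolutelyContinuousOnInterval.add (a2.absolutelyContinuousOnInterval.smul a3))
    fun k _ => ?_
  simp only [Pi.add_apply, Pi.mul_apply, smul_eq_mul, hα, hγ, hP, boundaryTransformDeriv,
    boundarySymbol, boundarySymbolOne, boundarySymbolTwo, symbol, symbolOne, symbolTwo]
  ring

theorem tendsto_add_mul_I (k : ℝ) :
    Tendsto (fun ε : ℝ => (ε : ℂ) + k * Complex.I) (𝓝[>] 0) (𝓝 (k * Complex.I)) := by
  have hc : Continuous fun ε : ℝ => (ε : ℂ) + k * Complex.I := by fun_prop
  have := (hc.tendsto 0).mono_left (nhdsWithin_le_nhds (s := Ioi (0 : ℝ)))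
  simpa using this

theorem tendsto_symbol_boundarySymbol (hK : KernelBounds b c Λ) (hμ : 0 < μ)
    {k : ℝ} (hk : 0 < k) :
    Tendsto (fun ε : ℝ => symbol μ (ε + k * Complex.I) (laplace b (ε + k * Complex.I)))
      (𝓝[>] 0) (𝓝 (boundarySymbol b μ k)) :=
  (((tendsto_add_mul_I k).add ((hK.tendsto_zero k hk).const_mul (μ : ℂ))).inv₀
    (hK.symbolData_boundary hμ hk).ne_zero)

theorem tendsto_symbolOne_boundarySymbolOne (hK : KernelBounds b c Λ) (hμ : 0 < μ)
    {k : ℝ} (hk : 0 < k) :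
    Tendsto (fun ε : ℝ => symbolOne μ (ε + k * Complex.I) (laplace b (ε + k * Complex.I))
      (deriv (laplace b) (ε + k * Complex.I))) (𝓝[>] 0) (𝓝 (boundarySymbolOne b μ k)) :=
  (((hK.tendsto_one k hk).const_mul (μ : ℂ)).const_add 1).neg.mul
    ((tendsto_symbol_boundarySymbol hK hμ hk).pow 2)

end Volterra

/-! ### Integrating the pointwise bounds against the growth conditions. -/

namespace Volterra

variable {b : ℝ → ℝ} {c Λ μ ρ : ℝ}

theorem lintegral_deriv_le_of_le_first {C K : ℝ} (hμ : 0 < μ) (hK : 0 ≤ K)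
    (hC : (∫⁻ k in Ioi (0 : ℝ), ENNReal.ofReal
      (‖boundary b k‖ / (|k| + μ * ‖boundary b k‖) ^ 2)) ≤ ENNReal.ofReal (C / μ)) {φ : ℝ → ℂ}
    (hφ : ∀ k, 0 < k → ‖deriv φ k‖ ≤
      K * (μ * ‖boundary b k‖) * ((k + μ * ‖boundary b k‖)⁻¹) ^ 2) :
    ∫⁻ k in Ioi 0, ‖deriv φ k‖ₑ ≤ ENNReal.ofReal (K * C) := by
  calc ∫⁻ k in Ioi 0, ‖deriv φ k‖ₑ
      ≤ ∫⁻ k in Ioi (0 : ℝ), ENNReal.ofReal (K * μ) * ENNReal.ofReal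
        (‖boundary b k‖ / (|k| + μ * ‖boundary b k‖) ^ 2) := by
        refine setLIntegral_mono' measurableSet_Ioi fun k hk => ?_
        have hk' : (0 : ℝ) < k := hk
        rw [← ENNReal.ofReal_mul (by positivity), ← ofReal_norm]
        refine ENNReal.ofReal_le_ofReal ((hφ k hk).trans_eq ?_)
        rw [abs_of_pos hk', inv_pow]
        ring
    _ = ENNReal.ofReal (K * μ) * ∫⁻ k in Ioi (0 : ℝ), ENNReal.ofReal
        (‖boundary b k‖ / (|k| + μ * ‖boundary b k‖) ^ 2) :=
        lintegral_const_mul' _ _ ENNReal.ofReal_ne_top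
    _ ≤ ENNReal.ofReal (K * μ) * ENNReal.ofReal (C / μ) := by gcongr
    _ = _ := by
        rw [← ENNReal.ofReal_mul (by positivity)]
        congr 1
        field_simp

/-- Factoring out μ turns 1 + μ|g'| into |g'| + 1/μ, the form in the growth condition; this μ
against μ^(-1-1/ρ) leaves μ^(-1/ρ). -/
theorem lintegral_deriv_le_of_le_second {C K : ℝ} (hμ : 0 < μ) (hK : 0 ≤ K)
    (hC : (∫⁻ k in Ioi (0 : ℝ), ENNReal.ofReal
        ((‖(k : ℂ) ^ 2 * iteratedDeriv 3 (boundary b) k‖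
            + ‖(k : ℂ) * iteratedDeriv 2 (boundary b) k‖
            + ‖deriv (boundary b) k‖ + 1 / μ) / (|k| + μ * ‖boundary b k‖) ^ 2))
      ≤ ENNReal.ofReal (C / μ ^ (1 + 1 / ρ))) {φ : ℝ → ℂ}
    (hφ : ∀ᵐ k, 0 < k → ‖deriv φ k‖ ≤
      K * (μ * (k ^ 2 * ‖deriv (deriv (deriv (boundary b))) k‖) +
        μ * (k * ‖deriv (deriv (boundary b)) k‖) + (1 + μ * ‖deriv (boundary b) k‖)) *
        ((k + μ * ‖boundary b k‖)⁻¹) ^ 2) :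
    ∫⁻ k in Ioi 0, ‖deriv φ k‖ₑ ≤ ENNReal.ofReal (K * C * μ ^ (-(1 / ρ))) := by
  set F : ℝ → ℝ := fun k => (‖(k : ℂ) ^ 2 * iteratedDeriv 3 (boundary b) k‖
            + ‖(k : ℂ) * iteratedDeriv 2 (boundary b) k‖
            + ‖deriv (boundary b) k‖ + 1 / μ) / (|k| + μ * ‖boundary b k‖) ^ 2 with hF
  calc ∫⁻ k in Ioi 0, ‖deriv φ k‖ₑ
      ≤ ∫⁻ k in Ioi (0 : ℝ), ENNReal.ofReal (K * μ) * ENNReal.ofReal (F k) := by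
        refine lintegral_mono_ae ((ae_restrict_iff' measurableSet_Ioi).2 ?_)
        filter_upwards [hφ] with k h1 hk
        have hk' : (0 : ℝ) < k := hk
        rw [← ENNReal.ofReal_mul (by positivity), ← ofReal_norm]
        refine ENNReal.ofReal_le_ofReal ((h1 hk).trans_eq ?_)
        have e3 : iteratedDeriv 3 (boundary b) = deriv (deriv (deriv (boundary b))) := by
          rw [iteratedDeriv_succ, iteratedDeriv_succ, iteratedDeriv_one]
        have e2 : iteratedDeriv 2 (boundary b) = deriv (deriv (boundary b)) := by
          rw [iteratedDeriv_succ, iteratedDeriv_one]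
        simp only [hF]
        rw [e3, e2, norm_mul, norm_mul, norm_pow, Complex.norm_real, Real.norm_eq_abs,
          abs_of_pos hk', inv_pow]
        field_simp
        ring
    _ = ENNReal.ofReal (K * μ) * ∫⁻ k in Ioi (0 : ℝ), ENNReal.ofReal (F k) :=
        lintegral_const_mul' _ _ ENNReal.ofReal_ne_top
    _ ≤ ENNReal.ofReal (K * μ) * ENNReal.ofReal (C / μ ^ (1 + 1 / ρ)) := by gcongr
    _ = _ := by
        rw [← ENNReal.ofReal_mul (by positivity)]
        congr 1
        rw [Real.rpow_add hμ, Real.rpow_one, Real.rpow_neg hμ.le]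
        field_simp

/-- Exhaustion of (0, ∞) by the intervals [1/(n + 1), n + 1], on each of which g'' is absolutely
continuous. -/
theorem KernelAssumption.ae_differentiableAt_deriv_deriv_boundary (hb : KernelAssumption b ρ) :
    ∀ᵐ k : ℝ, 0 < k → DifferentiableAt ℝ (deriv (deriv (boundary b))) k := by
  have h1 : ∀ᵐ k : ℝ, ∀ n : ℕ, k ∈ uIcc (1 / ((n : ℝ) + 1)) ((n : ℝ) + 1) →
      DifferentiableAt ℝ (deriv (deriv (boundary b))) k := by
    refine ae_all_iff.2 fun n => ?_
    have hn : (0 : ℝ) < (n : ℝ) + 1 := by positivity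
    have h2 := hb.absCont_boundary (1 / ((n : ℝ) + 1)) ((n : ℝ) + 1) (by positivity) (by
      rw [div_le_iff₀ hn]
      nlinarith [n.cast_nonneg (α := ℝ)])
    rw [iteratedDeriv_succ, iteratedDeriv_one] at h2
    filter_upwards [ae_hasDerivAt_of_absolutelyContinuous h2] with k hk hkm
    exact (hk hkm).differentiableAt
  filter_upwards [h1] with k hk hk0
  obtain ⟨n, hn⟩ := exists_nat_ge (max k (1 / k))
  refine hk n (Icc_subset_uIcc ⟨?_, ?_⟩)
  · rw [div_le_iff₀ (by positivity)]
    have h2 := (le_max_right _ _).trans hn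
    rw [div_le_iff₀ hk0] at h2
    linarith
  · have h2 := (le_max_left _ _).trans hn
    linarith

theorem norm_ofReal_mul_I {k : ℝ} (hk : 0 < k) : ‖(k : ℂ) * Complex.I‖ = k := by
  simp [abs_of_pos hk]

theorem norm_one_add_le {k : ℝ} (hμ : 0 < μ) :
    ‖1 + (μ : ℂ) * (-Complex.I * deriv (boundary b) k)‖ ≤ 1 + μ * ‖deriv (boundary b) k‖ := by
  refine (norm_add_le _ _).trans ?_
  rw [norm_one, norm_mul, norm_mul, norm_neg, Complex.norm_I, one_mul, Complex.norm_real,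
    Real.norm_of_nonneg hμ.le]

/-- The common majorant of the second kind for the derivatives of the boundary symbols. -/
theorem KernelBounds.norm_boundarySymbol_combination_le (hK : KernelBounds b c Λ) (hμ : 0 < μ)
    {k : ℝ} (hk : 0 < k) :
    6 * ‖boundarySymbolOne b μ k‖ + 6 * ‖k * Complex.I * boundarySymbolTwo b μ k‖ +
      ‖(k * Complex.I) ^ 2 * boundarySymbolThree b μ k‖ ≤ symbolConst (1 + c⁻¹) Λ *
        (μ * (k ^ 2 * ‖deriv (deriv (deriv (boundary b))) k‖) +
          μ * (k * ‖deriv (deriv (boundary b)) k‖) + (1 + μ * ‖deriv (boundary b) k‖)) *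
        ((k + μ * ‖boundary b k‖)⁻¹) ^ 2 := by
  have h := hK.symbolData_boundary hμ hk
  have h1 := h.norm_symbolOne_le
  have h2 := h.norm_mul_symbolTwo_le
  have h3 := h.norm_mul_symbolThree_le (Complex.I * deriv (deriv (deriv (boundary b))) k)
  have h4 := norm_one_add_le (b := b) (k := k) hμ
  rw [norm_ofReal_mul_I hk] at h1 h2 h3
  rw [norm_neg] at h2 h3
  rw [norm_mul Complex.I, Complex.norm_I, one_mul] at h3
  have hc := h.const_pos
  set K := symbolConst (1 + c⁻¹) Λ
  set σ := ((k + μ * ‖boundary b k‖)⁻¹) ^ 2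
  have hσ : 0 ≤ σ := sq_nonneg _
  set n := ‖1 + (μ : ℂ) * (-Complex.I * deriv (boundary b) k)‖
  set d2 := μ * (k * ‖deriv (deriv (boundary b)) k‖)
  set d3 := μ * (k ^ 2 * ‖deriv (deriv (deriv (boundary b))) k‖)
  have hd2 : 0 ≤ d2 := by positivity
  have hd3 : 0 ≤ d3 := by positivity
  calc 6 * ‖boundarySymbolOne b μ k‖ + 6 * ‖k * Complex.I * boundarySymbolTwo b μ k‖ +
        ‖(k * Complex.I) ^ 2 * boundarySymbolThree b μ k‖
      ≤ 6 * (K / 24 * n * σ) + 6 * (K / 24 * (d2 + 2 * n) * σ) +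
        K / 24 * (d3 + 6 * d2 + 6 * n) * σ :=
        add_le_add (add_le_add (mul_le_mul_of_nonneg_left h1 (by norm_num))
          (mul_le_mul_of_nonneg_left h2 (by norm_num))) h3
    -- The 24 in `symbolConst` is chosen for this sum: the coefficient of n is (6 + 12 + 6)/24 = 1.
    _ = K * (d3 / 24 + d2 / 2 + n) * σ := by ring
    _ ≤ _ := by
      gcongr
      · linarith
      · linarith

theorem KernelBounds.inv_boundary_le (hK : KernelBounds b c Λ) (hμ : 0 < μ) :
    ∃ M : ℝ, 0 ≤ M ∧ ∀ k : ℝ, 0 < k →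
      (k + μ * ‖boundary b k‖)⁻¹ ≤ M * k ^ (-(1 / 2) : ℝ) := by
  obtain ⟨M, hM0, hM⟩ := hK.sqrt_bound μ hμ
  refine ⟨M, hM0, fun k hk => ?_⟩
  have hn := tendsto_norm_add_mul_I hk
  have hS : 0 < k + μ * ‖boundary b k‖ := by positivity
  have h1 := (hn.add ((hK.tendsto_zero k hk).norm.const_mul μ)).inv₀ hS.ne'
  have h2 := (hn.rpow_const (p := (-(1 / 2) : ℝ)) (Or.inl hk.ne')).const_mul M
  refine le_of_tendsto_of_tendsto h1 h2 ?_
  filter_upwards [self_mem_nhdsWithin] with ε hε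
  have := hM (ε + k * Complex.I) (by simpa using hε)
  rwa [one_div] at this

/-- Existence and reality of this limit exclude a jump of the symmetric extension at the origin. The
terms other than 1 are O(k/S), hence O(k^(1/2)) by the square root bound. -/
theorem KernelBounds.tendsto_boundaryTransform (hK : KernelBounds b c Λ) (hμ : 0 < μ) :
    Tendsto (boundaryTransform b μ) (𝓝[>] 0) (𝓝 ((1 : ℝ) : ℂ)) := by
  obtain ⟨M, hM0, hM⟩ := hK.inv_boundary_le hμ
  set K := symbolConst (1 + c⁻¹) Λ
  rw [tendsto_iff_norm_sub_tendsto_zero]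
  have hlim : Tendsto (fun k : ℝ => 3 * K * M * k ^ (1 / 2 : ℝ)) (𝓝[>] 0) (𝓝 0) := by
    have h1 : Tendsto (fun k : ℝ => k ^ (1 / 2 : ℝ)) (𝓝[>] 0) (𝓝 0) := by
      have := (Real.continuousAt_rpow_const 0 (1 / 2 : ℝ) (Or.inr (by norm_num))).tendsto
      rw [Real.zero_rpow (by norm_num)] at this
      exact this.mono_left nhdsWithin_le_nhds
    simpa using h1.const_mul (3 * K * M)
  refine squeeze_zero' (.of_forall fun _ => norm_nonneg _) ?_ hlim
  filter_upwards [self_mem_nhdsWithin] with k hk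
  have hk' : (0 : ℝ) < k := hk
  have h := hK.symbolData_boundary hμ hk'
  have hc : 0 < K := h.const_pos
  have h0 : ‖boundarySymbol b μ k‖ ≤ K * (k + μ * ‖boundary b k‖)⁻¹ := by
    have := h.norm_symbol_le
    rwa [norm_ofReal_mul_I hk'] at this
  have h1 : k * ‖boundarySymbolOne b μ k‖ ≤ K * (k + μ * ‖boundary b k‖)⁻¹ := by
    have := h.norm_symbolOne_le'
    rw [norm_ofReal_mul_I hk', mul_inv, mul_left_comm, inv_mul_eq_div, le_div_iff₀ hk',
      mul_comm] at this
    exact this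
  have e : boundaryTransform b μ k - ((1 : ℝ) : ℂ) = -(2 * (k * Complex.I) * boundarySymbol b μ k +
      (k * Complex.I) ^ 2 * boundarySymbolOne b μ k) := by
    rw [boundaryTransform]
    push_cast
    ring
  rw [e, norm_neg]
  refine (norm_add_le _ _).trans ?_
  rw [norm_mul, norm_mul (2 : ℂ), norm_mul ((k * Complex.I) ^ 2), norm_pow, norm_ofReal_mul_I hk',
    Complex.norm_ofNat]
  calc 2 * k * ‖boundarySymbol b μ k‖ + k ^ 2 * ‖boundarySymbolOne b μ k‖
      = k * (2 * ‖boundarySymbol b μ k‖ + k * ‖boundarySymbolOne b μ k‖) := by ring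
    _ ≤ k * (2 * (K * (k + μ * ‖boundary b k‖)⁻¹) + K * (k + μ * ‖boundary b k‖)⁻¹) := by gcongr
    _ = 3 * K * (k * (k + μ * ‖boundary b k‖)⁻¹) := by ring
    _ ≤ 3 * K * (k * (M * k ^ (-(1 / 2) : ℝ))) := by
        gcongr
        exact hM k hk'
    _ = 3 * K * M * (k ^ (1 : ℝ) * k ^ (-(1 / 2) : ℝ)) := by
        rw [Real.rpow_one]
        ring
    _ = _ := by
        rw [← Real.rpow_add hk']
        norm_num

theorem KernelBounds.norm_boundaryTransformDeriv_le (hK : KernelBounds b c Λ) (hμ : 0 < μ) {k : ℝ}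
    (hk : 0 < k) : ‖boundaryTransformDeriv b μ k‖ ≤ symbolConst (1 + c⁻¹) Λ *
      (μ * ‖boundary b k‖) * ((k + μ * ‖boundary b k‖)⁻¹) ^ 2 := by
  have := (hK.symbolData_boundary hμ hk).norm_transform_deriv_le
  rw [norm_ofReal_mul_I hk] at this
  rw [boundaryTransformDeriv, norm_mul, norm_neg, Complex.norm_I, one_mul]
  exact this

theorem KernelBounds.tendsto_boundaryTransformDeriv (hK : KernelBounds b c Λ) (hμ : 0 < μ) :
    Tendsto (boundaryTransformDeriv b μ) atTop (𝓝 0) := by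
  rw [tendsto_zero_iff_norm_tendsto_zero]
  refine squeeze_zero' (.of_forall fun _ => norm_nonneg _) ?_
    (tendsto_inv_atTop_zero.const_mul (symbolConst (1 + c⁻¹) Λ) |>.trans_eq (by rw [mul_zero]))
  filter_upwards [eventually_gt_atTop 0] with k hk
  have h := hK.symbolData_boundary hμ hk
  have hc := h.const_pos
  have hS : 0 < k + μ * ‖boundary b k‖ := by positivity
  refine (hK.norm_boundaryTransformDeriv_le hμ hk).trans ?_
  rw [mul_assoc]
  gcongr
  calc μ * ‖boundary b k‖ * ((k + μ * ‖boundary b k‖)⁻¹) ^ 2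
      ≤ (k + μ * ‖boundary b k‖) * ((k + μ * ‖boundary b k‖)⁻¹) ^ 2 := by
        gcongr
        linarith
    _ = (k + μ * ‖boundary b k‖)⁻¹ := by field_simp
    _ ≤ k⁻¹ := by
      gcongr
      have : 0 ≤ μ * ‖boundary b k‖ := by positivity
      linarith

end Volterra

/-! ### The L¹ norms of the solution and its derivatives. -/

namespace Volterra

variable {b s : ℝ → ℝ} {c Λ μ ρ C : ℝ}

/-- The two integral conditions on the boundary function, for a fixed parameter. -/
def GrowthBound (b : ℝ → ℝ) (ρ μ C : ℝ) : Prop :=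
  (∫⁻ k in Ioi (0 : ℝ), ENNReal.ofReal
      (‖boundary b k‖ / (|k| + μ * ‖boundary b k‖) ^ 2)) ≤ ENNReal.ofReal (C / μ) ∧
  (∫⁻ k in Ioi (0 : ℝ), ENNReal.ofReal
      ((‖(k : ℂ) ^ 2 * iteratedDeriv 3 (boundary b) k‖
          + ‖(k : ℂ) * iteratedDeriv 2 (boundary b) k‖
          + ‖deriv (boundary b) k‖ + 1 / μ) / (|k| + μ * ‖boundary b k‖) ^ 2))
    ≤ ENNReal.ofReal (C / μ ^ (1 + 1 / ρ))

/-- The boundary function is σ, and its derivative iσ' is part of the combination controlled by the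
second growth condition. -/
theorem lintegral_solution_le (hb : KernelAssumption b ρ) (hK : KernelBounds b c Λ) (hμ : 0 < μ)
    (hs : SolutionTransforms b μ s) (hC : GrowthBound b ρ μ C) :
    ∫⁻ t in Ioi 0, ‖s t‖ₑ ≤
      ENNReal.ofReal (4 * (symbolConst (1 + c⁻¹) Λ * C * μ ^ (-(1 / ρ)))) := by
  obtain ⟨M, hM⟩ := hK.exists_solution_interior_bound hμ hs
  obtain ⟨h1, h2⟩ := hM s (by simp)
  have hc := (hK.symbolData_boundary hμ one_pos).const_pos
  have hd := fun k (hk : 0 < k) => hasDerivAt_boundarySymbol hb hK hμ hk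
  refine lintegral_norm_le_of_boundary_variation hs.growth h1 h2 (φ := boundarySymbol b μ)
    (fun k hk => ?_) (measurable_deriv _).enorm
    (fun x y hx hxy => enorm_sub_le_lintegral_deriv hd ?_ hx hxy)
    (lintegral_deriv_le_of_le_second hμ hc.le hC.2 (.of_forall fun k hk => ?_))
  · refine (tendsto_symbol_boundarySymbol hK hμ hk).congr' ?_
    filter_upwards [self_mem_nhdsWithin] with ε hε
    exact (hs.laplace_eq_symbol (by simpa using hε)).symm
  · exact continuousOn_const.mul (continuousOn_boundarySymbolOne hb hK hμ)
  · rw [(hd k hk).deriv, norm_mul, Complex.norm_I, one_mul]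
    refine le_trans ?_ (hK.norm_boundarySymbol_combination_le hμ hk)
    have e1 := norm_nonneg (boundarySymbolOne b μ k)
    have e2 := norm_nonneg (k * Complex.I * boundarySymbolTwo b μ k)
    have e3 := norm_nonneg ((k * Complex.I) ^ 2 * boundarySymbolThree b μ k)
    linarith

/-- The boundary function is zσ - 1, whose derivative falls under the first growth condition by
cancellation; hence no power of μ remains. -/
theorem lintegral_deriv_solution_le (hb : KernelAssumption b ρ) (hK : KernelBounds b c Λ)
    (hμ : 0 < μ) (hs : SolutionTransforms b μ s) (hC : GrowthBound b ρ μ C) :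
    ∫⁻ t in Ioi 0, ‖deriv s t‖ₑ ≤ ENNReal.ofReal (4 * (symbolConst (1 + c⁻¹) Λ * C)) := by
  obtain ⟨M, hM⟩ := hK.exists_solution_interior_bound hμ hs
  obtain ⟨h1, h2⟩ := hM (deriv s) (by simp)
  have hc := (hK.symbolData_boundary hμ one_pos).const_pos
  have hd : ∀ k, 0 < k → HasDerivAt (fun k => k * Complex.I * boundarySymbol b μ k - 1)
      (Complex.I * (boundarySymbol b μ k + k * Complex.I * boundarySymbolOne b μ k)) k :=
    fun k hk => by
      refine (((hasDerivAt_mul_I k).mul (hasDerivAt_boundarySymbol hb hK hμ hk)).sub_const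
        1).congr_deriv ?_
      ring
  refine lintegral_norm_le_of_boundary_variation hs.growth_deriv h1 h2
    (φ := fun k => k * Complex.I * boundarySymbol b μ k - 1)
    (fun k hk => ?_) (measurable_deriv _).enorm
    (fun x y hx hxy => enorm_sub_le_lintegral_deriv hd ?_ hx hxy)
    (lintegral_deriv_le_of_le_first hμ hc.le hC.1 fun k hk => ?_)
  · refine (((tendsto_add_mul_I k).mul (tendsto_symbol_boundarySymbol hK hμ hk)).sub_const
      1).congr' ?_
    filter_upwards [self_mem_nhdsWithin] with ε hε
    exact (hs.laplace_deriv_eq_symbol (by simpa using hε)).symm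
  · have a0 := continuousOn_boundarySymbol hb hK hμ
    have a1 := continuousOn_boundarySymbolOne hb hK hμ
    fun_prop
  · rw [(hd k hk).deriv, norm_mul, Complex.norm_I, one_mul]
    have := (hK.symbolData_boundary hμ hk).norm_add_mul_le
    rwa [norm_ofReal_mul_I hk] at this

theorem lintegral_mul_deriv_solution_le (hb : KernelAssumption b ρ) (hK : KernelBounds b c Λ)
    (hμ : 0 < μ) (hs : SolutionTransforms b μ s) (hC : GrowthBound b ρ μ C) :
    ∫⁻ t in Ioi 0, ‖t * deriv s t‖ₑ ≤
      ENNReal.ofReal (4 * (symbolConst (1 + c⁻¹) Λ * C * μ ^ (-(1 / ρ)))) := by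
  obtain ⟨M, hM⟩ := hK.exists_solution_interior_bound hμ hs
  obtain ⟨h1, h2⟩ := hM (fun t => t * deriv s t) (by simp)
  have hc := (hK.symbolData_boundary hμ one_pos).const_pos
  have hd : ∀ k, 0 < k → HasDerivAt
      (fun k => -(boundarySymbol b μ k + k * Complex.I * boundarySymbolOne b μ k))
      (-(Complex.I * (2 * boundarySymbolOne b μ k + k * Complex.I * boundarySymbolTwo b μ k))) k :=
    fun k hk => by
      refine ((hasDerivAt_boundarySymbol hb hK hμ hk).add
        ((hasDerivAt_mul_I k).mul (hasDerivAt_boundarySymbolOne hb hK hμ hk))).neg.congr_deriv ?_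
      ring
  refine lintegral_norm_le_of_boundary_variation hs.growth_deriv.id_mul h1 h2
    (φ := fun k => -(boundarySymbol b μ k + k * Complex.I * boundarySymbolOne b μ k))
    (fun k hk => ?_) (measurable_deriv _).enorm
    (fun x y hx hxy => enorm_sub_le_lintegral_deriv hd ?_ hx hxy)
    (lintegral_deriv_le_of_le_second hμ hc.le hC.2 (.of_forall fun k hk => ?_))
  · refine ((tendsto_symbol_boundarySymbol hK hμ hk).add ((tendsto_add_mul_I k).mul
      (tendsto_symbolOne_boundarySymbolOne hK hμ hk))).neg.congr' ?_
    filter_upwards [self_mem_nhdsWithin] with ε hε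
    exact (hK.laplace_mul_deriv_solution hμ hs (by simpa using hε)).symm
  · have a1 := continuousOn_boundarySymbolOne hb hK hμ
    have a2 := continuousOn_boundarySymbolTwo hb hK hμ
    fun_prop
  · rw [(hd k hk).deriv, norm_neg, norm_mul, Complex.norm_I, one_mul]
    refine le_trans ((norm_add_le _ _).trans ?_) (hK.norm_boundarySymbol_combination_le hμ hk)
    rw [norm_mul 2, Complex.norm_ofNat]
    have e1 := norm_nonneg (boundarySymbolOne b μ k)
    have e2 := norm_nonneg (k * Complex.I * boundarySymbolTwo b μ k)
    have e3 := norm_nonneg ((k * Complex.I) ^ 2 * boundarySymbolThree b μ k)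
    linarith

theorem tendsto_laplace_boundaryTransform (hK : KernelBounds b c Λ) (hμ : 0 < μ)
    (hs : SolutionTransforms b μ s) {k : ℝ} (hk : 0 < k) :
    Tendsto (fun ε : ℝ => laplace (fun t => t * deriv (deriv s) t) (ε + k * Complex.I)) (𝓝[>] 0)
      (𝓝 (boundaryTransform b μ k)) := by
  have hz := tendsto_add_mul_I k
  refine ((((hz.const_mul 2).mul (tendsto_symbol_boundarySymbol hK hμ hk)).const_sub 1).sub
    ((hz.pow 2).mul (tendsto_symbolOne_boundarySymbolOne hK hμ hk))).congr' ?_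
  filter_upwards [self_mem_nhdsWithin] with ε hε
  exact (hK.laplace_mul_deriv_deriv_solution hμ hs (by simpa using hε)).symm

theorem lintegral_mul_deriv_deriv_solution_le (hb : KernelAssumption b ρ)
    (hK : KernelBounds b c Λ) (hμ : 0 < μ) (hs : SolutionTransforms b μ s)
    (hC : GrowthBound b ρ μ C) :
    ∫⁻ t in Ioi 0, ‖t * deriv (deriv s) t‖ₑ ≤
      ENNReal.ofReal (4 * (symbolConst (1 + c⁻¹) Λ * C)) := by
  obtain ⟨M, hM⟩ := hK.exists_solution_interior_bound hμ hs
  obtain ⟨h1, h2⟩ := hM (fun t => t * deriv (deriv s) t) (by simp)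
  have hc := (hK.symbolData_boundary hμ one_pos).const_pos
  refine lintegral_norm_le_of_boundary_variation hs.growth_deriv_deriv.id_mul h1 h2
    (fun k hk => tendsto_laplace_boundaryTransform hK hμ hs hk) (measurable_deriv _).enorm
    (fun x y hx hxy => enorm_sub_le_lintegral_deriv
      (fun k hk => hasDerivAt_boundaryTransform hb hK hμ hk)
      (continuousOn_boundaryTransformDeriv hb hK hμ) hx hxy)
    (lintegral_deriv_le_of_le_first hμ hc.le hC.1 fun k hk => ?_)
  rw [(hasDerivAt_boundaryTransform hb hK hμ hk).deriv]
  exact hK.norm_boundaryTransformDeriv_le hμ hk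

/-- The second-order criterion applied to t s'' supplies the missing factor t. The third derivative
of the symbol appears only on the axis and only almost everywhere, where g''' exists, and absolute
continuity recovers the variation from it. -/
theorem lintegral_sq_mul_deriv_deriv_solution_le (hb : KernelAssumption b ρ)
    (hK : KernelBounds b c Λ) (hμ : 0 < μ) (hs : SolutionTransforms b μ s) (hC0 : 0 ≤ C)
    (hC : GrowthBound b ρ μ C) :
    ∫⁻ t in Ioi 0, ‖t * (t * deriv (deriv s) t)‖ₑ ≤
      ENNReal.ofReal (4 * (symbolConst (1 + c⁻¹) Λ * C * μ ^ (-(1 / ρ)))) := by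
  obtain ⟨M, hM⟩ := hK.exists_solution_interior_bound hμ hs
  obtain ⟨h1, h2⟩ := hM (fun t => t * deriv (deriv s) t) (by simp)
  have hc := (hK.symbolData_boundary hμ one_pos).const_pos
  have hd := fun k (hk : 0 < k) => hasDerivAt_boundaryTransform hb hK hμ hk
  have hcont := continuousOn_boundaryTransformDeriv hb hK hμ
  refine lintegral_mul_norm_le_of_boundary_variation hs.growth_deriv_deriv.id_mul h1 h2
    (f := boundaryTransform b μ) (φ := deriv (boundaryTransform b μ))
    (D := fun k => ‖deriv (boundaryTransformDeriv b μ) k‖ₑ)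
    (fun k hk => tendsto_laplace_boundaryTransform hK hμ hs hk) (measurable_deriv _)
    (fun x y hx hxy => sub_eq_integral_deriv hd hcont hx hxy) (hK.tendsto_boundaryTransform hμ)
    ((hK.tendsto_boundaryTransformDeriv hμ).congr' ?_) (measurable_deriv _).enorm
    (fun x y hx hxy => ?_) (by positivity)
    (lintegral_deriv_le_of_le_second hμ hc.le hC.2 ?_)
  · filter_upwards [eventually_gt_atTop 0] with k hk using (hd k hk).deriv.symm
  · rw [(hd x hx).deriv, (hd y (hx.trans_le hxy)).deriv, ← integral_deriv_of_absolutelyContinuous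
      (absolutelyContinuous_boundaryTransformDeriv hb hK hμ hx hxy)]
    exact enorm_integral_le_lintegral_Ioc hxy
  · filter_upwards [hb.ae_differentiableAt_deriv_deriv_boundary] with k hk3 hk
    rw [(hasDerivAt_boundaryTransformDeriv hb hK hμ hk (hk3 hk)).deriv]
    refine le_trans ?_ (hK.norm_boundarySymbol_combination_le hμ hk)
    refine (norm_add_le _ _).trans (add_le_add_left ((norm_add_le _ _).trans ?_) _)
    rw [norm_mul 6, norm_mul 6, Complex.norm_ofNat]

theorem normLp_one_eq (f : ℝ → ℝ) : normLp 1 f = ∫⁻ t in Ioi 0, ‖f t‖ₑ :=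
  eLpNorm_one_eq_lintegral_enorm

end Volterra

end

theorem lemma4p3 (b : ℝ → ℝ) (ρ : ℝ) (hb : Volterra.KernelAssumption b ρ) :
    ∃ C₀ : ℝ, 0 < C₀ ∧ ∀ μ : ℝ, 0 < μ → ∀ s : ℝ → ℝ, Volterra.IsScalarSolution b μ s →
      (∀ x y : ℝ, 0 < x → x ≤ y → AbsolutelyContinuousOnInterval (deriv s) x y) ∧
      Volterra.normLp ∞ s ≤ 1 ∧
      Volterra.normLp 1 s ≤ ENNReal.ofReal (C₀ * μ ^ (-(1 / ρ))) ∧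
      Volterra.normLp 1 (deriv s) + Volterra.normLp 1 (fun t => t * deriv (deriv s) t)
        ≤ ENNReal.ofReal C₀ ∧
      Volterra.normLp 1 (fun t => t * deriv s t)
          + Volterra.normLp 1 (fun t => t ^ 2 * deriv (deriv s) t)
        ≤ ENNReal.ofReal (C₀ * μ ^ (-(1 / ρ))) := by
  obtain ⟨c, Λ, hK⟩ := hb.exists_kernelBounds
  obtain ⟨C, hC, hgrowth⟩ := hb.growth
  have hc := (hK.symbolData_boundary one_pos one_pos).const_pos
  set K := Volterra.symbolConst (1 + c⁻¹) Λ
  -- Each L¹ norm is bounded with constant 4KC, and at most two are added.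
  refine ⟨8 * (K * C), by positivity, fun μ hμ s hs => ?_⟩
  have hμρ : 0 < μ ^ (-(1 / ρ)) := Real.rpow_pos_of_pos hμ _
  have hT := hs.solutionTransforms hK.growth hK.re_nonneg hμ
  have hG : Volterra.GrowthBound b ρ μ C := hgrowth μ hμ
  refine ⟨hT.absolutelyContinuous, ?_, ?_, ?_, ?_⟩
  · rw [Volterra.normLp, eLpNorm_exponent_top]
    have h1 : ∀ᵐ t ∂volume.restrict (Ioi (0 : ℝ)), ‖s t‖ ≤ 1 :=
      (ae_restrict_mem measurableSet_Ioi).mono fun t ht =>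
        hs.abs_le_one hK.growth hK.re_nonneg hμ ht
    simpa using eLpNormEssSup_le_of_ae_bound h1
  · rw [Volterra.normLp_one_eq]
    refine (Volterra.lintegral_solution_le hb hK hμ hT hG).trans (ENNReal.ofReal_le_ofReal ?_)
    have : 0 < K * C * μ ^ (-(1 / ρ)) := by positivity
    linarith
  · rw [Volterra.normLp_one_eq, Volterra.normLp_one_eq]
    refine (add_le_add (Volterra.lintegral_deriv_solution_le hb hK hμ hT hG)
      (Volterra.lintegral_mul_deriv_deriv_solution_le hb hK hμ hT hG)).trans ?_
    rw [← ENNReal.ofReal_add (by positivity) (by positivity)]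
    refine ENNReal.ofReal_le_ofReal (le_of_eq ?_)
    ring
  · rw [Volterra.normLp_one_eq, Volterra.normLp_one_eq]
    have h2 := Volterra.lintegral_sq_mul_deriv_deriv_solution_le hb hK hμ hT hC.le hG
    simp only [← mul_assoc, ← sq] at h2
    refine (add_le_add (Volterra.lintegral_mul_deriv_solution_le hb hK hμ hT hG) h2).trans ?_
    rw [← ENNReal.ofReal_add (by positivity) (by positivity)]
    refine ENNReal.ofReal_le_ofReal (le_of_eq ?_)
    ring
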